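/- **Conventions.** All 2-categories are small and strict, and 2-functors and 2-natural transformations are strict. A category is regarded as a 2-category with only identity 2-cells. Let $\underline{\mathbf{2Cat}}$ be the 2-category of 2-categories, 2-functors and 2-natural transformations. The nerve of a 2-category $A$ is the simplicial category $\mathrm{N}A$ with $$\mathrm{N}_pA=\coprod_{a_0,\dots,a_p}A(a_0,a_1)\times\cdots\times A(a_{p-1},a_p),$$ and the classifying space of $A$ is the geometric realization $\|A\|=|\mathrm{Diag}\,\mathrm{N}\mathrm{N}A|$ of the simplicial set $[p]\mapsto \mathrm{N}_p\mathrm{N}_pA$. A 2-functor $F:A\to B$ is a *weak equivalence* if the induced map $\|A\|\to\|B\|$ is a homotopy equivalence. The classifying space of a simplicial 2-category $S$ is the geometric realization $\|S\|$ of the simplicial set $[p]\mapsto \mathrm{N}_p\mathrm{N}_pS_p$. For a 2-category $C$ and a 2-functor $D:C\to\underline{\mathbf{2Cat}}$, with action on cells written $D_c$, $f_*$, $\alpha_*$, the homotopy colimit $\mathrm{hocolim}_C D$ is the simplicial 2-category with 2-category of $p$-simplices $$\coprod_{c_0,\dots,c_p}D_{c_0}\times C(c_0,c_1)\times\cdots\times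 C(c_{p-1},c_p).$$ Its face $d_0$ is induced by the 2-functor $D_{c_0}\times C(c_0,c_1)\to D_{c_1}$ that sends $(x,f)$ to $f_*x$, a 1-cell $(u,\alpha):(x,f)\to(y,g)$ to $g_*u\circ\alpha_*x$, and a 2-cell $(\phi,1_\alpha)$ to $g_*\phi\circ 1_{\alpha_*x}$; the other faces and the degeneracies are $1_{D_{c_0}}\times d_i$ and $1_{D_{c_0}}\times s_i$, with $d_i,s_i$ those of $\mathrm{N}C$. For a 2-functor $D:C^{\mathrm{op}}\to\underline{\mathbf{2Cat}}$ (where $C^{\mathrm{op}}$ reverses the 1-cells only), with action on cells written $D_c$, $f^*$, $\alpha^*$, the homotopy colimit $\mathrm{hocolim}_C D$ has 2-category of $p$-simplices $$\coprod_{c_0,\dots,c_p}C(c_0,c_1)\times\cdots\times C(c_{p-1},c_p)\times D_{c_p};$$ its face $d_p$ is induced by the 2-functor $C(c_{p-1},c_p)\times D_{c_p}\to D_{c_{p-1}}$ given by the same formulas with $f^*,g^*,\alpha^*$ in place of $f_*,g_*,\alpha_*$, and its other faces and degeneracies come from those of $\mathrm{N}C$. A 2-natural transformation $\Gamma:D\Rightarrow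 E$ induces a morphism $\Gamma_*:\mathrm{hocolim}_CD\to\mathrm{hocolim}_CE$ of simplicial 2-categories, given on the summands by $\Gamma_{c_0}\times 1$ (respectively $1\times\Gamma_{c_p}$). **Theorem (Homotopy Invariance).** Let $C$ be a 2-category, let $D,E:C\to\underline{\mathbf{2Cat}}$ (or $D,E:C^{\mathrm{op}}\to\underline{\mathbf{2Cat}}$) be 2-functors, and let $\Gamma:D\Rightarrow E$ be a 2-natural transformation such that for every object $c$ of $C$ the 2-functor $\Gamma_c:D_c\to E_c$ is a weak equivalence. Then the induced map $$\Gamma_*:\|\mathrm{hocolim}_C D\|\longrightarrow\|\mathrm{hocolim}_C E\|$$ is a homotopy equivalence. -/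

import Mathlib

open CategoryTheory Bicategory Opposite

universe w₁ w₂ w₃ v₁ v₂ v₃ u₁ u₂ u₃ u

namespace TwoCategory

section
variable {B : Type u₁} [Bicategory.{w₁, v₁} B] {C : Type u₂} [Bicategory.{w₂, v₂} C]

/-- 2-functors that agree on objects, 1-cells and 2-cells are equal. -/
theorem twoFunctor_ext {F G : StrictPseudofunctor B C}
    (h₀ : ∀ x, F.obj x = G.obj x)
    (h₁ : ∀ {x y : B} (f : x ⟶ y), F.map f ≍ G.map f)
    (h₂ : ∀ {x y : B} {f g : x ⟶ y} (η : f ⟶ g), F.map₂ η ≍ G.map₂ η) : F = G := by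
  obtain ⟨⟨⟨⟨⟨⟨Fo, Fm⟩, Fm₂⟩, _, _⟩, Fid, Fcomp, _, _, _, _, _⟩, Fi, Fie⟩, Fc, Fce⟩ := F
  obtain ⟨⟨⟨⟨⟨⟨Go, Gm⟩, Gm₂⟩, _, _⟩, Gid, Gcomp, _, _, _, _, _⟩, Gi, Gie⟩, Gc, Gce⟩ := G
  dsimp at h₀ h₁ h₂ Fi Gi Fc Gc Fie Gie Fce Gce
  obtain rfl : Fo = Go := funext h₀
  obtain rfl : @Fm = @Gm := by
    funext x y f; exact eq_of_heq (h₁ f)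
  obtain rfl : @Fm₂ = @Gm₂ := by
    funext x y f g η; exact eq_of_heq (h₂ η)
  obtain rfl : @Fid = @Gid := by
    funext x; rw [Fie, Gie]
  obtain rfl : @Fcomp = @Gcomp := by
    funext x y z f g; rw [Fce, Gce]
  rfl

theorem map₂_whiskerRight_heq (K : StrictPseudofunctor B C) {a b c : B}
    {f g : a ⟶ b} (η : f ⟶ g) (h : b ⟶ c) : K.map₂ (η ▷ h) ≍ K.map₂ η ▷ K.map h := by
  simp [K.map₂_whisker_right, K.mapComp_eq_eqToIso]

theorem map₂_whiskerLeft_heq (K : StrictPseudofunctor B C) {a b c : B}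
    (f : a ⟶ b) {g h : b ⟶ c} (η : g ⟶ h) : K.map₂ (f ◁ η) ≍ K.map f ◁ K.map₂ η := by
  simp [K.map₂_whisker_left, K.mapComp_eq_eqToIso]

theorem map₂_heq {K : StrictPseudofunctor B C} {a b : B}
    {f g f' g' : a ⟶ b} {η : f ⟶ g} {η' : f' ⟶ g'} (hf : f = f') (hg : g = g') (h : η ≍ η') :
    K.map₂ η ≍ K.map₂ η' := by
  subst hf hg; cases h; rfl

/-- A 2-natural transformation between 2-functors: it is strictly natural with respect to
1-cells and 2-cells. -/
@[ext]
structure TwoNatTrans (F G : StrictPseudofunctor B C) where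
  app (a : B) : F.obj a ⟶ G.obj a
  naturality {a b : B} (f : a ⟶ b) : F.map f ≫ app b = app a ≫ G.map f
  naturality₂ {a b : B} {f g : a ⟶ b} (η : f ⟶ g) :
    F.map₂ η ▷ app b ≫ eqToHom (naturality g) = eqToHom (naturality f) ≫ app a ◁ G.map₂ η

namespace TwoNatTrans

/-- Naturality with respect to 2-cells, as a heterogeneous equality. -/
theorem naturality₂_heq {F G : StrictPseudofunctor B C} (σ : TwoNatTrans F G)
    {a b : B} {f g : a ⟶ b} (η : f ⟶ g) :
    F.map₂ η ▷ σ.app b ≍ σ.app a ◁ G.map₂ η := by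
  have h := σ.naturality₂ η
  rw [← comp_eqToHom_heq_iff (F.map₂ η ▷ σ.app b) _ (σ.naturality g), h]
  simp

end TwoNatTrans
end

section
variable {B : Type u₁} [Bicategory.{w₁, v₁} B] {C : Type u₂} [Bicategory.{w₂, v₂} C] [Strict C]

/-- Associativity of whiskerings. -/
theorem whiskerRight_comp_heq {a b c d : C} {f f' : a ⟶ b} (η : f ⟶ f') (g : b ⟶ c) (h : c ⟶ d) :
    η ▷ (g ≫ h) ≍ (η ▷ g) ▷ h := by
  simp [whiskerRight_comp, Strict.associator_eqToIso]

theorem comp_whiskerLeft_heq {a b c d : C} (f : a ⟶ b) (g : b ⟶ c) {h h' : c ⟶ d} (η : h ⟶ h') :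
    (f ≫ g) ◁ η ≍ f ◁ g ◁ η := by
  simp [comp_whiskerLeft, Strict.associator_eqToIso]

theorem whisker_assoc_heq {a b c d : C} (f : a ⟶ b) {g g' : b ⟶ c} (η : g ⟶ g') (h : c ⟶ d) :
    (f ◁ η) ▷ h ≍ f ◁ (η ▷ h) := by
  simp [whisker_assoc, Strict.associator_eqToIso]

theorem id_whiskerLeft_heq {a b : C} {f f' : a ⟶ b} (η : f ⟶ f') : 𝟙 a ◁ η ≍ η := by
  simp [id_whiskerLeft, Strict.leftUnitor_eqToIso]

theorem whiskerRight_id_heq {a b : C} {f f' : a ⟶ b} (η : f ⟶ f') : η ▷ 𝟙 b ≍ η := by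
  simp [whiskerRight_id, Strict.rightUnitor_eqToIso]

theorem whiskerLeft_heq {a b c : C} {f f' : a ⟶ b} {g₁ g₂ h₁ h₂ : b ⟶ c} {η : g₁ ⟶ h₁}
    {θ : g₂ ⟶ h₂} (hf : f = f') (hg : g₁ = g₂) (hh : h₁ = h₂) (h : η ≍ θ) :
    f ◁ η ≍ f' ◁ θ := by
  subst hf hg hh; cases h; rfl

theorem whiskerRight_heq {a b c : C} {g g' : b ⟶ c} {f₁ f₂ h₁ h₂ : a ⟶ b} {η : f₁ ⟶ h₁}
    {θ : f₂ ⟶ h₂} (hg : g = g') (hf : f₁ = f₂) (hh : h₁ = h₂) (h : η ≍ θ) :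
    η ▷ g ≍ θ ▷ g' := by
  subst hg hf hh; cases h; rfl

namespace TwoNatTrans

/-- A 2-natural transformation, from 2-cell naturality given as a heterogeneous equality. -/
@[simps]
def ofHEq {F G : StrictPseudofunctor B C} (app : ∀ a, F.obj a ⟶ G.obj a)
    (nat : ∀ {a b : B} (f : a ⟶ b), F.map f ≫ app b = app a ≫ G.map f)
    (nat₂ : ∀ {a b : B} {f g : a ⟶ b} (η : f ⟶ g), F.map₂ η ▷ app b ≍ app a ◁ G.map₂ η) :
    TwoNatTrans F G where
  app := app
  naturality := nat
  naturality₂ η := by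
    apply eq_of_heq
    rw [comp_eqToHom_heq_iff, heq_eqToHom_comp_iff]
    exact nat₂ η

/-- The identity 2-natural transformation. -/
def id (F : StrictPseudofunctor B C) : TwoNatTrans F F :=
  ofHEq (fun a => 𝟙 (F.obj a)) (fun f => by simp)
    (fun η => (whiskerRight_id_heq _).trans (id_whiskerLeft_heq _).symm)

/-- Vertical composition of 2-natural transformations. -/
def vcomp {F G H : StrictPseudofunctor B C} (σ : TwoNatTrans F G) (τ : TwoNatTrans G H) :
    TwoNatTrans F H :=
  ofHEq (fun a => σ.app a ≫ τ.app a)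
    (fun f => by
      rw [← Strict.assoc, σ.naturality, Strict.assoc, τ.naturality, Strict.assoc])
    (fun {a b f g} η => by
      refine (whiskerRight_comp_heq _ _ _).trans ?_
      refine (whiskerRight_heq rfl (σ.naturality f) (σ.naturality g) (σ.naturality₂_heq η)).trans ?_
      refine (whisker_assoc_heq _ _ _).trans ?_
      refine (whiskerLeft_heq rfl (τ.naturality f) (τ.naturality g) (τ.naturality₂_heq η)).trans ?_
      exact (comp_whiskerLeft_heq _ _ _).symm)

instance : Category (StrictPseudofunctor B C) where
  Hom F G := TwoNatTrans F G
  id F := id F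
  comp σ τ := vcomp σ τ
  id_comp σ := by
    apply TwoNatTrans.ext; funext a; exact Strict.id_comp _
  comp_id σ := by
    apply TwoNatTrans.ext; funext a; exact Strict.comp_id _
  assoc σ τ υ := by
    apply TwoNatTrans.ext; funext a; exact Strict.assoc _ _ _

@[ext]
theorem hom_ext {F G : StrictPseudofunctor B C} {σ τ : F ⟶ G}
    (h : ∀ a, TwoNatTrans.app σ a = TwoNatTrans.app τ a) : σ = τ :=
  TwoNatTrans.ext (funext h)

end TwoNatTrans
end
/-- A small (strict) 2-category. -/
structure TwoCat where
  carrier : Type u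
  [bicategory : Bicategory.{u, u} carrier]
  [strict : Strict carrier]

namespace TwoCat

instance : CoeSort TwoCat.{u} (Type u) := ⟨TwoCat.carrier⟩

attribute [instance] TwoCat.bicategory TwoCat.strict

/-- Whiskering of a 2-natural transformation with a 2-functor on the source side. -/
def whiskerL {A B C : TwoCat.{u}} (F : StrictPseudofunctor A B) {G H : StrictPseudofunctor B C}
    (σ : TwoNatTrans G H) : TwoNatTrans (F.comp G) (F.comp H) where
  app a := σ.app (F.obj a)
  naturality f := σ.naturality (F.map f)
  naturality₂ η := σ.naturality₂ (F.map₂ η)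

/-- Whiskering of a 2-natural transformation with a 2-functor on the target side. -/
def whiskerR {A B C : TwoCat.{u}} {F G : StrictPseudofunctor A B} (σ : TwoNatTrans F G)
    (K : StrictPseudofunctor B C) : TwoNatTrans (F.comp K) (G.comp K) :=
  TwoNatTrans.ofHEq (fun a => K.map (σ.app a))
    (fun f => by
      change K.map (F.map f) ≫ K.map _ = K.map _ ≫ K.map (G.map f)
      rw [← K.map_comp, ← K.map_comp, σ.naturality])
    (fun {a b f g} η => by
      change K.map₂ (F.map₂ η) ▷ K.map (σ.app b) ≍ K.map (σ.app a) ◁ K.map₂ (G.map₂ η)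
      refine (map₂_whiskerRight_heq K _ _).symm.trans ?_
      refine HEq.trans ?_ (map₂_whiskerLeft_heq K _ _)
      exact map₂_heq (σ.naturality f) (σ.naturality g) (σ.naturality₂_heq η))

theorem id_comp' {A B : TwoCat.{u}} (F : StrictPseudofunctor A B) :
    (StrictPseudofunctor.id A).comp F = F :=
  twoFunctor_ext (fun _ => rfl) (fun _ => HEq.rfl) (fun _ => HEq.rfl)

theorem comp_id' {A B : TwoCat.{u}} (F : StrictPseudofunctor A B) :
    F.comp (StrictPseudofunctor.id B) = F :=
  twoFunctor_ext (fun _ => rfl) (fun _ => HEq.rfl) (fun _ => HEq.rfl)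

theorem assoc' {A B C D : TwoCat.{u}} (F : StrictPseudofunctor A B)
    (G : StrictPseudofunctor B C) (H : StrictPseudofunctor C D) :
    (F.comp G).comp H = F.comp (G.comp H) :=
  twoFunctor_ext (fun _ => rfl) (fun _ => HEq.rfl) (fun _ => HEq.rfl)

theorem conj_app {A B : TwoCat.{u}} {F F' G G' : StrictPseudofunctor A B} (h : F = F')
    (h' : G' = G) (σ : F' ⟶ G') (a : A) :
    TwoNatTrans.app (eqToHom h ≫ σ ≫ eqToHom h') a ≍ TwoNatTrans.app σ a := by
  subst h h'; simp

theorem whiskerL_eqToHom {A B C : TwoCat.{u}} (F : StrictPseudofunctor A B)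
    {G H : StrictPseudofunctor B C} (h : G = H) :
    whiskerL F (eqToHom h : G ⟶ H) =
      (eqToHom (congrArg F.comp h) : F.comp G ⟶ F.comp H) := by
  subst h; rfl

theorem whiskerR_eqToHom {A B C : TwoCat.{u}} {F G : StrictPseudofunctor A B} (h : F = G)
    (K : StrictPseudofunctor B C) :
    whiskerR (eqToHom h : F ⟶ G) K =
      (eqToHom (congrArg (fun X => X.comp K) h) : F.comp K ⟶ G.comp K) := by
  subst h; apply TwoNatTrans.hom_ext; intro a; exact K.map_id _

theorem pentagon' {A B C D E : TwoCat.{u}} (F : StrictPseudofunctor A B)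
    (G : StrictPseudofunctor B C) (H : StrictPseudofunctor C D) (K : StrictPseudofunctor D E) :
    (show ((F.comp G).comp H).comp K ⟶ (F.comp (G.comp H)).comp K from
        whiskerR (eqToHom (assoc' F G H)) K) ≫
      (show _ ⟶ F.comp ((G.comp H).comp K) from eqToHom (assoc' F (G.comp H) K)) ≫
      (show _ ⟶ F.comp (G.comp (H.comp K)) from whiskerL F (eqToHom (assoc' G H K))) =
    (show _ ⟶ (F.comp G).comp (H.comp K) from eqToHom (assoc' (F.comp G) H K)) ≫
      eqToHom (assoc' F G (H.comp K)) := by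
  have h₁ := whiskerR_eqToHom (assoc' F G H) K
  have h₂ := whiskerL_eqToHom F (assoc' G H K)
  dsimp only
  rw [h₁, h₂]
  exact (eqToHom_trans_assoc _ _ _).trans ((eqToHom_trans _ _).trans (eqToHom_trans _ _).symm)

theorem triangle' {A B C : TwoCat.{u}} (F : StrictPseudofunctor A B)
    (G : StrictPseudofunctor B C) :
    (show (F.comp (StrictPseudofunctor.id B)).comp G ⟶
        F.comp ((StrictPseudofunctor.id B).comp G) from eqToHom (assoc' F (StrictPseudofunctor.id B) G)) ≫
      (show _ ⟶ F.comp G from whiskerL F (eqToHom (id_comp' G))) =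
    whiskerR (eqToHom (comp_id' F)) G := by
  have h₁ := whiskerR_eqToHom (comp_id' F) G
  have h₂ := whiskerL_eqToHom F (id_comp' G)
  dsimp only
  rw [h₁, h₂]
  exact eqToHom_trans _ _

/-- The underlying structure of 2-categories and 2-functors. -/
instance : CategoryStruct TwoCat.{u} where
  Hom A B := StrictPseudofunctor A B
  id A := StrictPseudofunctor.id A
  comp F G := StrictPseudofunctor.comp F G

/-- The 2-category of small 2-categories, 2-functors and 2-natural transformations. -/
instance : Bicategory TwoCat.{u} where
  homCategory A B := inferInstanceAs (Category (StrictPseudofunctor A B))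
  whiskerLeft F _ _ σ := whiskerL F σ
  whiskerRight σ K := whiskerR σ K
  associator {A _ _ D} F G H := eqToIso (C := StrictPseudofunctor A D) (assoc' F G H)
  leftUnitor {A B} F := eqToIso (C := StrictPseudofunctor A B) (id_comp' F)
  rightUnitor {A B} F := eqToIso (C := StrictPseudofunctor A B) (comp_id' F)
  whiskerLeft_id F G := rfl
  whiskerLeft_comp F _ _ _ σ τ := rfl
  id_whiskerLeft σ := by
    apply TwoNatTrans.hom_ext; intro a; exact (eq_of_heq (conj_app (id_comp' _) (id_comp' _).symm σ a)).symm
  comp_whiskerLeft F G _ _ σ := by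
    apply TwoNatTrans.hom_ext; intro a; exact (eq_of_heq (conj_app (assoc' _ _ _) (assoc' _ _ _).symm (whiskerL F (whiskerL G σ)) a)).symm
  id_whiskerRight F G := by
    apply TwoNatTrans.hom_ext; intro a; exact G.map_id _
  comp_whiskerRight σ τ K := by
    apply TwoNatTrans.hom_ext; intro a; exact K.map_comp _ _
  whiskerRight_id σ := by
    apply TwoNatTrans.hom_ext; intro a; exact (eq_of_heq (conj_app (comp_id' _) (comp_id' _).symm σ a)).symm
  whiskerRight_comp σ G H := by
    apply TwoNatTrans.hom_ext; intro a; exact (eq_of_heq (conj_app (assoc' _ _ _).symm (assoc' _ _ _) (whiskerR (whiskerR σ G) H) a)).symm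
  whisker_assoc F _ _ σ H := by
    apply TwoNatTrans.hom_ext; intro a; exact (eq_of_heq (conj_app (assoc' _ _ _) (assoc' _ _ _).symm (whiskerL F (whiskerR σ H)) a)).symm
  whisker_exchange σ τ := by
    apply TwoNatTrans.hom_ext; intro a
    exact (TwoNatTrans.naturality τ (TwoNatTrans.app σ a)).symm
  pentagon F G H K := pentagon' F G H K
  triangle F G := triangle' F G

instance : Strict TwoCat.{u} where
  id_comp := id_comp'
  comp_id := comp_id'
  assoc := assoc'

end TwoCat
section Chains

variable {ι κ : Type} [Preorder ι] [Preorder κ]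
variable {B : Type u₁} [Bicategory.{w₁, v₁} B] {B' : Type u₂} [Bicategory.{w₂, v₂} B']

/-- Horizontal composition of 2-cells. -/
def hcomp {a b c : B} {f f' : a ⟶ b} {g g' : b ⟶ c} (α : f ⟶ f') (β : g ⟶ g') :
    f ≫ g ⟶ f' ≫ g' :=
  α ▷ g ≫ f' ◁ β

/-- A composable chain of 1-cells through given objects `c i`, recorded together with all its
composites `c i ⟶ c j`. For `ι = Fin (n + 1)` this is the same as a family of `n` consecutive
1-cells, that is, an element of `C(c₀, c₁) × ⋯ × C(cₙ₋₁, cₙ)`. -/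
@[ext]
structure Chain (c : ι → B) where
  hom {i j : ι} (h : i ≤ j) : c i ⟶ c j
  hom_refl (i : ι) : hom (le_refl i) = 𝟙 (c i)
  hom_trans {i j k : ι} (h : i ≤ j) (h' : j ≤ k) : hom (h.trans h') = hom h ≫ hom h'

/-- A family of 2-cells between the 1-cells of two chains through the same objects, recorded
together with all its horizontal composites. For `ι = Fin (n + 1)` this is the same as a family of
`n` 2-cells between the consecutive 1-cells, that is, a morphism of the product category
`C(c₀, c₁) × ⋯ × C(cₙ₋₁, cₙ)`. -/
@[ext]
structure ChainHom {c : ι → B} (f g : Chain c) where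
  cell {i j : ι} (h : i ≤ j) : f.hom h ⟶ g.hom h
  cell_refl (i : ι) : cell (le_refl i) ≍ 𝟙 (𝟙 (c i))
  cell_trans {i j k : ι} (h : i ≤ j) (h' : j ≤ k) :
    cell (h.trans h') ≍ hcomp (cell h) (cell h')

theorem comp_heq {A : Type u₁} [Category.{v₁} A] {x y z x' y' z' : A} {f : x ⟶ y} {g : y ⟶ z}
    {f' : x' ⟶ y'} {g' : y' ⟶ z'} (hx : x = x') (hy : y = y') (hz : z = z') (hf : f ≍ f')
    (hg : g ≍ g') : f ≫ g ≍ f' ≫ g' := by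
  subst hx hy hz; cases hf; cases hg; rfl

theorem id_heq {A : Type u₁} [Category.{v₁} A] {x y : A} (h : x = y) : 𝟙 x ≍ 𝟙 y := by
  subst h; rfl

theorem hcomp_comp {a b c : B} {f f' f'' : a ⟶ b} {g g' g'' : b ⟶ c} (α : f ⟶ f') (α' : f' ⟶ f'')
    (β : g ⟶ g') (β' : g' ⟶ g'') :
    hcomp (α ≫ α') (β ≫ β') = hcomp α β ≫ hcomp α' β' := by
  simp [hcomp, whisker_exchange_assoc]

/-- Chains through given objects form a category (with composition of 2-cells). -/
instance (c : ι → B) : Category (Chain c) where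
  Hom f g := ChainHom f g
  id f :=
    { cell h := 𝟙 (f.hom h)
      cell_refl i := id_heq (f.hom_refl i)
      cell_trans h h' := (id_heq (f.hom_trans h h')).trans (by simp [hcomp]) }
  comp {f g k} α β :=
    { cell h := α.cell h ≫ β.cell h
      cell_refl i := (comp_heq (f.hom_refl i) (g.hom_refl i) (k.hom_refl i) (α.cell_refl i)
        (β.cell_refl i)).trans (by simp)
      cell_trans h h' := (comp_heq (f.hom_trans h h') (g.hom_trans h h') (k.hom_trans h h')
        (α.cell_trans h h') (β.cell_trans h h')).trans (by rw [hcomp_comp]) }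
  id_comp α := ChainHom.ext (by funext i j h; exact Category.id_comp _)
  comp_id α := ChainHom.ext (by funext i j h; exact Category.comp_id _)
  assoc α β γ := ChainHom.ext (by funext i j h; exact Category.assoc _ _ _)

/-- Reindexing of chains along a monotone map. -/
def Chain.restrict (φ : κ →o ι) (c : ι → B) : Chain c ⥤ Chain (c ∘ φ) where
  obj f :=
    { hom h := f.hom (φ.monotone h)
      hom_refl i := f.hom_refl (φ i)
      hom_trans h h' := f.hom_trans (φ.monotone h) (φ.monotone h') }
  map α :=
    { cell h := α.cell (φ.monotone h)
      cell_refl i := α.cell_refl (φ i)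
      cell_trans h h' := α.cell_trans (φ.monotone h) (φ.monotone h') }

theorem map₂_hcomp_heq (K : StrictPseudofunctor B B') {a b c : B} {f f' : a ⟶ b} {g g' : b ⟶ c}
    (α : f ⟶ f') (β : g ⟶ g') : K.map₂ (hcomp α β) ≍ hcomp (K.map₂ α) (K.map₂ β) := by
  have h : K.map₂ (hcomp α β) = eqToHom (K.map_comp f g) ≫ hcomp (K.map₂ α) (K.map₂ β) ≫
      eqToHom (K.map_comp f' g').symm := by
    simp [hcomp, K.map₂_whisker_right, K.map₂_whisker_left, K.mapComp_eq_eqToIso]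
  rw [h, eqToHom_comp_heq_iff, comp_eqToHom_heq_iff]

/-- The image of a chain under a 2-functor. -/
def Chain.image (K : StrictPseudofunctor B B') (c : ι → B) :
    Chain c ⥤ Chain (fun i => K.obj (c i)) where
  obj f :=
    { hom h := K.map (f.hom h)
      hom_refl i := by rw [f.hom_refl, K.map_id]
      hom_trans h h' := by rw [f.hom_trans h h', K.map_comp] }
  map {f g} α :=
    { cell h := K.map₂ (α.cell h)
      cell_refl i := (map₂_heq (f.hom_refl i) (g.hom_refl i) (α.cell_refl i)).trans (by
        rw [K.map₂_id]; exact id_heq (K.map_id _))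
      cell_trans h h' := (map₂_heq (f.hom_trans h h') (g.hom_trans h h')
        (α.cell_trans h h')).trans (map₂_hcomp_heq K _ _) }
  map_id f := ChainHom.ext (by funext i j h; exact K.map₂_id _)
  map_comp α β := ChainHom.ext (by funext i j h; exact K.map₂_comp _ _)

end Chains

section Nerve

/-- The functor between disjoint unions of categories induced by a map of the index sets and
functors between the summands. -/
def sigmaFunctor {I J : Type u} {A : I → Type u} {A' : J → Type u} [∀ i, Category.{u} (A i)]
    [∀ j, Category.{u} (A' j)] (e : I → J) (F : ∀ i, A i ⥤ A' (e i)) :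
    (Σ i, A i) ⥤ (Σ j, A' j) :=
  Sigma.desc fun i => F i ⋙ Sigma.incl (e i)

theorem sigma_functor_ext {I : Type u} {A : I → Type u} [∀ i, Category.{u} (A i)] {E : Type u}
    [Category.{u} E] {F G : (Σ i, A i) ⥤ E} (h : ∀ i, Sigma.incl i ⋙ F = Sigma.incl i ⋙ G) :
    F = G := by
  refine Functor.hext (fun ⟨i, x⟩ => Functor.congr_obj (h i) x) ?_
  rintro ⟨i, x⟩ ⟨_, y⟩ ⟨f⟩
  have := Functor.congr_hom (h i) f
  dsimp at this
  exact (conj_eqToHom_iff_heq _ _ (Functor.congr_obj (h i) x) (Functor.congr_obj (h i) _)).1 this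

/-- The nerve of a 2-category `C`: the simplicial category whose category of `p`-simplices is the
disjoint union over `c₀, …, cₚ` of the categories `C(c₀, c₁) × ⋯ × C(cₚ₋₁, cₚ)`. -/
def ner (C : TwoCat.{u}) : SimplicialObject Cat.{u, u} where
  obj p := Cat.of (Σ c : Fin (p.unop.len + 1) → C, Chain c)
  map φ := (sigmaFunctor.{u} (fun (c : _ → C) => c ∘ φ.unop.toOrderHom)
    (fun c => Chain.restrict φ.unop.toOrderHom c)).toCatHom
  map_id p := by
    apply Cat.ext
    apply sigma_functor_ext
    intro c; rfl
  map_comp φ ψ := by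
    apply Cat.ext
    apply sigma_functor_ext
    intro c; rfl

/-- The nerve as a functor from 2-categories and 2-functors to simplicial categories. -/
def nerFunctor : TwoCat.{u} ⥤ SimplicialObject Cat.{u, u} where
  obj C := ner C
  map {C C'} K :=
    { app p := (sigmaFunctor.{u} (A' := fun c : Fin (p.unop.len + 1) → C' => Chain c)
        (fun (c : Fin (p.unop.len + 1) → C) i => (show StrictPseudofunctor C C' from K).obj (c i))
        (fun c => Chain.image K c)).toCatHom
      naturality p q φ := by
        apply Cat.ext
        apply sigma_functor_ext
        intro c; rfl }
  map_id C := by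
    ext p
    apply sigma_functor_ext
    intro c; rfl
  map_comp K K' := by
    ext p
    apply sigma_functor_ext
    intro c; rfl

/-- The diagonal of a bisimplicial set. -/
def diag : SimplicialObject SSet.{u} ⥤ SSet.{u} where
  obj X :=
    { obj p := (X.obj p).obj p
      map {p q} φ := (X.map φ).app p ≫ (X.obj q).map φ
      map_id p := by simp
      map_comp {p q r} φ ψ := by
        simp }
  map f :=
    { app p := (f.app p).app p
      naturality p q φ := by
        have h := congrArg (fun k => NatTrans.app k p) (f.naturality φ)
        have h' := (f.app q).naturality φ
        dsimp at h h' ⊢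
        rw [Category.assoc, h', reassoc_of% h] }
  map_id X := rfl
  map_comp f g := rfl

/-- The diagonal of the double nerve of a 2-category, with `p`-simplices `ner_p ner_p C`. -/
def diagDoubleNerve : TwoCat.{u} ⥤ SSet.{u} :=
  nerFunctor ⋙ (SimplicialObject.whiskering _ _).obj nerveFunctor ⋙ diag

/-- The classifying space functor of 2-categories. -/
noncomputable def classifyingSpace : TwoCat.{u} ⥤ TopCat.{u} :=
  diagDoubleNerve ⋙ SSet.toTop

/-- The classifying space functor of simplicial 2-categories: the geometric realization of the
simplicial set with `p`-simplices `ner_p ner_p S_p`. -/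
noncomputable def classifyingSpaceSimplicial : SimplicialObject TwoCat.{u} ⥤ TopCat.{u} :=
  (SimplicialObject.whiskering _ _).obj diagDoubleNerve ⋙ diag ⋙ SSet.toTop

/-- A continuous map is a homotopy equivalence. -/
def IsHomotopyEquivalence {X Y : TopCat.{u}} (f : X ⟶ Y) : Prop :=
  ∃ e : ContinuousMap.HomotopyEquiv X Y, e.toFun = f.hom

/-- A 2-functor is a weak equivalence if it induces a homotopy equivalence on classifying
spaces. -/
def IsWeakEquivalence {A B : TwoCat.{u}} (F : A ⟶ B) : Prop :=
  IsHomotopyEquivalence (classifyingSpace.map F)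

end Nerve

section Coproducts

variable {I : Type u} (A : I → TwoCat.{u})

/-- The disjoint union of a family of 2-categories. -/
structure Coprod where
  idx : I
  pt : A idx

namespace Coprod

variable {A}

/-- The 1-cells of a disjoint union: those of the summands. -/
inductive Hom : Coprod A → Coprod A → Type u
  | mk {i : I} {x y : A i} (f : x ⟶ y) : Hom ⟨i, x⟩ ⟨i, y⟩

/-- The 2-cells of a disjoint union: those of the summands. -/
inductive Hom₂ : ∀ {X Y : Coprod A}, Hom X Y → Hom X Y → Type u
  | mk {i : I} {x y : A i} {f g : x ⟶ y} (η : f ⟶ g) : Hom₂ (Hom.mk f) (Hom.mk g)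

instance : CategoryStruct (Coprod A) where
  Hom X Y := Hom X Y
  id X := Hom.mk (𝟙 X.pt)
  comp
    | .mk f, .mk g => .mk (f ≫ g)

instance (X Y : Coprod A) : Category (X ⟶ Y) where
  Hom f g := Hom₂ f g
  id
    | .mk f => .mk (𝟙 f)
  comp
    | .mk η, .mk θ => .mk (η ≫ θ)
  id_comp := by
    rintro _ _ ⟨η⟩
    exact congrArg Hom₂.mk (Category.id_comp η)
  comp_id := by
    rintro _ _ ⟨η⟩
    exact congrArg Hom₂.mk (Category.comp_id η)
  assoc := by
    rintro _ _ _ _ ⟨η⟩ ⟨θ⟩ ⟨κ⟩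
    exact congrArg Hom₂.mk (Category.assoc η θ κ)

/-- The inclusion of a hom-category of a summand. -/
def inclHom {i : I} (x y : A i) : (x ⟶ y) ⥤ ((⟨i, x⟩ : Coprod A) ⟶ ⟨i, y⟩) where
  obj f := Hom.mk f
  map η := Hom₂.mk η

/-- Left whiskering in a disjoint union. -/
def whiskerL : ∀ {X Y Z : Coprod A} (f : X ⟶ Y) {g h : Y ⟶ Z} (_ : g ⟶ h), (f ≫ g ⟶ f ≫ h)
  | _, _, _, Hom.mk f, _, _, Hom₂.mk η => Hom₂.mk (f ◁ η)

/-- Right whiskering in a disjoint union. -/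
def whiskerR : ∀ {X Y Z : Coprod A} {f g : X ⟶ Y} (_ : f ⟶ g) (h : Y ⟶ Z), (f ≫ h ⟶ g ≫ h)
  | _, _, _, _, _, Hom₂.mk η, Hom.mk h => Hom₂.mk (η ▷ h)

/-- The associators of a disjoint union. -/
def assoc : ∀ {W X Y Z : Coprod A} (f : W ⟶ X) (g : X ⟶ Y) (h : Y ⟶ Z),
    (f ≫ g) ≫ h ≅ f ≫ g ≫ h
  | _, _, _, _, Hom.mk f, Hom.mk g, Hom.mk h => (inclHom _ _).mapIso (α_ f g h)

/-- The left unitors of a disjoint union. -/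
def unitL : ∀ {X Y : Coprod A} (f : X ⟶ Y), 𝟙 X ≫ f ≅ f
  | _, _, Hom.mk f => (inclHom _ _).mapIso (λ_ f)

/-- The right unitors of a disjoint union. -/
def unitR : ∀ {X Y : Coprod A} (f : X ⟶ Y), f ≫ 𝟙 Y ≅ f
  | _, _, Hom.mk f => (inclHom _ _).mapIso (ρ_ f)

instance : Bicategory (Coprod A) where
  whiskerLeft f _ _ η := whiskerL f η
  whiskerRight η h := whiskerR η h
  associator f g h := assoc f g h
  leftUnitor f := unitL f
  rightUnitor f := unitR f
  whiskerLeft_id := by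
    rintro _ _ _ ⟨f⟩ ⟨g⟩
    exact congrArg Hom₂.mk (whiskerLeft_id f g)
  whiskerLeft_comp := by
    rintro _ _ _ ⟨f⟩ _ _ _ ⟨η⟩ ⟨θ⟩
    exact congrArg Hom₂.mk (whiskerLeft_comp f η θ)
  id_whiskerLeft := by
    rintro _ _ _ _ ⟨η⟩
    exact congrArg Hom₂.mk (id_whiskerLeft η)
  comp_whiskerLeft := by
    rintro _ _ _ _ ⟨f⟩ ⟨g⟩ _ _ ⟨η⟩
    exact congrArg Hom₂.mk (comp_whiskerLeft f g η)
  id_whiskerRight := by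
    rintro _ _ _ ⟨f⟩ ⟨g⟩
    exact congrArg Hom₂.mk (id_whiskerRight f g)
  comp_whiskerRight := by
    rintro _ _ _ _ _ _ ⟨η⟩ ⟨θ⟩ ⟨g⟩
    exact congrArg Hom₂.mk (comp_whiskerRight η θ g)
  whiskerRight_id := by
    rintro _ _ _ _ ⟨η⟩
    exact congrArg Hom₂.mk (whiskerRight_id η)
  whiskerRight_comp := by
    rintro _ _ _ _ _ _ ⟨η⟩ ⟨g⟩ ⟨h⟩
    exact congrArg Hom₂.mk (whiskerRight_comp η g h)
  whisker_assoc := by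
    rintro _ _ _ _ ⟨f⟩ _ _ ⟨η⟩ ⟨h⟩
    exact congrArg Hom₂.mk (whisker_assoc f η h)
  whisker_exchange := by
    rintro _ _ _ _ _ _ _ ⟨η⟩ ⟨θ⟩
    exact congrArg Hom₂.mk (whisker_exchange η θ)
  pentagon := by
    rintro _ _ _ _ _ ⟨f⟩ ⟨g⟩ ⟨h⟩ ⟨k⟩
    exact congrArg Hom₂.mk (pentagon f g h k)
  triangle := by
    rintro _ _ _ ⟨f⟩ ⟨g⟩
    exact congrArg Hom₂.mk (triangle f g)

theorem mapIso_eqToIso {i : I} {x y : A i} {f g : x ⟶ y} (h : f = g) :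
    (inclHom x y).mapIso (eqToIso h) = eqToIso (congrArg (inclHom x y).obj h) := by
  subst h; rfl

instance : Strict (Coprod A) where
  id_comp := by
    rintro _ _ ⟨f⟩
    exact congrArg Hom.mk (Strict.id_comp f)
  comp_id := by
    rintro _ _ ⟨f⟩
    exact congrArg Hom.mk (Strict.comp_id f)
  assoc := by
    rintro _ _ _ _ ⟨f⟩ ⟨g⟩ ⟨h⟩
    exact congrArg Hom.mk (Strict.assoc f g h)
  leftUnitor_eqToIso := by
    rintro _ _ ⟨f⟩
    exact (congrArg (inclHom _ _).mapIso (Strict.leftUnitor_eqToIso f)).trans (mapIso_eqToIso _)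
  rightUnitor_eqToIso := by
    rintro _ _ ⟨f⟩
    exact (congrArg (inclHom _ _).mapIso (Strict.rightUnitor_eqToIso f)).trans (mapIso_eqToIso _)
  associator_eqToIso := by
    rintro _ _ _ _ ⟨f⟩ ⟨g⟩ ⟨h⟩
    exact (congrArg (inclHom _ _).mapIso (Strict.associator_eqToIso f g h)).trans
      (mapIso_eqToIso _)

theorem heq_mk {i : I} {x y : A i} {f g f' g' : x ⟶ y} {η : f ⟶ g} {η' : f' ⟶ g'}
    (hf : f = f') (hg : g = g') (h : η ≍ η') :
    (inclHom x y).map η ≍ (inclHom x y).map η' := by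
  subst hf hg; cases h; rfl

/-- The action on 1-cells of `Coprod.map`. -/
def mapHom {J : Type u} {A' : J → TwoCat.{u}} (e : I → J)
    (F : ∀ i, StrictPseudofunctor (A i) (A' (e i))) : ∀ {X Y : Coprod A} (_ : X ⟶ Y),
      ((⟨e X.idx, (F X.idx).obj X.pt⟩ : Coprod A') ⟶ ⟨e Y.idx, (F Y.idx).obj Y.pt⟩)
  | _, _, Hom.mk f => Hom.mk ((F _).map f)

/-- The action on 2-cells of `Coprod.map`. -/
def mapHom₂ {J : Type u} {A' : J → TwoCat.{u}} (e : I → J)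
    (F : ∀ i, StrictPseudofunctor (A i) (A' (e i))) : ∀ {X Y : Coprod A} {f g : X ⟶ Y}
      (_ : f ⟶ g), (mapHom e F f ⟶ mapHom e F g)
  | _, _, _, _, Hom₂.mk η => Hom₂.mk ((F _).map₂ η)

/-- The 2-functor between disjoint unions induced by a map of the index sets and 2-functors
between the summands. -/
def map {J : Type u} {A' : J → TwoCat.{u}} (e : I → J)
    (F : ∀ i, StrictPseudofunctor (A i) (A' (e i))) :
    StrictPseudofunctor (Coprod A) (Coprod A') :=
  StrictPseudofunctor.mk''
    { obj X := ⟨e X.idx, (F X.idx).obj X.pt⟩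
      map f := mapHom e F f
      map₂ η := mapHom₂ e F η
      map₂_id := by
        rintro _ _ ⟨f⟩
        exact congrArg Hom₂.mk ((F _).map₂_id f)
      map₂_comp := by
        rintro _ _ _ _ _ ⟨η⟩ ⟨θ⟩
        exact congrArg Hom₂.mk ((F _).map₂_comp η θ)
      map_id X := congrArg Hom.mk ((F _).map_id X.pt)
      map_comp := by
        rintro _ _ _ ⟨f⟩ ⟨g⟩
        exact congrArg Hom.mk ((F _).map_comp f g)
      map₂_whisker_left := by
        rintro _ _ _ ⟨f⟩ _ _ ⟨η⟩
        apply eq_of_heq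
        rw [heq_eqToHom_comp_iff, heq_comp_eqToHom_iff]
        exact heq_mk ((F _).map_comp _ _) ((F _).map_comp _ _) (map₂_whiskerLeft_heq (F _) f η)
      map₂_whisker_right := by
        rintro _ _ _ _ _ ⟨η⟩ ⟨g⟩
        apply eq_of_heq
        rw [heq_eqToHom_comp_iff, heq_comp_eqToHom_iff]
        exact heq_mk ((F _).map_comp _ _) ((F _).map_comp _ _) (map₂_whiskerRight_heq (F _) η g) }

theorem map_comp_map {J K : Type u} {A' : J → TwoCat.{u}} {A'' : K → TwoCat.{u}} (e : I → J)
    (F : ∀ i, StrictPseudofunctor (A i) (A' (e i))) (e' : J → K)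
    (F' : ∀ j, StrictPseudofunctor (A' j) (A'' (e' j))) :
    (map e F).comp (map e' F') = map (e' ∘ e) (fun i => (F i).comp (F' (e i))) :=
  twoFunctor_ext (fun _ => rfl) (by rintro _ _ ⟨f⟩; rfl) (by rintro _ _ _ _ ⟨η⟩; rfl)

theorem map_id : map (fun i : I => i) (fun i => StrictPseudofunctor.id (A i)) =
    StrictPseudofunctor.id (Coprod A) :=
  twoFunctor_ext (fun _ => rfl) (by rintro _ _ ⟨f⟩; rfl) (by rintro _ _ _ _ ⟨η⟩; rfl)

end Coprod
end Coproducts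

section Action

/-- The 2-functor underlying a 1-cell of the 2-category of 2-categories. -/
abbrev TwoCat.fn {A B : TwoCat.{u}} (F : A ⟶ B) : StrictPseudofunctor A B := F

/-- The components of a 2-cell of the 2-category of 2-categories. -/
abbrev TwoCat.comp₂ {A B : TwoCat.{u}} {F G : A ⟶ B} (σ : F ⟶ G) (x : A) :
    (TwoCat.fn F).obj x ⟶ (TwoCat.fn G).obj x :=
  TwoNatTrans.app σ x

open TwoCat

variable {A B C : TwoCat.{u}} {K K' K'' : Type u} [Category.{u} K] [Category.{u} K']
  [Category.{u} K'']

/-- The 2-category `A × K`, where the category `K` is viewed as a 2-category with only identity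
2-cells. -/
def prodCat (A : TwoCat.{u}) (K : Type u) [Category.{u} K] : TwoCat.{u} :=
  letI : Bicategory (A × LocallyDiscrete K) := Bicategory.prod A (LocallyDiscrete K)
  { carrier := A × LocallyDiscrete K
    bicategory := Bicategory.prod A (LocallyDiscrete K)
    strict := inferInstance }

theorem exch_left (F G : A ⟶ B) (σ : F ⟶ G) {x y : A} (u : x ⟶ y) :
    (fn F).map u ≫ comp₂ σ y = comp₂ σ x ≫ (fn G).map u :=
  TwoNatTrans.naturality σ u

theorem comp₂_comp {F G H : A ⟶ B} (σ : F ⟶ G) (τ : G ⟶ H) (x : A) :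
    comp₂ (σ ≫ τ) x = comp₂ σ x ≫ comp₂ τ x := rfl

theorem comp₂_id (F : A ⟶ B) (x : A) : comp₂ (𝟙 F) x = 𝟙 ((fn F).obj x) := rfl

theorem act_map_comp (P : K ⥤ (A ⟶ B)) {x y z : A} {k l m : K} (u : x ⟶ y) (v : y ⟶ z)
    (α : k ⟶ l) (β : l ⟶ m) :
    comp₂ (P.map (α ≫ β)) x ≫ (fn (P.obj m)).map (u ≫ v) =
      (comp₂ (P.map α) x ≫ (fn (P.obj l)).map u) ≫
        (comp₂ (P.map β) y ≫ (fn (P.obj m)).map v) := by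
  rw [P.map_comp, comp₂_comp, (fn (P.obj m)).map_comp]
  simp only [Strict.assoc]
  rw [← Strict.assoc _ _ ((fn (P.obj m)).map v), ← exch_left, Strict.assoc]

/-- The 2-functor `A × K → B`, `(x, k) ↦ P k x` defined by a functor `P` from the category `K` to
the category of 2-functors from `A` to `B`. A 1-cell `(u, α) : (x, k) → (y, l)` goes to the
composite of `P α x : P k x → P l x` and `P l u : P l x → P l y`, and a 2-cell `(φ, 1)` goes to the
whiskering of `P l φ` with `P α x`. -/
def act (P : K ⥤ (A ⟶ B)) : StrictPseudofunctor (prodCat A K) B :=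
  StrictPseudofunctor.mk''
    { obj X := (fn (P.obj X.2.as)).obj X.1
      map {X Y} f := comp₂ (P.map f.2.as) X.1 ≫ (fn (P.obj Y.2.as)).map f.1
      map₂ {X Y f g} η := comp₂ (P.map f.2.as) X.1 ◁ (fn (P.obj Y.2.as)).map₂ η.1 ≫
        eqToHom (by rw [LocallyDiscrete.eq_of_hom η.2])
      map₂_id := by
        rintro ⟨x, ⟨k⟩⟩ ⟨y, ⟨l⟩⟩ ⟨u, ⟨α⟩⟩
        change comp₂ (P.map α) x ◁ (fn (P.obj l)).map₂ (𝟙 u) ≫ 𝟙 _ = _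
        rw [PrelaxFunctor.map₂_id, whiskerLeft_id, Category.comp_id]
      map₂_comp := by
        rintro ⟨x, ⟨k⟩⟩ ⟨y, ⟨l⟩⟩ ⟨u, ⟨α⟩⟩ ⟨v, ⟨β⟩⟩ ⟨w, ⟨γ⟩⟩ ⟨η, ⟨⟨h⟩⟩⟩ ⟨θ, ⟨⟨h'⟩⟩⟩
        obtain rfl : α = β := h
        obtain rfl : α = γ := h'
        change comp₂ (P.map α) x ◁ (fn (P.obj l)).map₂ (η ≫ θ) ≫ 𝟙 _ =
          (comp₂ (P.map α) x ◁ (fn (P.obj l)).map₂ η ≫ 𝟙 _) ≫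
            (comp₂ (P.map α) x ◁ (fn (P.obj l)).map₂ θ ≫ 𝟙 _)
        simp only [Category.comp_id, PrelaxFunctor.map₂_comp, whiskerLeft_comp]
      map_id := by
        rintro ⟨x, ⟨k⟩⟩
        change comp₂ (P.map (𝟙 k)) x ≫ (fn (P.obj k)).map (𝟙 x) = 𝟙 _
        rw [P.map_id, comp₂_id, (fn (P.obj k)).map_id, Strict.comp_id]
      map_comp := by
        rintro ⟨x, ⟨k⟩⟩ ⟨y, ⟨l⟩⟩ ⟨z, ⟨m⟩⟩ ⟨u, ⟨α⟩⟩ ⟨v, ⟨β⟩⟩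
        exact act_map_comp P u v α β
      map₂_whisker_left := by
        rintro ⟨x, ⟨k⟩⟩ ⟨y, ⟨l⟩⟩ ⟨z, ⟨m⟩⟩ ⟨u, ⟨α⟩⟩ ⟨v, ⟨β⟩⟩ ⟨w, ⟨γ⟩⟩ ⟨η, ⟨⟨h⟩⟩⟩
        obtain rfl : β = γ := h
        apply eq_of_heq
        rw [heq_eqToHom_comp_iff, heq_comp_eqToHom_iff]
        change comp₂ (P.map (α ≫ β)) x ◁ (fn (P.obj m)).map₂ (u ◁ η) ≫ 𝟙 _ ≍
          (comp₂ (P.map α) x ≫ (fn (P.obj l)).map u) ◁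
            (comp₂ (P.map β) y ◁ (fn (P.obj m)).map₂ η ≫ 𝟙 _)
        rw [Category.comp_id, Category.comp_id, P.map_comp, comp₂_comp]
        refine (whiskerLeft_heq rfl ((fn (P.obj m)).map_comp _ _) ((fn (P.obj m)).map_comp _ _)
          (map₂_whiskerLeft_heq _ u η)).trans ?_
        refine (comp_whiskerLeft_heq _ _ _).trans ?_
        refine HEq.trans ?_ (comp_whiskerLeft_heq _ _ _).symm
        refine whiskerLeft_heq rfl (by rw [← Strict.assoc, ← Strict.assoc, exch_left])
          (by rw [← Strict.assoc, ← Strict.assoc, exch_left]) ?_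
        refine (comp_whiskerLeft_heq _ _ _).symm.trans ?_
        refine HEq.trans ?_ (comp_whiskerLeft_heq _ _ _)
        exact whiskerLeft_heq (exch_left _ _ _ _).symm rfl rfl HEq.rfl
      map₂_whisker_right := by
        rintro ⟨x, ⟨k⟩⟩ ⟨y, ⟨l⟩⟩ ⟨z, ⟨m⟩⟩ ⟨u, ⟨α⟩⟩ ⟨v, ⟨β⟩⟩ ⟨η, ⟨⟨h⟩⟩⟩ ⟨w, ⟨γ⟩⟩
        obtain rfl : α = β := h
        apply eq_of_heq
        rw [heq_eqToHom_comp_iff, heq_comp_eqToHom_iff]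
        change comp₂ (P.map (α ≫ γ)) x ◁ (fn (P.obj m)).map₂ (η ▷ w) ≫ 𝟙 _ ≍
          (comp₂ (P.map α) x ◁ (fn (P.obj l)).map₂ η ≫ 𝟙 _) ▷
            (comp₂ (P.map γ) y ≫ (fn (P.obj m)).map w)
        rw [Category.comp_id, Category.comp_id, P.map_comp, comp₂_comp]
        refine (whiskerLeft_heq rfl ((fn (P.obj m)).map_comp _ _) ((fn (P.obj m)).map_comp _ _)
          (map₂_whiskerRight_heq _ η w)).trans ?_
        refine (comp_whiskerLeft_heq _ _ _).trans ?_
        refine HEq.trans ?_ (whisker_assoc_heq _ _ _).symm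
        refine whiskerLeft_heq rfl (by rw [← Strict.assoc, ← Strict.assoc, exch_left])
          (by rw [← Strict.assoc, ← Strict.assoc, exch_left]) ?_
        refine HEq.trans ?_ (whiskerRight_comp_heq _ _ _).symm
        refine (whisker_assoc_heq _ _ _).symm.trans ?_
        exact whiskerRight_heq rfl (exch_left _ _ _ _).symm (exch_left _ _ _ _).symm
          (TwoNatTrans.naturality₂_heq (P.map γ) η).symm }

theorem pair_heq {α α' β : Type u} {a : α} {a' : α'} (h : a ≍ a') (b : β) :
    ((a, b) : α × β) ≍ ((a', b) : α' × β) := by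
  cases h; rfl

theorem prodCat_heq {x x' y y' : A} {k l : K} {u v : x ⟶ y} {u' v' : x' ⟶ y'} {α β : k ⟶ l}
    (η : u ⟶ v) (η' : u' ⟶ v') (hx : x = x') (hy : y = y') (hu : u ≍ u') (hv : v ≍ v')
    (h : η ≍ η') (e e' : (⟨α⟩ : Discrete (k ⟶ l)) ⟶ ⟨β⟩) :
    ((η, e) : ((u, ⟨α⟩) : ((x, ⟨k⟩) : prodCat A K) ⟶ (y, ⟨l⟩)) ⟶ (v, ⟨β⟩)) ≍
      ((η', e') : ((u', ⟨α⟩) : ((x', ⟨k⟩) : prodCat A K) ⟶ (y', ⟨l⟩)) ⟶ (v', ⟨β⟩)) := by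
  subst hx hy; cases hu; cases hv; cases h
  obtain rfl : e = e' := Subsingleton.elim _ _
  rfl

theorem eq_conj_of_heq {A : Type u₁} [Category.{v₁} A] {x y x' y' : A} {f : x ⟶ y} {g : x' ⟶ y'}
    (hx : x = x') (hy : y' = y) (h : f ≍ g) : f = eqToHom hx ≫ g ≫ eqToHom hy := by
  subst hx hy; simpa using h

theorem prod_cell_heq {A : Type u₁} [Bicategory.{w₁, v₁} A] {L : Type u₂} [Bicategory.{w₂, v₂} L]
    {X Y : A × L} {f g f' g' : X ⟶ Y} (η : f ⟶ g) (η' : f' ⟶ g') (hf : f = f') (hg : g = g')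
    (h₁ : η.1 ≍ η'.1) (h₂ : η.2 ≍ η'.2) : η ≍ η' := by
  subst hf hg
  exact heq_of_eq (Prod.ext (eq_of_heq h₁) (eq_of_heq h₂))

/-- The 2-functor into a product of 2-categories with given components. -/
def pairing {Z : Type u₁} [Bicategory.{w₁, v₁} Z] [Strict Z] {A : Type u₂} [Bicategory.{w₂, v₂} A]
    [Strict A] {L : Type u₃} [Bicategory.{w₃, v₃} L] [Strict L] (F : StrictPseudofunctor Z A)
    (G : StrictPseudofunctor Z L) : StrictPseudofunctor Z (A × L) :=
  StrictPseudofunctor.mk''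
    { obj X := (F.obj X, G.obj X)
      map f := (F.map f, G.map f)
      map₂ η := (F.map₂ η, G.map₂ η)
      map₂_id f := Prod.ext (F.map₂_id f) (G.map₂_id f)
      map₂_comp η θ := Prod.ext (F.map₂_comp η θ) (G.map₂_comp η θ)
      map_id X := Prod.ext (F.map_id X) (G.map_id X)
      map_comp f g := Prod.ext (F.map_comp f g) (G.map_comp f g)
      map₂_whisker_left {a _ c} f _ _ η :=
        eq_conj_of_heq (A := ((F.obj a, G.obj a) : A × L) ⟶ (F.obj c, G.obj c)) _ _ <|
          prod_cell_heq _ _ (Prod.ext (F.map_comp _ _) (G.map_comp _ _))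
          (Prod.ext (F.map_comp _ _) (G.map_comp _ _)) (map₂_whiskerLeft_heq F f η)
          (map₂_whiskerLeft_heq G f η)
      map₂_whisker_right {a _ c} _ _ η h :=
        eq_conj_of_heq (A := ((F.obj a, G.obj a) : A × L) ⟶ (F.obj c, G.obj c)) _ _ <|
          prod_cell_heq _ _ (Prod.ext (F.map_comp _ _) (G.map_comp _ _))
          (Prod.ext (F.map_comp _ _) (G.map_comp _ _)) (map₂_whiskerRight_heq F η h)
          (map₂_whiskerRight_heq G η h) }

/-- A functor, viewed as a 2-functor. -/
def locDiscr (R : K ⥤ K') : StrictPseudofunctor (LocallyDiscrete K) (LocallyDiscrete K') :=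
  StrictPseudofunctor.mk''
    { obj X := ⟨R.obj X.as⟩
      map f := ⟨R.map f.as⟩
      map₂ η := eqToHom (congrArg (fun a => Discrete.mk (R.map a))
          (congrArg Discrete.as (LocallyDiscrete.eq_of_hom η)))
      map₂_id _ := Subsingleton.elim _ _
      map₂_comp _ _ := Subsingleton.elim _ _
      map_id _ := congrArg Discrete.mk (R.map_id _)
      map_comp _ _ := congrArg Discrete.mk (R.map_comp _ _)
      map₂_whisker_left _ _ _ _ := Subsingleton.elim _ _
      map₂_whisker_right _ _ := Subsingleton.elim _ _ }

/-- The 2-functor `A × K → B × K'` with components `act P` and `R`. -/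
def step (P : K ⥤ (A ⟶ B)) (R : K ⥤ K') : StrictPseudofunctor (prodCat A K) (prodCat B K') :=
  pairing (act P) ((Bicategory.Prod.snd A (LocallyDiscrete K)).comp (locDiscr R))

/-- The 2-functor `F × 1 : A × K → B × K`. -/
def prodMap (F : StrictPseudofunctor A B) (K : Type u) [Category.{u} K] :
    StrictPseudofunctor (prodCat A K) (prodCat B K) :=
  pairing ((Bicategory.Prod.fst A (LocallyDiscrete K)).comp F)
    (Bicategory.Prod.snd A (LocallyDiscrete K))

theorem act_heq {F F' G G' : A ⟶ B} {σ : F ⟶ G} {σ' : F' ⟶ G'} (hF : F = F') (hG : G = G')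
    (h : σ ≍ σ') {x y : A} (u : x ⟶ y) :
    comp₂ σ x ≫ (fn G).map u ≍ comp₂ σ' x ≫ (fn G').map u := by
  subst hF hG; cases h; rfl

theorem act_heq₂ {F F' G G' : A ⟶ B} {σ : F ⟶ G} {σ' : F' ⟶ G'} (hF : F = F') (hG : G = G')
    (h : σ ≍ σ') {x y : A} {u v : x ⟶ y} (η : u ⟶ v) :
    comp₂ σ x ◁ (fn G).map₂ η ≍ comp₂ σ' x ◁ (fn G').map₂ η := by
  subst hF hG; cases h; rfl

theorem step_id (P : K ⥤ (A ⟶ A)) (h₀ : ∀ k, P.obj k = 𝟙 A)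
    (h₁ : ∀ {k l : K} (α : k ⟶ l), P.map α ≍ 𝟙 (𝟙 A)) :
    step P (𝟭 K) = StrictPseudofunctor.id (prodCat A K) := by
  refine twoFunctor_ext ?_ ?_ ?_
  · rintro ⟨x, ⟨k⟩⟩
    exact Prod.ext (congrArg (fun F => (fn F).obj x) (h₀ k)) rfl
  · rintro ⟨x, ⟨k⟩⟩ ⟨y, ⟨l⟩⟩ ⟨u, ⟨α⟩⟩
    refine pair_heq ?_ _
    exact (act_heq (h₀ k) (h₀ l) (h₁ α) u).trans (heq_of_eq (Strict.id_comp _))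
  · rintro ⟨x, ⟨k⟩⟩ ⟨y, ⟨l⟩⟩ ⟨u, ⟨α⟩⟩ ⟨v, ⟨β⟩⟩ ⟨η, ⟨⟨h⟩⟩⟩
    obtain rfl : α = β := h
    refine prodCat_heq _ _ (congrArg (fun F => (fn F).obj x) (h₀ k))
      (congrArg (fun F => (fn F).obj y) (h₀ l))
      ((act_heq (h₀ k) (h₀ l) (h₁ α) u).trans (heq_of_eq (Strict.id_comp _)))
      ((act_heq (h₀ k) (h₀ l) (h₁ α) v).trans (heq_of_eq (Strict.id_comp _))) ?_ _ _
    change comp₂ (P.map α) x ◁ (fn (P.obj l)).map₂ η ≫ 𝟙 _ ≍ _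
    rw [Category.comp_id]
    exact (act_heq₂ (h₀ k) (h₀ l) (h₁ α) η).trans (id_whiskerLeft_heq _)

theorem step_comp (P : K ⥤ (A ⟶ B)) (R : K ⥤ K') (P' : K' ⥤ (B ⟶ C)) (R' : K' ⥤ K'')
    (Q : K ⥤ (A ⟶ C)) (h₀ : ∀ k, Q.obj k = P.obj k ≫ P'.obj (R.obj k))
    (h₁ : ∀ {k l : K} (α : k ⟶ l), Q.map α ≍ hcomp (P.map α) (P'.map (R.map α))) :
    (step P R).comp (step P' R') = step Q (R ⋙ R') := by
  have key : ∀ {x y : A} {k l : K} (u : x ⟶ y) (α : k ⟶ l),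
      comp₂ (P'.map (R.map α)) ((fn (P.obj k)).obj x) ≫
        (fn (P'.obj (R.obj l))).map (comp₂ (P.map α) x ≫ (fn (P.obj l)).map u) =
      comp₂ (hcomp (P.map α) (P'.map (R.map α))) x ≫
        (fn (P.obj l ≫ P'.obj (R.obj l))).map u := by
    intro x y k l u α
    rw [(fn (P'.obj (R.obj l))).map_comp, ← Strict.assoc, ← exch_left]
    rfl
  refine twoFunctor_ext ?_ ?_ ?_
  · rintro ⟨x, ⟨k⟩⟩
    exact Prod.ext (congrArg (fun F => (fn F).obj x) (h₀ k)).symm rfl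
  · rintro ⟨x, ⟨k⟩⟩ ⟨y, ⟨l⟩⟩ ⟨u, ⟨α⟩⟩
    refine pair_heq ?_ _
    exact (heq_of_eq (key u α)).trans (act_heq (h₀ k) (h₀ l) (h₁ α) u).symm
  · rintro ⟨x, ⟨k⟩⟩ ⟨y, ⟨l⟩⟩ ⟨u, ⟨α⟩⟩ ⟨v, ⟨β⟩⟩ ⟨η, ⟨⟨h⟩⟩⟩
    obtain rfl : α = β := h
    refine prodCat_heq _ _ (congrArg (fun F => (fn F).obj x) (h₀ k)).symm
      (congrArg (fun F => (fn F).obj y) (h₀ l)).symm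
      ((heq_of_eq (key u α)).trans (act_heq (h₀ k) (h₀ l) (h₁ α) u).symm)
      ((heq_of_eq (key v α)).trans (act_heq (h₀ k) (h₀ l) (h₁ α) v).symm) ?_ _ _
    change comp₂ (P'.map (R.map α)) ((fn (P.obj k)).obj x) ◁
      (fn (P'.obj (R.obj l))).map₂ (comp₂ (P.map α) x ◁ (fn (P.obj l)).map₂ η ≫ 𝟙 _) ≫ 𝟙 _ ≍
        comp₂ (Q.map α) x ◁ (fn (Q.obj l)).map₂ η ≫ 𝟙 _
    rw [Category.comp_id, Category.comp_id, Category.comp_id]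
    refine HEq.trans ?_ (act_heq₂ (h₀ k) (h₀ l) (h₁ α) η).symm
    refine (whiskerLeft_heq rfl ((fn (P'.obj (R.obj l))).map_comp _ _)
      ((fn (P'.obj (R.obj l))).map_comp _ _) (map₂_whiskerLeft_heq _ _ _)).trans ?_
    refine (comp_whiskerLeft_heq _ _ _).symm.trans ?_
    exact whiskerLeft_heq (exch_left _ _ _ _).symm rfl rfl HEq.rfl

theorem step_prodMap {A' B' : TwoCat.{u}} (F : A ⟶ A') (G : B ⟶ B') (P : K ⥤ (A ⟶ B))
    (P' : K ⥤ (A' ⟶ B')) (R : K ⥤ K') (h₀ : ∀ k, P.obj k ≫ G = F ≫ P'.obj k)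
    (h₁ : ∀ {k l : K} (α : k ⟶ l), P.map α ▷ G ≍ F ◁ P'.map α) :
    (step P R).comp (prodMap G K') = (prodMap F K).comp (step P' R) := by
  have key : ∀ {x y : A} {k l : K} (u : x ⟶ y) (α : k ⟶ l),
      (fn G).map (comp₂ (P.map α) x ≫ (fn (P.obj l)).map u) =
      comp₂ (P.map α ▷ G) x ≫ (fn (P.obj l ≫ G)).map u := by
    intro x y k l u α
    exact (fn G).map_comp _ _
  refine twoFunctor_ext ?_ ?_ ?_
  · rintro ⟨x, ⟨k⟩⟩
    exact Prod.ext (congrArg (fun F => (fn F).obj x) (h₀ k)) rfl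
  · rintro ⟨x, ⟨k⟩⟩ ⟨y, ⟨l⟩⟩ ⟨u, ⟨α⟩⟩
    refine pair_heq ?_ _
    exact (heq_of_eq (key u α)).trans (act_heq (h₀ k) (h₀ l) (h₁ α) u)
  · rintro ⟨x, ⟨k⟩⟩ ⟨y, ⟨l⟩⟩ ⟨u, ⟨α⟩⟩ ⟨v, ⟨β⟩⟩ ⟨η, ⟨⟨h⟩⟩⟩
    obtain rfl : α = β := h
    refine prodCat_heq _ _ (congrArg (fun F => (fn F).obj x) (h₀ k))
      (congrArg (fun F => (fn F).obj y) (h₀ l))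
      ((heq_of_eq (key u α)).trans (act_heq (h₀ k) (h₀ l) (h₁ α) u))
      ((heq_of_eq (key v α)).trans (act_heq (h₀ k) (h₀ l) (h₁ α) v)) ?_ _ _
    change (fn G).map₂ (comp₂ (P.map α) x ◁ (fn (P.obj l)).map₂ η ≫ 𝟙 _) ≍
      comp₂ (P'.map α) ((fn F).obj x) ◁ (fn (P'.obj l)).map₂ ((fn F).map₂ η) ≫ 𝟙 _
    rw [Category.comp_id, Category.comp_id]
    refine HEq.trans ?_ (act_heq₂ (h₀ k) (h₀ l) (h₁ α) η)
    exact map₂_whiskerLeft_heq (fn G) _ _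

end Action

section Hocolim

open TwoCat Bicategory.Opposite

variable {C : Type u} [Bicategory.{u, u} C] {ι : Type} [Preorder ι]

/-- The functor `f ↦ (f_{ij})_* : D (c i) → D (c j)`. -/
def push (D : StrictPseudofunctor C TwoCat.{u}) (c : ι → C) {i j : ι} (h : i ≤ j) :
    Chain c ⥤ (D.obj (c i) ⟶ D.obj (c j)) where
  obj f := D.map (f.hom h)
  map α := D.map₂ (α.cell h)
  map_id _ := D.map₂_id _
  map_comp _ _ := D.map₂_comp _ _

/-- The functor `f ↦ (f_{ij})^* : D (c j) → D (c i)`. -/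
def pull (D : StrictPseudofunctor Cᵒᵖ TwoCat.{u}) (c : ι → C) {i j : ι} (h : i ≤ j) :
    Chain c ⥤ (D.obj (op (c j)) ⟶ D.obj (op (c i))) where
  obj f := D.map (f.hom h).op
  map α := D.map₂ (op2 (α.cell h))
  map_id _ := D.map₂_id _
  map_comp α β := D.map₂_comp (op2 (α.cell h)) (op2 (β.cell h))

theorem op2_heq {a b : C} {f g f' g' : a ⟶ b} {η : f ⟶ g} {η' : f' ⟶ g'} (hf : f = f')
    (hg : g = g') (h : η ≍ η') : op2 η ≍ op2 η' := by
  subst hf hg; cases h; rfl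

theorem op2_hcomp {a b c : C} {f f' : a ⟶ b} {g g' : b ⟶ c} (α : f ⟶ f') (β : g ⟶ g') :
    op2 (hcomp α β) = hcomp (op2 β) (op2 α) := by
  have h : hcomp α β = f ◁ β ≫ α ▷ g' := (whisker_exchange α β).symm
  rw [h]; rfl

/-- The homotopy colimit of a 2-functor `D : C → 2Cat`: the simplicial 2-category whose
2-category of `p`-simplices is the disjoint union over `c₀, …, cₚ` of the 2-categories
`D_{c₀} × C(c₀, c₁) × ⋯ × C(cₚ₋₁, cₚ)`. An order-preserving map `φ : [q] → [p]` acts by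
reindexing the chains `f` and by `(f_{0,φ(0)})_*` from `D_{c₀}` to `D_{c_φ(0)}`. -/
def hocolim (D : StrictPseudofunctor C TwoCat.{u}) : SimplicialObject TwoCat.{u} where
  obj p := TwoCat.mk
    (Coprod (fun c : Fin (p.unop.len + 1) → C => prodCat (D.obj (c 0)) (Chain c)))
  map φ := Coprod.map (fun c => c ∘ φ.unop.toOrderHom)
    (fun c => step (push D c (Fin.zero_le (φ.unop.toOrderHom 0)))
      (Chain.restrict φ.unop.toOrderHom c))
  map_id p := by
    refine Eq.trans (congrArg (Coprod.map _) ?_) Coprod.map_id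
    funext c
    refine step_id _ (fun f => ?_) (fun {f g} α => ?_)
    · exact (congrArg D.map (f.hom_refl 0)).trans (D.map_id _)
    · refine (map₂_heq (f.hom_refl 0) (g.hom_refl 0) (α.cell_refl 0)).trans ?_
      rw [D.map₂_id]
      exact id_heq (D.map_id _)
  map_comp {p q r} φ ψ := by
    refine Eq.trans ?_ (Coprod.map_comp_map _ _ _ _).symm
    refine congrArg (Coprod.map _) ?_
    funext c
    refine (step_comp (push D c (Fin.zero_le _))
      (Chain.restrict φ.unop.toOrderHom c)
      (push D (c ∘ φ.unop.toOrderHom) (Fin.zero_le (ψ.unop.toOrderHom 0)))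
      (Chain.restrict ψ.unop.toOrderHom (c ∘ φ.unop.toOrderHom)) (push D c (Fin.zero_le _))
      (fun f => ?_) (fun {f g} α => ?_)).symm
    · exact (congrArg D.map (f.hom_trans _ _)).trans (D.map_comp _ _)
    · exact (map₂_heq (f.hom_trans _ _) (g.hom_trans _ _) (α.cell_trans _ _)).trans
        (map₂_hcomp_heq D _ _)

/-- The morphism of simplicial 2-categories induced by a 2-transformation, given on
`D_{c₀} × C(c₀, c₁) × ⋯ × C(cₚ₋₁, cₚ)` by `Γ_{c₀} × 1`. -/
def hocolimMap {D E : StrictPseudofunctor C TwoCat.{u}} (Γ : TwoNatTrans D E) :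
    hocolim D ⟶ hocolim E where
  app p := Coprod.map (fun c => c) (fun c => prodMap (Γ.app (c 0)) (Chain c))
  naturality p q φ := by
    refine (Coprod.map_comp_map _ _ _ _).trans (Eq.trans ?_ (Coprod.map_comp_map _ _ _ _).symm)
    refine congrArg (Coprod.map _) ?_
    funext c
    exact step_prodMap _ _ _ _ _ (fun f => Γ.naturality _) (fun α => Γ.naturality₂_heq _)

theorem pull_trans (D : StrictPseudofunctor Cᵒᵖ TwoCat.{u}) {c : ι → C} {f g : Chain c}
    (α : f ⟶ g) {i j k : ι} (h : i ≤ j) (h' : j ≤ k) :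
    (pull D c (h.trans h')).map α ≍ hcomp ((pull D c h').map α) ((pull D c h).map α) := by
  refine (map₂_heq (congrArg Quiver.Hom.op (f.hom_trans h h'))
    (congrArg Quiver.Hom.op (g.hom_trans h h'))
    (op2_heq (f.hom_trans h h') (g.hom_trans h h') (α.cell_trans h h'))).trans ?_
  refine HEq.trans ?_ (map₂_hcomp_heq D _ _)
  exact heq_of_eq (congrArg (fun k => D.map₂ k) (op2_hcomp _ _))

/-- The homotopy colimit of a 2-functor `D : Cᵒᵖ → 2Cat`: the simplicial 2-category whose
2-category of `p`-simplices is the disjoint union over `c₀, …, cₚ` of the 2-categories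
`C(c₀, c₁) × ⋯ × C(cₚ₋₁, cₚ) × D_{cₚ}` (written here with the factor `D_{cₚ}` in front). An
order-preserving map `φ : [q] → [p]` acts by reindexing the chains `f` and by `(f_{φ(q),p})^*` from
`D_{cₚ}` to `D_{c_φ(q)}`. -/
def hocolimOp (D : StrictPseudofunctor Cᵒᵖ TwoCat.{u}) : SimplicialObject TwoCat.{u} where
  obj p := TwoCat.mk
    (Coprod (fun c : Fin (p.unop.len + 1) → C =>
      prodCat (D.obj (op (c (Fin.last p.unop.len)))) (Chain c)))
  map {p q} φ := Coprod.map (fun c => c ∘ φ.unop.toOrderHom)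
    (fun c => step (pull D c (Fin.le_last (φ.unop.toOrderHom (Fin.last q.unop.len))))
      (Chain.restrict φ.unop.toOrderHom c))
  map_id p := by
    refine Eq.trans (congrArg (Coprod.map _) ?_) Coprod.map_id
    funext c
    refine step_id _ (fun f => ?_) (fun {f g} α => ?_)
    · exact (congrArg (fun k => D.map (Quiver.Hom.op k)) (f.hom_refl _)).trans (D.map_id _)
    · refine (map₂_heq (congrArg Quiver.Hom.op (f.hom_refl _))
        (congrArg Quiver.Hom.op (g.hom_refl _))
        (op2_heq (f.hom_refl _) (g.hom_refl _) (α.cell_refl _))).trans ?_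
      exact (heq_of_eq (D.map₂_id _)).trans (id_heq (D.map_id _))
  map_comp {p q r} φ ψ := by
    refine Eq.trans ?_ (Coprod.map_comp_map _ _ _ _).symm
    refine congrArg (Coprod.map _) ?_
    funext c
    refine (step_comp (pull D c (Fin.le_last _))
      (Chain.restrict φ.unop.toOrderHom c)
      (pull D (c ∘ φ.unop.toOrderHom) (Fin.le_last (ψ.unop.toOrderHom (Fin.last _))))
      (Chain.restrict ψ.unop.toOrderHom (c ∘ φ.unop.toOrderHom)) (pull D c (Fin.le_last _))
      (fun f => ?_) (fun {f g} α => ?_)).symm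
    · exact (congrArg (fun k => D.map (Quiver.Hom.op k)) (f.hom_trans _ _)).trans (D.map_comp _ _)
    · exact pull_trans D α (φ.unop.toOrderHom.monotone (Fin.le_last _)) (Fin.le_last _)

/-- The morphism of simplicial 2-categories induced by a 2-transformation, given on
`C(c₀, c₁) × ⋯ × C(cₚ₋₁, cₚ) × D_{cₚ}` by `1 × Γ_{cₚ}`. -/
def hocolimOpMap {D E : StrictPseudofunctor Cᵒᵖ TwoCat.{u}} (Γ : TwoNatTrans D E) :
    hocolimOp D ⟶ hocolimOp E where
  app p := Coprod.map (fun c => c)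
    (fun c => prodMap (Γ.app (op (c (Fin.last p.unop.len)))) (Chain c))
  naturality p q φ := by
    refine (Coprod.map_comp_map _ _ _ _).trans (Eq.trans ?_ (Coprod.map_comp_map _ _ _ _).symm)
    refine congrArg (Coprod.map _) ?_
    funext c
    exact step_prodMap _ _ _ _ _ (fun f => Γ.naturality _) (fun α => Γ.naturality₂_heq _)

end Hocolim

end TwoCategory

open TwoCategory

/-!
In degree `p` the homotopy colimit is a coproduct, over sequences of objects `c₀, …, cₚ`, of
products of `D c₀` (or `D cₚ`) with a category of chains. The double nerve turns these products
and coproducts into products and coproducts of simplicial sets, so `Γ_*` is a weak equivalence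
in each simplicial degree, and it remains to see that the diagonal of bisimplicial sets
preserves levelwise weak equivalences.

The monomorphisms of simplicial sets whose realization is a homotopy equivalence are those
which lift on the left against the singular maps of `T → pt` and of `T^I → T × T` for all
spaces `T`. Hence they are closed under pushouts, filtered unions and pushout-products with the
boundary inclusions of simplices, and filtering the diagonal by rows and degeneracies gives the
claim for levelwise monomorphisms. Every map factors as a monomorphism followed by a projection
with contractible fibre, and this factorization is compatible with the diagonal.
-/

open scoped unitInterval

/-! ### Cofibrations of spaces and lifting along fibrations -/

namespace HomotopyExtension

section Paths

variable {Y : Type u₁} {T : Type u₂} [TopologicalSpace Y] [TopologicalSpace T]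

/-- A homotopy, regarded as a family of paths. -/
def pathFamily {f g : C(Y, T)} (H : ContinuousMap.Homotopy f g) : C(Y, C(I, T)) :=
  (H.toContinuousMap.comp ContinuousMap.prodSwap).curry

theorem pathFamily_apply {f g : C(Y, T)} (H : ContinuousMap.Homotopy f g) (y : Y) (t : I) :
    pathFamily H y t = H (t, y) := rfl

/-- A family of paths, regarded as a homotopy between the maps given by its ends. -/
def homotopyOfPathFamily {f g : C(Y, T)} (h : C(Y, C(I, T))) (h₀ : ∀ y, h y 0 = f y)
    (h₁ : ∀ y, h y 1 = g y) : ContinuousMap.Homotopy f g where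
  toContinuousMap := h.uncurry.comp ContinuousMap.prodSwap
  map_zero_left := h₀
  map_one_left := h₁

/-- The family of constant paths at the values of a map. -/
def constPaths (f : C(Y, T)) : C(Y, C(I, T)) :=
  (f.comp ContinuousMap.fst).curry

/-- The family of paths obtained by reversing the paths of a family. -/
def reversePaths (h : C(Y, C(I, T))) : C(Y, C(I, T)) :=
  ⟨fun y => (h y).comp ⟨σ, unitInterval.continuous_symm⟩,
    (ContinuousMap.continuous_precomp _).comp h.continuous⟩

theorem reversePaths_apply (h : C(Y, C(I, T))) (y : Y) (t : I) :
    reversePaths h y t = h y (σ t) := rfl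

theorem reversePaths_zero (h : C(Y, C(I, T))) (y : Y) : reversePaths h y 0 = h y 1 := by
  rw [reversePaths_apply, unitInterval.symm_zero]

theorem reversePaths_one (h : C(Y, C(I, T))) (y : Y) : reversePaths h y 1 = h y 0 := by
  rw [reversePaths_apply, unitInterval.symm_one]

end Paths

section Concatenation

/-- The nearest-point retraction of the real line onto the unit interval. -/
noncomputable def clamp : C(ℝ, I) :=
  ⟨Set.projIcc 0 1 zero_le_one, continuous_projIcc⟩

theorem clamp_coe (t : I) : clamp t = t :=
  Set.projIcc_val zero_le_one t

theorem clamp_of_nonpos {c : ℝ} (hc : c ≤ 0) : clamp c = 0 :=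
  Set.projIcc_of_le_left zero_le_one hc

theorem clamp_of_one_le {c : ℝ} (hc : 1 ≤ c) : clamp c = 1 :=
  Set.projIcc_of_right_le zero_le_one hc

theorem coe_clamp_of_mem {c : ℝ} (hc : c ∈ Set.Icc (0 : ℝ) 1) : (clamp c : ℝ) = c :=
  congrArg Subtype.val (Set.projIcc_of_mem zero_le_one hc)

/-- The affine time change of the interval `[0, 1]` onto `[-s, 1 + s]`. -/
noncomputable def stretch (s t : I) : ℝ := (1 + 2 * (s : ℝ)) * t - s

theorem continuous_stretch : Continuous fun p : I × I => stretch p.1 p.2 := by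
  unfold stretch; fun_prop

theorem stretch_zero_left (t : I) : stretch 0 t = t := by
  simp [stretch]

theorem stretch_zero_right (s : I) : stretch s 0 = -s := by
  simp [stretch]

theorem stretch_one_right (s : I) : stretch s 1 = 1 + s := by
  simp only [stretch, Set.Icc.coe_one]; ring

variable {Y : Type u₁} {T : Type u₂} [TopologicalSpace Y] [TopologicalSpace T]

/-- Given families of paths `U`, `G`, `V` such that `U y` and `V y` start at the two ends of `G y`,
the family of paths obtained by following `U y` backwards from time `s`, then `G y`, and then
`V y` until time `s`. -/
noncomputable def concat (U G V : C(Y, C(I, T))) (h₀ : ∀ y, U y 0 = G y 0)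
    (h₁ : ∀ y, V y 0 = G y 1) : C(Y × I, C(I, T)) :=
  ContinuousMap.curry
    { toFun := fun p =>
        let w := stretch p.1.2 p.2
        if w ≤ 0 then U p.1.1 (clamp (-w))
        else if w ≤ 1 then G p.1.1 (clamp w) else V p.1.1 (clamp (w - 1))
      continuous_toFun := by
        have hw : Continuous fun p : (Y × I) × I => stretch p.1.2 p.2 :=
          continuous_stretch.comp (by fun_prop : Continuous fun p : (Y × I) × I => (p.1.2, p.2))
        refine Continuous.if_le (by fun_prop)
          (Continuous.if_le (by fun_prop) (by fun_prop) hw continuous_const fun p hp => ?_)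
          hw continuous_const fun p hp => ?_
        · rw [hp, sub_self, clamp_of_nonpos le_rfl, clamp_of_one_le le_rfl, h₁]
        · rw [hp, neg_zero, clamp_of_nonpos le_rfl, if_pos zero_le_one, h₀] }

variable {U G V : C(Y, C(I, T))} (h₀ : ∀ y, U y 0 = G y 0) (h₁ : ∀ y, V y 0 = G y 1)

theorem concat_apply (y : Y) (s t : I) : concat U G V h₀ h₁ (y, s) t =
    if stretch s t ≤ 0 then U y (clamp (-stretch s t))
    else if stretch s t ≤ 1 then G y (clamp (stretch s t)) else V y (clamp (stretch s t - 1)) :=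
  rfl

theorem concat_zero (y : Y) : concat U G V h₀ h₁ (y, 0) = G y := by
  ext t
  rw [concat_apply, stretch_zero_left, clamp_coe, if_pos t.2.2]
  split_ifs with ht
  · obtain rfl : t = 0 := Subtype.ext (le_antisymm ht t.2.1)
    rw [Set.Icc.coe_zero, neg_zero, clamp_of_nonpos le_rfl, h₀]
  · rfl

theorem concat_start (y : Y) (s : I) : concat U G V h₀ h₁ (y, s) 0 = U y s := by
  rw [concat_apply, stretch_zero_right, if_pos (neg_nonpos.2 s.2.1), neg_neg, clamp_coe]

theorem concat_end (y : Y) (s : I) : concat U G V h₀ h₁ (y, s) 1 = V y s := by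
  have hs : (0 : ℝ) ≤ s := s.2.1
  rw [concat_apply, stretch_one_right, if_neg (by linarith), add_sub_cancel_left, clamp_coe]
  split_ifs with h
  · obtain rfl : s = 0 := Subtype.ext (le_antisymm (add_le_iff_nonpos_right _ |>.1 h) hs)
    rw [clamp_of_one_le (by simp), h₁]
  · rfl

theorem concat_of_const (y : Y) (hU : ∀ s, U y s = U y 0) (hV : ∀ s, V y s = V y 0) (s t : I) :
    concat U G V h₀ h₁ (y, s) t = G y (clamp (stretch s t)) := by
  rw [concat_apply]
  split_ifs with h h'
  · rw [hU, h₀, clamp_of_nonpos h]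
  · rfl
  · rw [hV, h₁, clamp_of_one_le (not_le.1 h').le]

end Concatenation

/-- A homotopy of unit speed between two reparametrizations with the same ends: `e₁ t` is reached
at time `|e₁ t - e₀ t|`, hence at time `0` when `t` is an end. -/
theorem exists_unitSpeed_homotopy (e₀ e₁ : C(I, I)) (h₀ : e₀ 0 = e₁ 0) (h₁ : e₀ 1 = e₁ 1) :
    ∃ (ψ : C(I × I, I)) (τ : C(I, I)), (∀ t, ψ (0, t) = e₀ t) ∧ (∀ t, ψ (τ t, t) = e₁ t) ∧
      τ 0 = 0 ∧ τ 1 = 0 := by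
  let τ : C(I, I) := ⟨fun t => clamp |(e₁ t : ℝ) - e₀ t|, by fun_prop⟩
  have coe_τ (t : I) : (τ t : ℝ) = |(e₁ t : ℝ) - e₀ t| := coe_clamp_of_mem
    ⟨abs_nonneg _, abs_sub_le_iff.2
      ⟨by linarith [(e₁ t).2.2, (e₀ t).2.1], by linarith [(e₁ t).2.1, (e₀ t).2.2]⟩⟩
  have τ_eq_zero {t : I} (h : e₀ t = e₁ t) : τ t = 0 := Subtype.ext (by simp [coe_τ, h])
  refine ⟨⟨fun p => clamp (max (e₀ p.2 - p.1 : ℝ) (min (e₁ p.2 : ℝ) (e₀ p.2 + p.1))),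
    by fun_prop⟩, τ, fun t => ?_, fun t => ?_, τ_eq_zero h₀, τ_eq_zero h₁⟩
  · refine Eq.trans (congrArg clamp ?_) (clamp_coe (e₀ t))
    rw [Set.Icc.coe_zero, sub_zero, add_zero, max_eq_left (min_le_right _ _)]
  · refine Eq.trans (congrArg clamp ?_) (clamp_coe (e₁ t))
    have := abs_le.1 (coe_τ t).ge
    rw [min_eq_left (by linarith), max_eq_right (by linarith)]

section Cofibrations

variable {A X : Type u} [TopologicalSpace A] [TopologicalSpace X]

/-- The homotopy extension property, for maps to spaces of the same universe level. -/
def HasHomotopyExtension (i : C(A, X)) : Prop :=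
  ∀ (T : Type u) [TopologicalSpace T] (g : C(X, T)) (h : C(A, C(I, T))),
    (∀ a, h a 0 = g (i a)) → ∃ K : C(X, C(I, T)), (∀ x, K x 0 = g x) ∧ ∀ a, K (i a) = h a

/-- The map `i` is the inclusion of a strong deformation retract. -/
def IsStrongDeformationRetract (i : C(A, X)) : Prop :=
  ∃ (r : C(X, A)) (h : C(X, C(I, X))), (∀ a, r (i a) = a) ∧ (∀ x, h x 0 = x) ∧
    (∀ x, h x 1 = i (r x)) ∧ ∀ a t, h (i a) t = i a

/-- Every map defined on the source extends along `i`. -/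
def ExtendsMaps (i : C(A, X)) : Prop :=
  ∀ (T : Type u) [TopologicalSpace T] (g : C(A, T)), ∃ k : C(X, T), ∀ a, k (i a) = g a

/-- Every homotopy defined on the source of `i` between restrictions of maps defined on the target
extends to a homotopy between these maps. -/
def ExtendsHomotopies (i : C(A, X)) : Prop :=
  ∀ (T : Type u) [TopologicalSpace T] (f g : C(X, T)) (h : C(A, C(I, T))),
    (∀ a, h a 0 = f (i a)) → (∀ a, h a 1 = g (i a)) →
    ∃ K : C(X, C(I, T)), (∀ x, K x 0 = f x) ∧ (∀ x, K x 1 = g x) ∧ ∀ a, K (i a) = h a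

theorem IsStrongDeformationRetract.extendsMaps {i : C(A, X)} (hi : IsStrongDeformationRetract i) :
    ExtendsMaps i := by
  obtain ⟨r, -, hr, -⟩ := hi
  exact fun T _ g => ⟨g.comp r, fun a => congrArg g (hr a)⟩

theorem IsStrongDeformationRetract.of_extends {i : C(A, X)} (h₁ : ExtendsMaps i)
    (h₂ : ExtendsHomotopies i) : IsStrongDeformationRetract i := by
  obtain ⟨r, hr⟩ := h₁ A (ContinuousMap.id A)
  obtain ⟨K, hK₀, hK₁, hK⟩ := h₂ X (ContinuousMap.id X) (i.comp r) (constPaths i) (fun _ => rfl)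
    (fun a => congrArg i (hr a).symm)
  exact ⟨r, K, hr, hK₀, hK₁, fun a t => by rw [hK]; rfl⟩

theorem IsStrongDeformationRetract.exists_homotopyEquiv {i : C(A, X)}
    (hi : IsStrongDeformationRetract i) : ∃ e : ContinuousMap.HomotopyEquiv A X, e.toFun = i := by
  obtain ⟨r, h, hr, h₀, h₁, -⟩ := hi
  refine ⟨⟨i, r, ?_, ⟨(homotopyOfPathFamily (f := ContinuousMap.id X) h h₀ h₁).symm⟩⟩, rfl⟩
  rw [show r.comp i = ContinuousMap.id A from ContinuousMap.ext hr]

/-- The family `P` restricts on the source to a reparametrization of `γ`; sliding this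
reparametrization along extends over the target, and stopping the extension at the time when the
new reparametrization is reached keeps the ends of `P` fixed. -/
theorem HasHomotopyExtension.exists_reparametrization {i : C(A, X)} (hi : HasHomotopyExtension i)
    {T : Type u} [TopologicalSpace T] (P : C(X, C(I, T))) (γ : C(A, C(I, T))) {e₀ e₁ : C(I, I)}
    (h₀ : e₀ 0 = e₁ 0) (h₁ : e₀ 1 = e₁ 1) (hP : ∀ a, P (i a) = (γ a).comp e₀) :
    ∃ K : C(X, C(I, T)), (∀ x, K x 0 = P x 0) ∧ (∀ x, K x 1 = P x 1) ∧
      ∀ a, K (i a) = (γ a).comp e₁ := by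
  obtain ⟨ψ, τ, hψ₀, hψτ, hτ₀, hτ₁⟩ := exists_unitSpeed_homotopy e₀ e₁ h₀ h₁
  let slide : C(A, C(I, C(I, T))) := ContinuousMap.curry (ContinuousMap.curry
    ⟨fun p : (A × I) × I => γ p.1.1 (ψ (p.1.2, p.2)), by fun_prop⟩)
  have slide_apply (a : A) (s t : I) : slide a s t = γ a (ψ (s, t)) := rfl
  obtain ⟨N, hN₀, hN⟩ := hi C(I, T) P slide fun a => by
    ext t; rw [slide_apply, hψ₀, hP, ContinuousMap.comp_apply]
  refine ⟨ContinuousMap.curry ⟨fun p => N p.1 (τ p.2) p.2, by fun_prop⟩, fun x => ?_, fun x => ?_,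
    fun a => ?_⟩
  · change N x (τ 0) 0 = _
    rw [hτ₀, hN₀]
  · change N x (τ 1) 1 = _
    rw [hτ₁, hN₀]
  · ext t
    change N (i a) (τ t) t = _
    rw [hN, slide_apply, hψτ, ContinuousMap.comp_apply]

/-- The path which runs from `0` to `1` and back. -/
noncomputable def tent : C(I, I) :=
  ⟨fun t => clamp (1 - |1 - 2 * (t : ℝ)|), by fun_prop⟩

theorem tent_zero : tent 0 = 0 :=
  clamp_of_nonpos (by norm_num)

theorem tent_one : tent 1 = 0 :=
  clamp_of_nonpos (by norm_num)

theorem coe_tent_of_le_half {t : I} (ht : (t : ℝ) ≤ 1 / 2) : (tent t : ℝ) = 2 * t := by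
  have habs : 1 - |1 - 2 * (t : ℝ)| = 2 * t := by rw [abs_of_nonneg (by linarith)]; ring
  refine (coe_clamp_of_mem ?_).trans habs
  rw [habs]
  exact ⟨by linarith [t.2.1], by linarith⟩

theorem coe_tent_of_half_le {t : I} (ht : 1 / 2 ≤ (t : ℝ)) : (tent t : ℝ) = 2 - 2 * t := by
  have habs : 1 - |1 - 2 * (t : ℝ)| = 2 - 2 * t := by rw [abs_of_nonpos (by linarith)]; ring
  refine (coe_clamp_of_mem ?_).trans habs
  rw [habs]
  exact ⟨by linarith [t.2.2], by linarith⟩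

theorem HasHomotopyExtension.exists_retraction {i : C(A, X)} (hi : HasHomotopyExtension i)
    (e : ContinuousMap.HomotopyEquiv A X) (he : e.toFun = i) :
    ∃ r : C(X, A), (∀ a, r (i a) = a) ∧ (ContinuousMap.id X).Homotopic (i.comp r) := by
  obtain ⟨f, g, ⟨H₁⟩, ⟨H₂⟩⟩ := e
  obtain rfl : f = i := he
  rename' f => i
  obtain ⟨K, hK₀, hK⟩ := hi A g (pathFamily H₁) H₁.map_zero_left
  refine ⟨⟨fun x => K x 1, by fun_prop⟩, fun a => ?_, ?_⟩
  · change K (i a) 1 = a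
    rw [hK]
    exact H₁.map_one_left a
  · have homotopic : g.Homotopic ⟨fun x => K x 1, by fun_prop⟩ :=
      ⟨homotopyOfPathFamily K hK₀ fun _ => rfl⟩
    exact (ContinuousMap.Homotopic.symm ⟨H₂⟩).trans (.comp (.refl i) homotopic)

/-- Following a homotopy from the identity to `i ∘ r`, and then its restriction to the image of `r`
backwards, describes on `A` a path and its reverse. -/
theorem exists_backAndForth {i : C(A, X)} {r : C(X, A)} (hr : ∀ a, r (i a) = a)
    (H : ContinuousMap.Homotopy (ContinuousMap.id X) (i.comp r)) :
    ∃ P : C(X, C(I, X)), (∀ x, P x 0 = x) ∧ (∀ x, P x 1 = i (r x)) ∧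
      ∀ a, P (i a) = (pathFamily H (i a)).comp tent := by
  let H' : ContinuousMap.Homotopy (i.comp r) (i.comp r) :=
    homotopyOfPathFamily (reversePaths ((pathFamily H).comp (i.comp r)))
      (fun x => (reversePaths_zero _ x).trans <| (H.map_one_left _).trans <| congrArg i (hr (r x)))
      (fun x => (reversePaths_one _ x).trans (H.map_zero_left _))
  refine ⟨pathFamily (H.trans H'), (H.trans H').map_zero_left, (H.trans H').map_one_left,
    fun a => ?_⟩
  ext t
  rw [pathFamily_apply, ContinuousMap.Homotopy.trans_apply, ContinuousMap.comp_apply,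
    pathFamily_apply]
  split_ifs with ht
  · exact congrArg H (Prod.ext (Subtype.ext (coe_tent_of_le_half ht).symm) rfl)
  · refine congrArg H (Prod.ext (Subtype.ext ?_) (congrArg i (hr a)))
    rw [coe_tent_of_half_le (not_le.1 ht).le]
    exact (by ring : 1 - (2 * (t : ℝ) - 1) = 2 - 2 * t)

theorem HasHomotopyExtension.isStrongDeformationRetract {i : C(A, X)} (hi : HasHomotopyExtension i)
    (e : ContinuousMap.HomotopyEquiv A X) (he : e.toFun = i) : IsStrongDeformationRetract i := by
  obtain ⟨r, hr, ⟨H⟩⟩ := hi.exists_retraction e he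
  obtain ⟨P, hP₀, hP₁, hP⟩ := exists_backAndForth hr H
  obtain ⟨K, hK₀, hK₁, hK⟩ := hi.exists_reparametrization P ((pathFamily H).comp i)
    (e₁ := ContinuousMap.const I 0) tent_zero tent_one hP
  refine ⟨r, K, hr, fun x => (hK₀ x).trans (hP₀ x), fun x => (hK₁ x).trans (hP₁ x), fun a t => ?_⟩
  rw [hK]
  exact H.map_zero_left (i a)

/-- Through the deformation onto `A`, conjugate the homotopy on `A` by the images of the
deformation under the two maps; on `A` this is a reparametrization of the given homotopy. -/
theorem IsStrongDeformationRetract.extendsHomotopies {i : C(A, X)}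
    (hs : IsStrongDeformationRetract i) (hi : HasHomotopyExtension i) : ExtendsHomotopies i := by
  obtain ⟨r, k, hr, hk₀, hk₁, hki⟩ := hs
  intro T _ f g h hf hg
  let track (f : C(X, T)) : C(X, C(I, T)) :=
    reversePaths ⟨fun x => f.comp (k x), (ContinuousMap.continuous_postcomp f).comp k.continuous⟩
  have track_zero (f : C(X, T)) (x : X) : track f x 0 = f (i (r x)) :=
    (reversePaths_zero _ x).trans (congrArg f (hk₁ x))
  have track_one (f : C(X, T)) (x : X) : track f x 1 = f x :=
    (reversePaths_one _ x).trans (congrArg f (hk₀ x))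
  have track_const (f : C(X, T)) (a : A) (s : I) : track f (i a) s = track f (i a) 0 :=
    (congrArg f (hki a _)).trans (congrArg f (hki a _)).symm
  have h₀ (x : X) : track f x 0 = h.comp r x 0 := (track_zero f x).trans (hf (r x)).symm
  have h₁ (x : X) : track g x 0 = h.comp r x 1 := (track_zero g x).trans (hg (r x)).symm
  let e₀ : C(I, I) := ⟨fun t => clamp (stretch 1 t), by unfold stretch; fun_prop⟩
  obtain ⟨K, hK₀, hK₁, hK⟩ := hi.exists_reparametrization (e₀ := e₀) (e₁ := ContinuousMap.id I)
    ⟨fun x => concat _ _ _ h₀ h₁ (x, 1), by fun_prop⟩ h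
    (clamp_of_nonpos (by simp [stretch])) (clamp_of_one_le (by simp [stretch_one_right]))
    fun a => by
      ext t
      refine (concat_of_const h₀ h₁ (i a) (track_const f a) (track_const g a) 1 t).trans ?_
      rw [ContinuousMap.comp_apply, hr, ContinuousMap.comp_apply]
      rfl
  refine ⟨K, fun x => (hK₀ x).trans ?_, fun x => (hK₁ x).trans ?_, hK⟩
  · exact (concat_start h₀ h₁ x 1).trans (track_one f x)
  · exact (concat_end h₀ h₁ x 1).trans (track_one g x)

end Cofibrations

end HomotopyExtension

namespace SimplexLifting

open Simplicial

section RelativeLifting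

/-- The homotopy lifting property, for spaces of universe level `0`, like the simplices. -/
def HasHomotopyLifting {E : Type u₁} {B : Type u₂} [TopologicalSpace E] [TopologicalSpace B]
    (p : C(E, B)) : Prop :=
  ∀ (Y : Type) [TopologicalSpace Y] (f : C(Y, E)) (h : C(Y × I, B)), (∀ y, h (y, 0) = p (f y)) →
    ∃ l : C(Y × I, E), (∀ y, l (y, 0) = f y) ∧ ∀ z, p (l z) = h z

/-- Every partial lift along `p`, defined on the subspace `A`, extends to a lift. -/
def HasRelativeLifting {X : Type u₁} {E : Type u₂} {B : Type u₃} [TopologicalSpace X]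
    [TopologicalSpace E] [TopologicalSpace B] (A : Set X) (p : C(E, B)) : Prop :=
  ∀ (F : C(A, E)) (b : C(X, B)), (∀ x, p (F x) = b x) →
    ∃ l : C(X, E), (∀ x : A, l x = F x) ∧ ∀ x, p (l x) = b x

theorem exists_descent {K : Type u₁} {L : Type u₂} {E : Type u₃} [TopologicalSpace K]
    [TopologicalSpace L] [TopologicalSpace E] [CompactSpace K] [T2Space L] (q : C(K, L))
    (hq : Function.Surjective q) (f : C(K, E)) (h : ∀ a b, q a = q b → f a = f b) :
    ∃ F : C(L, E), ∀ a, F (q a) = f a :=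
  have hq' : Topology.IsQuotientMap q := .of_surjective_continuous hq q.continuous
  ⟨hq'.lift f fun a b => h a b, DFunLike.congr_fun (hq'.lift_comp f fun a b => h a b)⟩

variable {X : Type u₁} {T : Type u₂} [TopologicalSpace X] [TopologicalSpace T] {A : Set X}

/-- The part of the cylinder over `X` consisting of the bottom and the sides over `A`. -/
def openBox (A : Set X) : Set (X × I) :=
  {z | z.1 ∈ A ∨ z.2 = 0}

theorem exists_glue_openBox [CompactSpace X] [T2Space X] (hA : IsClosed A) (F : C(A, C(I, T)))
    (b : C(X, T)) (hF : ∀ x, F x 0 = b x) :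
    ∃ G : C(openBox A, T), (∀ (x : A) (t : I), G ⟨(x, t), Or.inl x.2⟩ = F x t) ∧
      ∀ x : X, G ⟨(x, 0), Or.inr rfl⟩ = b x := by
  have : CompactSpace A := isCompact_iff_compactSpace.1 hA.isCompact
  let q : C((A × I) ⊕ X, openBox A) :=
    ⟨Sum.elim (fun z => ⟨(z.1, z.2), Or.inl z.1.2⟩) (fun x => ⟨(x, 0), Or.inr rfl⟩), by fun_prop⟩
  have surjective : Function.Surjective q := by
    rintro ⟨⟨x, t⟩, hx | ht⟩
    · exact ⟨Sum.inl (⟨x, hx⟩, t), rfl⟩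
    · obtain rfl : t = 0 := ht
      exact ⟨Sum.inr x, rfl⟩
  have compatible (z : A × I) (x : X) (h : q (Sum.inl z) = q (Sum.inr x)) :
      F z.1 z.2 = b x := by
    obtain ⟨h₁, h₂⟩ : z.1.1 = x ∧ z.2 = 0 := Prod.ext_iff.1 (congrArg Subtype.val h)
    rw [h₂, hF, h₁]
  obtain ⟨G, hG⟩ := exists_descent q surjective ⟨Sum.elim (fun z => F z.1 z.2) b, by fun_prop⟩ <| by
    rintro (z | x) (z' | x') h
    · obtain ⟨h₁, h₂⟩ := Prod.ext_iff.1 (congrArg Subtype.val h)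
      rw [show z = z' from Prod.ext (Subtype.ext h₁) h₂]
    · exact compatible z x' h
    · exact (compatible z' x h.symm).symm
    · rw [show x = x' from (Prod.ext_iff.1 (congrArg Subtype.val h)).1]
  exact ⟨G, fun x t => hG (Sum.inl (x, t)), fun x => hG (Sum.inr x)⟩

/-- The evaluation of paths at their start. -/
def evalStart (T : Type u₂) [TopologicalSpace T] : C(C(I, T), T) :=
  ⟨fun γ => γ 0, by fun_prop⟩

theorem hasRelativeLifting_evalStart [CompactSpace X] [T2Space X] (hA : IsClosed A)
    (r : C(X × I, X × I)) (hr : ∀ z, r z ∈ openBox A) (hr' : ∀ z ∈ openBox A, r z = z) :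
    HasRelativeLifting A (evalStart T) := by
  intro F b hF
  obtain ⟨G, hG, hG₀⟩ := exists_glue_openBox hA F b hF
  refine ⟨ContinuousMap.curry ⟨fun z => G ⟨r z, hr z⟩, by fun_prop⟩, fun x => ?_, fun x => ?_⟩
  · ext t
    exact (congrArg G (Subtype.ext (hr' _ (Or.inl x.2)))).trans (hG x t)
  · exact (congrArg G (Subtype.ext (hr' _ (Or.inr rfl)))).trans (hG₀ x)

end RelativeLifting

section Coordinates

variable {ι : Type} [Fintype ι]

/-- A barycentric coordinate. -/
def coord (j : ι) : C(stdSimplex ℝ ι, I) :=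
  ⟨fun x => ⟨x j, x.2.1 j, stdSimplex.le_one x j⟩,
    ((continuous_apply j).comp continuous_subtype_val).subtype_mk _⟩

theorem continuous_apply_simplex (j : ι) : Continuous fun x : stdSimplex ℝ ι => x j :=
  (continuous_apply j).comp continuous_subtype_val

/-- The union of the faces of a simplex opposite to the vertices in `J`. -/
def faceUnion (J : Finset ι) : Set (stdSimplex ℝ ι) :=
  {x | ∃ j ∈ J, x j = 0}

theorem isClosed_faceUnion (J : Finset ι) : IsClosed (faceUnion J) := by
  have : faceUnion J = ⋃ j ∈ J, {x | x j = 0} := by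
    ext x; simp [faceUnion]
  rw [this]
  exact isClosed_biUnion_finset fun j _ => isClosed_eq (continuous_apply_simplex j) continuous_const

variable {J : Finset ι} (hJ : J.Nonempty)

/-- The smallest of the barycentric coordinates with index in `J`. -/
noncomputable def minCoord : C(stdSimplex ℝ ι, I) where
  toFun x := J.inf' hJ fun j => coord j x
  continuous_toFun := Continuous.finset_inf'_apply hJ fun j _ => (coord j).continuous

theorem minCoord_le {j : ι} (hj : j ∈ J) (x : stdSimplex ℝ ι) : (minCoord hJ x : ℝ) ≤ x j :=
  Subtype.coe_le_coe.2 (Finset.inf'_le (fun j => coord j x) hj)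

theorem exists_eq_minCoord (x : stdSimplex ℝ ι) : ∃ j ∈ J, x j = minCoord hJ x :=
  (Finset.exists_mem_eq_inf' hJ fun j => coord j x).imp fun _ h =>
    ⟨h.1, congrArg Subtype.val h.2.symm⟩

theorem minCoord_eq_zero {x : stdSimplex ℝ ι} (hx : x ∈ faceUnion J) : minCoord hJ x = 0 := by
  obtain ⟨j, hj, hx⟩ := hx
  exact Subtype.ext (le_antisymm ((minCoord_le hJ hj x).trans hx.le) (minCoord hJ x).2.1)

end Coordinates

section Horn

variable {ι : Type} [Fintype ι] [DecidableEq ι] [Nontrivial ι] (k : ι)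

/-- The smallest barycentric coordinate of index different from `k`. -/
noncomputable def hornDepth : C(stdSimplex ℝ ι, I) :=
  minCoord (J := {k}ᶜ) ((exists_ne k).imp fun _ h => by simpa using h)

theorem shift_mem (x : stdSimplex ℝ ι) {c : ℝ} (h₀ : 0 ≤ c) (h₁ : c ≤ hornDepth k x) :
    (fun j => x j - c + Fintype.card ι * Pi.single (M := fun _ => ℝ) k c j) ∈ stdSimplex ℝ ι := by
  constructor
  · intro j
    dsimp only
    obtain rfl | hj := eq_or_ne j k
    · rw [Pi.single_eq_same]
      have : (1 : ℝ) ≤ Fintype.card ι := by exact_mod_cast Fintype.card_pos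
      linarith [x.2.1 j, le_mul_of_one_le_left h₀ this, show x.1 j = x j from rfl]
    · rw [Pi.single_eq_of_ne hj, mul_zero, add_zero, sub_nonneg]
      exact h₁.trans (minCoord_le _ (by simpa using hj) x)
  · simp only [Finset.sum_add_distrib, Finset.sum_sub_distrib, stdSimplex.sum_eq_one,
      Finset.sum_const, Finset.card_univ, nsmul_eq_mul, ← Finset.mul_sum, Finset.sum_pi_single',
      Finset.mem_univ, if_true, sub_add_cancel]

/-- The deformation of the simplex which starts with its projection onto the horn at `k`, in the
direction of the vertex `k`, and reaches each point at the time given by its depth. -/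
noncomputable def hornDeformation : C(stdSimplex ℝ ι × I, stdSimplex ℝ ι) where
  toFun z := ⟨_, shift_mem k z.1 (c := max (hornDepth k z.1 - z.2) 0) (le_max_right _ _)
    (max_le (by linarith [z.2.2.1]) (hornDepth k z.1).2.1)⟩
  continuous_toFun := by
    refine Continuous.subtype_mk (continuous_pi fun j => ?_) _
    have := (continuous_apply_simplex j).comp (continuous_fst (Y := I))
    simp only [Pi.single_apply, mul_ite, mul_zero]
    split_ifs <;> fun_prop

theorem hornDeformation_apply (x : stdSimplex ℝ ι) (t : I) (j : ι) :
    hornDeformation k (x, t) j = x j - max (hornDepth k x - t : ℝ) 0 +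
      Fintype.card ι * Pi.single (M := fun _ => ℝ) k (max (hornDepth k x - t : ℝ) 0) j := rfl

theorem hornDeformation_depth (x : stdSimplex ℝ ι) :
    hornDeformation k (x, hornDepth k x) = x := by
  ext j
  rw [hornDeformation_apply, sub_self, max_self, Pi.single_zero, Pi.zero_apply, mul_zero, sub_zero,
    add_zero]

theorem hornDeformation_zero_mem (x : stdSimplex ℝ ι) :
    hornDeformation k (x, 0) ∈ faceUnion {k}ᶜ := by
  obtain ⟨j, hj, h⟩ := exists_eq_minCoord (J := {k}ᶜ) _ x
  refine ⟨j, hj, ?_⟩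
  rw [hornDeformation_apply, Pi.single_eq_of_ne (by simpa using hj), mul_zero, add_zero,
    Set.Icc.coe_zero, sub_zero, max_eq_left (hornDepth k x).2.1, h]
  exact sub_self _

theorem hasRelativeLifting_horn {E : Type u₁} {B : Type u₂} [TopologicalSpace E]
    [TopologicalSpace B] {p : C(E, B)} (hp : HasHomotopyLifting p) :
    HasRelativeLifting (faceUnion {k}ᶜ) p := by
  intro F b hF
  obtain ⟨l, hl₀, hl⟩ := hp _
    (F.comp ⟨fun x => ⟨_, hornDeformation_zero_mem k x⟩, by fun_prop⟩) (b.comp (hornDeformation k))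
    fun x => (hF ⟨_, hornDeformation_zero_mem k x⟩).symm
  refine ⟨⟨fun x => l (x, hornDepth k x), by fun_prop⟩, fun x => ?_, fun x => ?_⟩
  · have depth_eq : hornDepth k x.1 = 0 := minCoord_eq_zero _ x.2
    have fixed : hornDeformation k (x.1, 0) = x.1 := by
      rw [← depth_eq, hornDeformation_depth]
    exact (congrArg (fun t => l (x.1, t)) depth_eq).trans
      ((hl₀ x).trans (congrArg F (Subtype.ext fixed)))
  · exact (hl _).trans (congrArg b (hornDeformation_depth k x))

end Horn

section Boundary

variable {ι : Type} [Fintype ι] [Nonempty ι]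

/-- The smallest barycentric coordinate. -/
noncomputable def depth : C(stdSimplex ℝ ι, I) :=
  minCoord Finset.univ_nonempty

/-- The inverse scaling factor of the projection of the cylinder over a simplex onto its bottom and
sides, radial from the point at height `2` over the barycenter. -/
noncomputable def scale : C(stdSimplex ℝ ι × I, ℝ) :=
  ⟨fun z => max (1 - (z.2 : ℝ) / 2) (1 - Fintype.card ι * (depth z.1 : ℝ)), by fun_prop⟩

theorem scale_apply (z : stdSimplex ℝ ι × I) :
    scale z = max (1 - (z.2 : ℝ) / 2) (1 - Fintype.card ι * (depth z.1 : ℝ)) := rfl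

theorem scale_pos (z : stdSimplex ℝ ι × I) : 0 < scale z :=
  lt_max_of_lt_left (by linarith [z.2.2.2])

theorem scale_le_one (z : stdSimplex ℝ ι × I) : scale z ≤ 1 :=
  max_le (sub_le_self _ (div_nonneg z.2.2.1 zero_le_two))
    (sub_le_self _ (mul_nonneg (Nat.cast_nonneg _) (depth z.1).2.1))

theorem scale_eq_one {z : stdSimplex ℝ ι × I} (hz : z ∈ openBox (faceUnion Finset.univ)) :
    scale z = 1 := by
  refine le_antisymm (scale_le_one z) ?_
  obtain hz | hz := hz
  · refine le_max_of_le_right ?_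
    rw [show depth z.1 = 0 from minCoord_eq_zero _ hz, Set.Icc.coe_zero, mul_zero, sub_zero]
  · refine le_max_of_le_left ?_
    rw [hz, Set.Icc.coe_zero, zero_div, sub_zero]

theorem radialPoint_mem (z : stdSimplex ℝ ι × I) :
    (fun j => (Fintype.card ι : ℝ)⁻¹ + (z.1 j - (Fintype.card ι : ℝ)⁻¹) / scale z) ∈
      stdSimplex ℝ ι := by
  have hN : (0 : ℝ) < Fintype.card ι := by exact_mod_cast Fintype.card_pos
  have hs := scale_pos z
  refine ⟨fun j => ?_, ?_⟩
  · have h_scale : 1 - Fintype.card ι * (depth z.1 : ℝ) ≤ scale z := le_max_right _ _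
    have h_depth : Fintype.card ι * (depth z.1 : ℝ) ≤ Fintype.card ι * z.1 j :=
      mul_le_mul_of_nonneg_left (minCoord_le _ (Finset.mem_univ j) z.1) hN.le
    have : (Fintype.card ι : ℝ)⁻¹ + (z.1 j - (Fintype.card ι : ℝ)⁻¹) / scale z =
        (scale z - (1 - Fintype.card ι * z.1 j)) / (Fintype.card ι * scale z) := by
      field_simp; ring
    dsimp only
    rw [this]
    exact div_nonneg (by linarith) (by positivity)
  · rw [Finset.sum_add_distrib, ← Finset.sum_div, Finset.sum_sub_distrib, stdSimplex.sum_eq_one,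
      Finset.sum_const, Finset.card_univ, nsmul_eq_mul, mul_inv_cancel₀ hN.ne', sub_self, zero_div,
      add_zero]

theorem radialTime_mem (z : stdSimplex ℝ ι × I) : 2 - (2 - (z.2 : ℝ)) / scale z ∈ I := by
  have hs := scale_pos z
  have h_scale : 1 - (z.2 : ℝ) / 2 ≤ scale z := le_max_left _ _
  constructor
  · rw [sub_nonneg, div_le_iff₀ hs]
    linarith
  · rw [sub_le_comm, le_div_iff₀ hs]
    linarith [z.2.2.2, scale_le_one z]

/-- The radial projection of the cylinder over a simplex onto its bottom and sides. -/
noncomputable def radial : C(stdSimplex ℝ ι × I, stdSimplex ℝ ι × I) where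
  toFun z := (⟨_, radialPoint_mem z⟩, ⟨_, radialTime_mem z⟩)
  continuous_toFun := by
    have hs (z : stdSimplex ℝ ι × I) : scale z ≠ 0 := (scale_pos z).ne'
    refine .prodMk (.subtype_mk (continuous_pi fun j => ?_) _) (.subtype_mk ?_ _)
    · have := (continuous_apply_simplex j).comp (continuous_fst (Y := I))
      exact continuous_const.add ((this.sub continuous_const).div scale.continuous hs)
    · exact continuous_const.sub (.div (by fun_prop) scale.continuous hs)

theorem radial_mem (z : stdSimplex ℝ ι × I) : radial z ∈ openBox (faceUnion Finset.univ) := by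
  have hs := (scale_pos z).ne'
  have hN : (Fintype.card ι : ℝ) ≠ 0 := by exact_mod_cast Fintype.card_ne_zero
  obtain h | h := max_choice (1 - (z.2 : ℝ) / 2) (1 - Fintype.card ι * (depth z.1 : ℝ))
  · right
    refine Subtype.ext ?_
    change 2 - (2 - (z.2 : ℝ)) / scale z = 0
    rw [show 2 - (z.2 : ℝ) = 2 * scale z by rw [scale_apply, h]; ring,
      mul_div_cancel_right₀ _ hs, sub_self]
  · left
    obtain ⟨j, hj, hj'⟩ := exists_eq_minCoord Finset.univ_nonempty z.1
    refine ⟨j, hj, ?_⟩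
    change (Fintype.card ι : ℝ)⁻¹ + (z.1 j - (Fintype.card ι : ℝ)⁻¹) / scale z = 0
    have : z.1 j - (Fintype.card ι : ℝ)⁻¹ = -(Fintype.card ι : ℝ)⁻¹ * scale z := by
      rw [scale_apply, h, hj', depth]; field_simp; ring
    rw [this, mul_div_cancel_right₀ _ hs, add_neg_cancel]

theorem radial_of_mem {z : stdSimplex ℝ ι × I} (hz : z ∈ openBox (faceUnion Finset.univ)) :
    radial z = z := by
  refine Prod.ext (stdSimplex.ext (funext fun j => ?_)) (Subtype.ext ?_)
  · change (Fintype.card ι : ℝ)⁻¹ + (z.1 j - (Fintype.card ι : ℝ)⁻¹) / scale z = z.1 j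
    rw [scale_eq_one hz, div_one, add_sub_cancel]
  · change 2 - (2 - (z.2 : ℝ)) / scale z = z.2
    rw [scale_eq_one hz, div_one, sub_sub_cancel]

theorem hasRelativeLifting_boundary (T : Type u) [TopologicalSpace T] :
    HasRelativeLifting (faceUnion (Finset.univ : Finset ι)) (evalStart T) :=
  hasRelativeLifting_evalStart (isClosed_faceUnion _) radial radial_mem fun _ => radial_of_mem

end Boundary

section Faces

variable {n : ℕ}

theorem map_succAbove_self (j : Fin (n + 1)) (z : stdSimplex ℝ (Fin n)) :
    stdSimplex.map j.succAbove z j = 0 := by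
  rw [stdSimplex.map_coe, FunOnFinite.linearMap_apply_apply]
  exact Finset.sum_eq_zero fun l hl => absurd (Finset.mem_filter.1 hl).2 (Fin.succAbove_ne j l)

theorem map_succAbove_apply (j : Fin (n + 1)) (z : stdSimplex ℝ (Fin n)) (k : Fin n) :
    stdSimplex.map j.succAbove z (j.succAbove k) = z k := by
  have : (Finset.univ.filter fun l => j.succAbove l = j.succAbove k) = {k} := by
    ext l; simp
  rw [stdSimplex.map_coe, FunOnFinite.linearMap_apply_apply, this, Finset.sum_singleton]

theorem map_succAbove_injective (j : Fin (n + 1)) :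
    Function.Injective (stdSimplex.map (S := ℝ) j.succAbove) := by
  intro z z' h
  ext k
  rw [← map_succAbove_apply j z k, h, map_succAbove_apply]

theorem exists_map_succAbove_eq {j : Fin (n + 1)} {y : stdSimplex ℝ (Fin (n + 1))} (hy : y j = 0) :
    ∃ z, stdSimplex.map j.succAbove z = y := by
  have sum_eq := stdSimplex.sum_eq_one y
  rw [Fin.sum_univ_succAbove _ j, hy, zero_add] at sum_eq
  refine ⟨⟨fun k => y (j.succAbove k), fun k => y.2.1 _, sum_eq⟩, ?_⟩
  ext k
  obtain rfl | ⟨l, rfl⟩ := Fin.eq_self_or_eq_succAbove j k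
  · rw [map_succAbove_self, hy]
  · rw [map_succAbove_apply]; rfl

theorem map_succAbove_comm {j k : Fin (n + 1)} (hjk : j ≤ k) (w : stdSimplex ℝ (Fin n)) :
    stdSimplex.map j.castSucc.succAbove (stdSimplex.map k.succAbove w) =
      stdSimplex.map k.succ.succAbove (stdSimplex.map j.succAbove w) := by
  rw [stdSimplex.map_comp_apply, stdSimplex.map_comp_apply]
  congr 1
  ext l
  grind [Fin.succAbove]

theorem exists_common_face {j k : Fin (n + 1)} (hjk : j ≤ k) {y z : stdSimplex ℝ (Fin (n + 1))}
    (h : stdSimplex.map j.castSucc.succAbove y = stdSimplex.map k.succ.succAbove z) :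
    ∃ w, stdSimplex.map k.succAbove w = y ∧ stdSimplex.map j.succAbove w = z := by
  have hy : y k = 0 := by
    rw [← map_succAbove_apply j.castSucc y k, Fin.succAbove_castSucc_of_le _ _ hjk, h,
      map_succAbove_self]
  obtain ⟨w, rfl⟩ := exists_map_succAbove_eq hy
  exact ⟨w, rfl, map_succAbove_injective _ ((map_succAbove_comm hjk w).symm.trans h)⟩

theorem exists_glue_faces (J : Finset (Fin (n + 2))) {E : Type u} [TopologicalSpace E]
    (f : ∀ j ∈ J, C(stdSimplex ℝ (Fin (n + 1)), E))
    (hf : ∀ (j k : Fin (n + 1)) hj hk y z, j ≤ k →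
      stdSimplex.map j.castSucc.succAbove y = stdSimplex.map k.succ.succAbove z →
        f j.castSucc hj y = f k.succ hk z) :
    ∃ F : C(faceUnion J, E), ∀ j (hj : j ∈ J) y,
      F ⟨stdSimplex.map j.succAbove y, j, hj, map_succAbove_self j y⟩ = f j hj y := by
  let q : C(Σ _ : J, stdSimplex ℝ (Fin (n + 1)), faceUnion J) :=
    ⟨fun p => ⟨stdSimplex.map p.1.1.succAbove p.2, p.1.1, p.1.2, map_succAbove_self _ _⟩,
      continuous_sigma fun j => (stdSimplex.continuous_map (S := ℝ) j.1.succAbove).subtype_mk _⟩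
  have surjective : Function.Surjective q := by
    rintro ⟨x, j, hj, hx⟩
    obtain ⟨z, rfl⟩ := exists_map_succAbove_eq hx
    exact ⟨⟨⟨j, hj⟩, z⟩, rfl⟩
  have of_lt {j k : Fin (n + 2)} (hjk : j < k) (hj : j ∈ J) (hk : k ∈ J) {y z}
      (h : stdSimplex.map j.succAbove y = stdSimplex.map k.succAbove z) :
      f j hj y = f k hk z := by
    obtain ⟨j, rfl⟩ := j.eq_castSucc_of_ne_last (Fin.ne_last_of_lt hjk)
    obtain ⟨k, rfl⟩ := k.eq_succ_of_ne_zero (Fin.ne_zero_of_lt hjk)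
    exact hf j k hj hk y z (Fin.castSucc_lt_succ_iff.1 hjk) h
  obtain ⟨F, hF⟩ := exists_descent q surjective
    ⟨fun p => f p.1.1 p.1.2 p.2, continuous_sigma fun j => (f j.1 j.2).continuous⟩ <| by
      rintro ⟨⟨j, hj⟩, y⟩ ⟨⟨k, hk⟩, z⟩ h
      replace h : stdSimplex.map j.succAbove y = stdSimplex.map k.succAbove z :=
        congrArg Subtype.val h
      obtain hjk | rfl | hjk := lt_trichotomy j k
      · exact of_lt hjk hj hk h
      · exact congrArg (f j hj) (map_succAbove_injective j h)
      · exact (of_lt hjk hk hj h.symm).symm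
  exact ⟨F, fun j hj y => hF ⟨⟨j, hj⟩, y⟩⟩

end Faces

section SingularSimplices

/-- Maps from a standard simplex to a singular simplicial set are maps of spaces defined on the
topological simplex. -/
noncomputable def simplexMapEquiv {n : ℕ} {Z : TopCat.{u}} :
    ((Δ[n] : SSet.{u}) ⟶ TopCat.toSSet.obj Z) ≃ C(stdSimplex ℝ (Fin (n + 1)), Z) :=
  SSet.yonedaEquiv.trans (Z.toSSetObjEquiv (op ⦋n⦌))

theorem simplexMapEquiv_δ_comp {n : ℕ} {Z : TopCat.{u}} (j : Fin (n + 2))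
    (g : (Δ[n + 1] : SSet.{u}) ⟶ TopCat.toSSet.obj Z) (y : stdSimplex ℝ (Fin (n + 1))) :
    simplexMapEquiv (SSet.stdSimplex.δ j ≫ g) y =
      simplexMapEquiv g (stdSimplex.map j.succAbove y) := by
  have : SSet.yonedaEquiv (SSet.stdSimplex.δ j ≫ g) =
      (TopCat.toSSet.obj Z).δ j (SSet.yonedaEquiv g) :=
    (SSet.yonedaEquiv_comp _ _).trans (SSet.yonedaEquiv_naturality ..).symm
  rw [simplexMapEquiv, Equiv.trans_apply, this]
  exact TopCat.toSSetObjEquiv_δ_apply _ _ _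

theorem simplexMapEquiv_comp {n : ℕ} {Z Z' : TopCat.{u}}
    (g : (Δ[n] : SSet.{u}) ⟶ TopCat.toSSet.obj Z) (p : Z ⟶ Z') (y : stdSimplex ℝ (Fin (n + 1))) :
    simplexMapEquiv (g ≫ TopCat.toSSet.map p) y = p (simplexMapEquiv g y) := by
  rw [simplexMapEquiv, Equiv.trans_apply, SSet.yonedaEquiv_comp]
  rfl

variable {n : ℕ} {A : (Δ[n + 1] : SSet.{u}).Subcomplex} {J : Finset (Fin (n + 2))}
  {ι : ∀ j ∈ J, (Δ[n] : SSet.{u}) ⟶ A} (hι : ∀ j hj, ι j hj ≫ A.ι = SSet.stdSimplex.δ j)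
include hι

theorem simplexMapEquiv_comp_eq_of_common_face {Z : TopCat.{u}}
    (f : (A : SSet.{u}) ⟶ TopCat.toSSet.obj Z) {j k : Fin (n + 1)} (hjk : j ≤ k)
    (hj : j.castSucc ∈ J) (hk : k.succ ∈ J) {y z : stdSimplex ℝ (Fin (n + 1))}
    (h : stdSimplex.map j.castSucc.succAbove y = stdSimplex.map k.succ.succAbove z) :
    simplexMapEquiv (ι _ hj ≫ f) y = simplexMapEquiv (ι _ hk ≫ f) z := by
  obtain ⟨w, rfl, rfl⟩ := exists_common_face hjk h
  obtain _ | n := n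
  · exact absurd (stdSimplex.sum_eq_one w) (by simp)
  have : SSet.stdSimplex.δ k ≫ ι _ hj = SSet.stdSimplex.δ j ≫ ι _ hk := by
    rw [← cancel_mono A.ι, Category.assoc, Category.assoc, hι, hι, SSet.stdSimplex.δ_comp_δ hjk]
  rw [← simplexMapEquiv_δ_comp, ← simplexMapEquiv_δ_comp, ← Category.assoc, this, Category.assoc]

theorem hasLiftingProperty_of_hasRelativeLifting
    (hom_ext : ∀ {X : SSet.{u}} {f g : (A : SSet.{u}) ⟶ X},
      (∀ j hj, ι j hj ≫ f = ι j hj ≫ g) → f = g)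
    {E B : TopCat.{u}} {p : E ⟶ B} (hp : HasRelativeLifting (faceUnion J) p.hom) :
    HasLiftingProperty A.ι (TopCat.toSSet.map p) := by
  refine ⟨fun {f b} sq => ?_⟩
  obtain ⟨F, hF⟩ := exists_glue_faces J (fun j hj => simplexMapEquiv (ι j hj ≫ f))
    fun j k hj hk _ _ hjk h => simplexMapEquiv_comp_eq_of_common_face hι f hjk hj hk h
  have hFb (x : faceUnion J) : p (F x) = simplexMapEquiv b x := by
    obtain ⟨x, j, hj, hx⟩ := x
    obtain ⟨y, rfl⟩ := exists_map_succAbove_eq hx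
    rw [hF j hj, ← simplexMapEquiv_comp, Category.assoc, sq.w, ← Category.assoc, hι,
      simplexMapEquiv_δ_comp]
  obtain ⟨l, hlF, hlb⟩ := hp F (simplexMapEquiv b) hFb
  refine ⟨⟨⟨simplexMapEquiv.symm l, hom_ext fun j hj => ?_, ?_⟩⟩⟩
  · rw [← Category.assoc, hι]
    apply simplexMapEquiv.injective
    ext y
    rw [simplexMapEquiv_δ_comp, Equiv.apply_symm_apply]
    exact (hlF ⟨_, j, hj, map_succAbove_self j y⟩).trans (hF j hj y)
  · apply simplexMapEquiv.injective
    ext y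
    rw [simplexMapEquiv_comp, Equiv.apply_symm_apply]
    exact hlb y

end SingularSimplices

section PathSpaces

theorem hasLiftingProperty_horn {n : ℕ} (k : Fin (n + 2)) {E B : TopCat.{u}} {p : E ⟶ B}
    (hp : HasHomotopyLifting p.hom) :
    HasLiftingProperty (SSet.horn.{u} (n + 1) k).ι (TopCat.toSSet.map p) :=
  hasLiftingProperty_of_hasRelativeLifting
    (ι := fun j hj => SSet.horn.ι k j (by simpa using hj)) (fun j _ => SSet.horn.ι_ι k j _)
    (fun h => SSet.horn.hom_ext' fun j hj => h j (by simpa using hj))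
    (hasRelativeLifting_horn k hp)

/-- The space of paths in a space. -/
abbrev pathSpace (T : TopCat.{u}) : TopCat.{u} := TopCat.of C(I, T)

/-- The evaluation of paths at their start. -/
def evalZero (T : TopCat.{u}) : pathSpace T ⟶ T :=
  TopCat.ofHom (evalStart T)

/-- The evaluation of paths at both ends. -/
def evalEnds (T : TopCat.{u}) : pathSpace T ⟶ TopCat.of (T × T) :=
  TopCat.ofHom ⟨fun γ => (γ 0, γ 1), by fun_prop⟩

/-- The inclusion of the constant paths. -/
def constPath (T : TopCat.{u}) : T ⟶ pathSpace T :=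
  TopCat.ofHom (HomotopyExtension.constPaths (ContinuousMap.id T))

theorem constPath_evalZero (T : TopCat.{u}) : constPath T ≫ evalZero T = 𝟙 T := rfl

theorem rlp_boundary_evalZero (T : TopCat.{u}) :
    SSet.modelCategoryQuillen.I.rlp (TopCat.toSSet.map (evalZero T)) := by
  rintro _ _ _ ⟨n⟩
  obtain _ | n := n
  · refine ⟨fun {f b} sq => ⟨⟨⟨b ≫ TopCat.toSSet.map (constPath T), SSet.boundary.hom_ext₀, ?_⟩⟩⟩⟩
    rw [Category.assoc, ← Functor.map_comp, constPath_evalZero, CategoryTheory.Functor.map_id,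
      Category.comp_id]
  · exact hasLiftingProperty_of_hasRelativeLifting (ι := fun j _ => SSet.boundary.ι j)
      (fun j _ => SSet.boundary.ι_ι j)
      (fun h => SSet.boundary.hom_ext fun j => h j (Finset.mem_univ j))
      (hasRelativeLifting_boundary T)

theorem hasHomotopyLifting_evalEnds (T : TopCat.{u}) : HasHomotopyLifting (evalEnds T).hom := by
  intro Y _ f h hf
  let U : C(Y, C(I, T)) := ContinuousMap.curry (ContinuousMap.fst.comp h)
  let V : C(Y, C(I, T)) := ContinuousMap.curry (ContinuousMap.snd.comp h)
  have h₀ (y : Y) : U y 0 = f y 0 := congrArg Prod.fst (hf y)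
  have h₁ (y : Y) : V y 0 = f y 1 := congrArg Prod.snd (hf y)
  exact ⟨HomotopyExtension.concat U f V h₀ h₁, HomotopyExtension.concat_zero h₀ h₁, fun z =>
    Prod.ext (HomotopyExtension.concat_start h₀ h₁ z.1 z.2)
      (HomotopyExtension.concat_end h₀ h₁ z.1 z.2)⟩

/-- The map to a point. -/
def toPoint (T : TopCat.{u}) : T ⟶ TopCat.of PUnit.{u + 1} :=
  TopCat.ofHom ⟨fun _ => PUnit.unit, continuous_const⟩

theorem hasHomotopyLifting_toPoint (T : TopCat.{u}) : HasHomotopyLifting (toPoint T).hom :=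
  fun _ _ f _ _ => ⟨f.comp ContinuousMap.fst, fun _ => rfl, fun _ => rfl⟩

end PathSpaces

end SimplexLifting

/-! ### Weak equivalences of simplicial sets -/

namespace RealizationEquivalence

open Simplicial MonoidalCategory CartesianMonoidalCategory Limits SimplexLifting HomotopyExtension

section HomotopyCategory

/-- The homotopy relation on continuous maps. -/
def homotopyRel : HomRel TopCat.{u} := fun _ _ f g => ContinuousMap.Homotopic f.hom g.hom

instance : Congruence homotopyRel.{u} where
  equivalence :=
    { refl := fun f => ContinuousMap.Homotopic.refl f.hom
      symm := fun h => ContinuousMap.Homotopic.symm h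
      trans := fun h h' => ContinuousMap.Homotopic.trans h h' }
  comp_left f _ _ h := ContinuousMap.Homotopic.comp h (ContinuousMap.Homotopic.refl f.hom)
  comp_right g h := ContinuousMap.Homotopic.comp (ContinuousMap.Homotopic.refl g.hom) h

/-- The functor from topological spaces to the naive homotopy category. -/
abbrev toHo : TopCat.{u} ⥤ Quotient homotopyRel.{u} := Quotient.functor homotopyRel

theorem toHo_map_eq_iff {X Y : TopCat.{u}} (f g : X ⟶ Y) :
    toHo.map f = toHo.map g ↔ ContinuousMap.Homotopic f.hom g.hom :=
  Quotient.functor_map_eq_iff homotopyRel f g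

theorem toHo_map_comp_eq_id_iff {X Y : TopCat.{u}} (f : X ⟶ Y) (g : Y ⟶ X) :
    toHo.map f ≫ toHo.map g = 𝟙 _ ↔
      ContinuousMap.Homotopic (g.hom.comp f.hom) (ContinuousMap.id X) := by
  rw [← Functor.map_comp, ← CategoryTheory.Functor.map_id, toHo_map_eq_iff]
  rfl

theorem isHomotopyEquivalence_iff {X Y : TopCat.{u}} (f : X ⟶ Y) :
    IsHomotopyEquivalence f ↔ IsIso (toHo.map f) := by
  constructor
  · rintro ⟨e, he⟩
    exact ⟨toHo.map (TopCat.ofHom e.invFun), (toHo_map_comp_eq_id_iff _ _).2 (he ▸ e.left_inv),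
      (toHo_map_comp_eq_id_iff _ _).2 (he ▸ e.right_inv)⟩
  · rintro ⟨g, h₁, h₂⟩
    obtain ⟨g, rfl⟩ := toHo.map_surjective g
    exact ⟨⟨f.hom, g.hom, (toHo_map_comp_eq_id_iff _ _).1 h₁,
      (toHo_map_comp_eq_id_iff _ _).1 h₂⟩, rfl⟩

variable {ι : Type w₁} {X : ι → TopCat.{u}} {A : TopCat.{u}} {a : ∀ i, X i ⟶ A}

theorem toHo_map_eq_of_cofan (ha : IsColimit (Cofan.mk A a)) {T : TopCat.{u}} (f g : A ⟶ T)
    (h : ∀ i, toHo.map (a i ≫ f) = toHo.map (a i ≫ g)) : toHo.map f = toHo.map g := by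
  simp only [toHo_map_eq_iff] at h ⊢
  let H i := (h i).some
  let K : A ⟶ pathSpace T := Cofan.IsColimit.desc ha fun i => TopCat.ofHom (pathFamily (H i))
  have inj_comp_K (i : ι) : a i ≫ K = TopCat.ofHom (pathFamily (H i)) :=
    Cofan.IsColimit.fac ha _ i
  have K_evalEnds : K ≫ evalEnds T = TopCat.ofHom (f.hom.prodMk g.hom) :=
    Cofan.IsColimit.hom_ext ha _ _ fun i => by
      change a i ≫ K ≫ evalEnds T = _
      rw [← Category.assoc, inj_comp_K]
      exact TopCat.hom_ext (ContinuousMap.ext fun x =>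
        Prod.ext ((H i).map_zero_left x) ((H i).map_one_left x))
  exact ⟨homotopyOfPathFamily K.hom
    (fun x => congrArg Prod.fst (ConcreteCategory.congr_hom K_evalEnds x))
    (fun x => congrArg Prod.snd (ConcreteCategory.congr_hom K_evalEnds x))⟩

/-- Coproducts of spaces are coproducts in the naive homotopy category. -/
noncomputable def isColimitMapToHo (ha : IsColimit (Cofan.mk A a)) :
    IsColimit (Cofan.mk (toHo.obj A) fun i => toHo.map (a i)) :=
  Cofan.IsColimit.mk _
    (fun s => toHo.map (Cofan.IsColimit.desc ha fun i => (toHo.map_surjective (s.inj i)).choose))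
    (fun s i => by
      refine (toHo.map_comp _ _).symm.trans ?_
      rw [← (toHo.map_surjective (s.inj i)).choose_spec]
      exact congrArg toHo.map (Cofan.IsColimit.fac ha _ i))
    (fun s m hm => by
      obtain ⟨m, rfl⟩ := toHo.map_surjective m
      refine toHo_map_eq_of_cofan ha _ _ fun i => ?_
      refine ((toHo.map_comp _ _).trans (hm i)).trans ?_
      rw [← (toHo.map_surjective (s.inj i)).choose_spec]
      exact (congrArg toHo.map (Cofan.IsColimit.fac ha
        (fun i => (toHo.map_surjective (s.inj i)).choose) i)).symm)

end HomotopyCategory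

section WeakEquivalences

/-- The realization of simplicial sets, as a functor to the naive homotopy category. -/
noncomputable abbrev realHo : SSet.{u} ⥤ Quotient homotopyRel.{u} := SSet.toTop ⋙ toHo

/-- The weak equivalences of simplicial sets: the maps whose realization is a homotopy
equivalence. -/
def weakEquivalences : MorphismProperty SSet.{u} :=
  (MorphismProperty.isomorphisms _).inverseImage realHo

instance : weakEquivalences.{u}.HasTwoOutOfThreeProperty := by
  unfold weakEquivalences; infer_instance

instance : weakEquivalences.{u}.RespectsIso := by unfold weakEquivalences; infer_instance

instance : weakEquivalences.{u}.IsMultiplicative := by unfold weakEquivalences; infer_instance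

theorem weakEquivalences_iff {X Y : SSet.{u}} (f : X ⟶ Y) :
    weakEquivalences f ↔ IsHomotopyEquivalence (SSet.toTop.map f) :=
  (isHomotopyEquivalence_iff _).symm

theorem weakEquivalences_of_inverse {X Y : SSet.{u}} (f : X ⟶ Y) (g : Y ⟶ X)
    (h₁ : realHo.map (f ≫ g) = 𝟙 _) (h₂ : realHo.map (g ≫ f) = 𝟙 _) : weakEquivalences f :=
  ⟨realHo.map g, by rw [← Functor.map_comp, h₁], by rw [← Functor.map_comp, h₂]⟩

theorem weakEquivalences_of_cofan {ι : Type w₁} {X Y : ι → SSet.{u}} {A B : SSet.{u}}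
    {a : ∀ i, X i ⟶ A} {b : ∀ i, Y i ⟶ B} (ha : IsColimit (Cofan.mk A a))
    (hb : IsColimit (Cofan.mk B b)) (f : A ⟶ B) (g : ∀ i, X i ⟶ Y i)
    (h : ∀ i, a i ≫ f = g i ≫ b i) (hg : ∀ i, weakEquivalences (g i)) : weakEquivalences f :=
  MorphismProperty.IsStableUnderColimitsOfShape.condition (W := .isomorphisms _) _ _ _ _
    (isColimitMapToHo (isColimitCofanMkObjOfIsColimit SSet.toTop _ _ ha))
    (isColimitMapToHo (isColimitCofanMkObjOfIsColimit SSet.toTop _ _ hb))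
    (Discrete.natTrans fun i => realHo.map (g i.as)) (fun i => hg i.as) (realHo.map f) fun i =>
      ((realHo.map_comp _ _).symm.trans (congrArg realHo.map (h i.as))).trans
        (realHo.map_comp _ _)

end WeakEquivalences

section LiftingCharacterization

variable {X Y : SSet.{u}} {i : X ⟶ Y}

theorem extendsMaps_toTop_map_iff : ExtendsMaps (SSet.toTop.map i).hom ↔
    ∀ T : TopCat.{u}, HasLiftingProperty i (TopCat.toSSet.map (toPoint T)) := by
  simp only [← sSetTopAdj.hasLiftingProperty_iff]
  constructor
  · intro h T
    refine ⟨fun {f b} sq => ?_⟩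
    obtain ⟨k, hk⟩ := h T f.hom
    exact ⟨⟨⟨TopCat.ofHom k, TopCat.hom_ext (ContinuousMap.ext hk), rfl⟩⟩⟩
  · intro h T _ g
    have := h (TopCat.of T)
    have sq : CommSq (TopCat.ofHom g) (SSet.toTop.map i) (toPoint (TopCat.of T)) (toPoint _) :=
      ⟨rfl⟩
    exact ⟨sq.lift.hom, fun a => ConcreteCategory.congr_hom sq.fac_left a⟩

theorem extendsHomotopies_toTop_map_iff : ExtendsHomotopies (SSet.toTop.map i).hom ↔
    ∀ T : TopCat.{u}, HasLiftingProperty i (TopCat.toSSet.map (evalEnds T)) := by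
  simp only [← sSetTopAdj.hasLiftingProperty_iff]
  constructor
  · intro h T
    refine ⟨fun {f b} sq => ?_⟩
    have hs a := ConcreteCategory.congr_hom sq.w a
    obtain ⟨k, h₀, h₁, hk⟩ := h T (ContinuousMap.fst.comp b.hom) (ContinuousMap.snd.comp b.hom)
      f.hom (fun a => congrArg Prod.fst (hs a)) (fun a => congrArg Prod.snd (hs a))
    exact ⟨⟨⟨TopCat.ofHom k, TopCat.hom_ext (ContinuousMap.ext hk),
      TopCat.hom_ext (ContinuousMap.ext fun x => Prod.ext (h₀ x) (h₁ x))⟩⟩⟩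
  · intro h T _ f g k h₀ h₁
    have := h (TopCat.of T)
    have sq : CommSq (TopCat.ofHom k) (SSet.toTop.map i) (evalEnds (TopCat.of T))
        (TopCat.ofHom (f.prodMk g)) :=
      ⟨TopCat.hom_ext (ContinuousMap.ext fun a => Prod.ext (h₀ a) (h₁ a))⟩
    have hr x := ConcreteCategory.congr_hom sq.fac_right x
    exact ⟨sq.lift.hom, fun x => congrArg Prod.fst (hr x), fun x => congrArg Prod.snd (hr x),
      fun a => ConcreteCategory.congr_hom sq.fac_left a⟩

/-- The singular maps of `T → pt` and of `T^I → T × T`, for all spaces `T`, against which lifting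
detects the trivial cofibrations among the monomorphisms. -/
def testFibrations : MorphismProperty SSet.{u} :=
  MorphismProperty.ofHoms (fun T : TopCat.{u} => TopCat.toSSet.map (toPoint T)) ⊔
    MorphismProperty.ofHoms (fun T : TopCat.{u} => TopCat.toSSet.map (evalEnds T))

theorem testFibrations_llp_iff : testFibrations.llp i ↔
    ExtendsMaps (SSet.toTop.map i).hom ∧ ExtendsHomotopies (SSet.toTop.map i).hom := by
  rw [extendsMaps_toTop_map_iff, extendsHomotopies_toTop_map_iff]
  constructor
  · exact fun h => ⟨fun T => h _ (Or.inl ⟨T⟩), fun T => h _ (Or.inr ⟨T⟩)⟩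
  · rintro ⟨h₁, h₂⟩ _ _ _ (⟨⟨T⟩⟩ | ⟨⟨T⟩⟩)
    exacts [h₁ T, h₂ T]

theorem hasHomotopyExtension_toTop_map [Mono i] :
    HasHomotopyExtension (SSet.toTop.map i).hom := by
  intro T _ g h hg
  have hr := rlp_boundary_evalZero (TopCat.of T)
  rw [← SSet.rlp_monomorphisms] at hr
  have := hr i (MorphismProperty.monomorphisms.infer_property i)
  rw [← sSetTopAdj.hasLiftingProperty_iff] at this
  have sq : CommSq (TopCat.ofHom h) (SSet.toTop.map i) (evalZero (TopCat.of T))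
      (TopCat.ofHom g) := ⟨TopCat.hom_ext (ContinuousMap.ext hg)⟩
  exact ⟨sq.lift.hom, fun x => ConcreteCategory.congr_hom sq.fac_right x,
    fun a => ConcreteCategory.congr_hom sq.fac_left a⟩

theorem weakEquivalences_of_llp (h : testFibrations.llp i) : weakEquivalences i := by
  rw [testFibrations_llp_iff] at h
  exact (weakEquivalences_iff i).2
    (IsStrongDeformationRetract.of_extends h.1 h.2).exists_homotopyEquiv

theorem llp_of_weakEquivalences [Mono i] (h : weakEquivalences i) : testFibrations.llp i := by
  obtain ⟨e, he⟩ := (weakEquivalences_iff i).1 h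
  have hi : HasHomotopyExtension (SSet.toTop.map i).hom := hasHomotopyExtension_toTop_map
  have hs := hi.isStrongDeformationRetract e he
  exact testFibrations_llp_iff.2 ⟨hs.extendsMaps, hs.extendsHomotopies hi⟩

theorem testFibrations_le : testFibrations.{u} ≤ SSet.modelCategoryQuillen.J.rlp := by
  rintro _ _ _ hp _ _ _ hi
  simp only [SSet.modelCategoryQuillen.J, MorphismProperty.iSup_iff] at hi
  obtain ⟨n, ⟨k⟩⟩ := hi
  rcases hp with ⟨⟨T⟩⟩ | ⟨⟨T⟩⟩
  · exact hasLiftingProperty_horn k (hasHomotopyLifting_toPoint T)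
  · exact hasLiftingProperty_horn k (hasHomotopyLifting_evalEnds T)

theorem weakEquivalences_of_anodyne (h : SSet.anodyneExtensions i) : weakEquivalences i :=
  weakEquivalences_of_llp (MorphismProperty.antitone_llp testFibrations_le _ h)

end LiftingCharacterization

section TrivialCofibrations

/-- The monomorphisms of simplicial sets that are weak equivalences. -/
def trivialCofibrations : MorphismProperty SSet.{u} :=
  MorphismProperty.monomorphisms _ ⊓ weakEquivalences

theorem trivialCofibrations_eq_llp :
    trivialCofibrations.{u} = MorphismProperty.monomorphisms _ ⊓ testFibrations.llp := by
  ext X Y i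
  refine and_congr_right fun (_ : Mono i) => ⟨llp_of_weakEquivalences, weakEquivalences_of_llp⟩

instance : trivialCofibrations.{u}.IsStableUnderCobaseChange := by
  rw [trivialCofibrations_eq_llp]; infer_instance

instance : trivialCofibrations.{u}.IsMultiplicative := by
  unfold trivialCofibrations; infer_instance

theorem trivialCofibrations_range_ι {X Y : SSet.{u}} {i : X ⟶ Y} [Mono i]
    (hi : weakEquivalences i) : trivialCofibrations (SSet.Subcomplex.range i).ι := by
  refine ⟨inferInstanceAs (Mono _), weakEquivalences.of_precomp (SSet.Subcomplex.toRange i) _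
    (MorphismProperty.of_isIso weakEquivalences _) ?_⟩
  rwa [SSet.Subcomplex.toRange_ι]

theorem weakEquivalences_of_range_ι {X Y : SSet.{u}} {i : X ⟶ Y} [Mono i]
    (hi : weakEquivalences (SSet.Subcomplex.range i).ι) : weakEquivalences i := by
  rw [← SSet.Subcomplex.toRange_ι i]
  exact weakEquivalences.comp_mem _ _ (MorphismProperty.of_isIso weakEquivalences _) hi

open SSet.Subcomplex in
theorem trivialCofibrations_ι_of_chain {Z : SSet.{u}} (B : ℕ → Z.Subcomplex) (hB : Monotone B)
    (h : ∀ n, trivialCofibrations (homOfLE (hB (Nat.le_succ n)))) (hsup : ⨆ n, B n = ⊤) :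
    trivialCofibrations (B 0).ι := by
  rw [trivialCofibrations_eq_llp] at h ⊢
  refine ⟨MorphismProperty.monomorphisms.infer_property _, ?_⟩
  have T : testFibrations.llp.TransfiniteCompositionOfShape ℕ (B 0).ι :=
    { F := hB.functor ⋙ toSSetFunctor
      isoBot := Iso.refl _
      incl := { app := fun n => (B n).ι }
      isColimit := IsColimit.ofIsoColimit (isColimitOfPreserves toSSetFunctor
        ((CompleteLattice.colimitCocone hB.functor).isColimit))
          (Cocone.ext (SSet.Subcomplex.eqToIso hsup ≪≫ topIso _))
      map_mem := fun n _ => (h n).2 }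
  exact testFibrations.llp.transfiniteCompositionsOfShape_le ℕ _ T.mem

end TrivialCofibrations

section Contractions

theorem anodyneExtensions_δ_one :
    SSet.anodyneExtensions (SSet.stdSimplex.δ (1 : Fin 2) : (Δ[0] : SSet.{u}) ⟶ Δ[1]) := by
  have range_eq_horn : SSet.Subcomplex.range (SSet.stdSimplex.{u}.δ (1 : Fin 2)) =
      SSet.horn 1 0 := by
    rw [SSet.stdSimplex.range_δ, SSet.horn_eq_iSup]
    apply le_antisymm
    · exact le_iSup (fun j : ({0}ᶜ : Set (Fin 2)) => SSet.stdSimplex.face.{u} {j.1}ᶜ) ⟨1, by simp⟩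
    · refine iSup_le ?_
      rintro ⟨j, hj⟩
      obtain rfl : j = 1 := by fin_cases j <;> simp_all
      rfl
  rw [← SSet.Subcomplex.toRange_ι (SSet.stdSimplex.{u}.δ (1 : Fin 2))]
  refine MorphismProperty.comp_mem _ _ _ (SSet.anodyneExtensions.of_isIso _) ?_
  rw [range_eq_horn]
  exact SSet.anodyneExtensions.horn_ι 0

theorem weakEquivalences_fst_interval (X : SSet.{u}) : weakEquivalences (fst X Δ[1]) := by
  have : IsIso (fst X Δ[0]) := by
    refine ⟨lift (𝟙 X) (SSet.stdSimplex.isTerminalObj₀.from X), ?_, by simp⟩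
    ext : 1
    · simp
    · exact SSet.stdSimplex.ext₀
  refine weakEquivalences.of_precomp (X ◁ SSet.stdSimplex.δ (1 : Fin 2)) _
    (weakEquivalences_of_anodyne (anodyneExtensions_δ_one.whiskerLeft X)) ?_
  rw [whiskerLeft_fst]
  exact MorphismProperty.of_isIso weakEquivalences _

theorem realHo_map_ι₀_comp {X Y : SSet.{u}} (H : X ⊗ Δ[1] ⟶ Y) :
    realHo.map (SSet.ι₀ ≫ H) = realHo.map (SSet.ι₁ ≫ H) := by
  have : IsIso (realHo.map (fst X Δ[1])) := weakEquivalences_fst_interval X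
  have h : realHo.map (SSet.ι₀ (X := X)) = realHo.map SSet.ι₁ := by
    rw [← cancel_mono (realHo.map (fst X Δ[1])), ← Functor.map_comp, ← Functor.map_comp,
      SSet.ι₀_fst, SSet.ι₁_fst]
  rw [Functor.map_comp, Functor.map_comp, h]

theorem weakEquivalences_fst_of_contraction {K : SSet.{u}} (pt : K _⦋0⦌) (H : K ⊗ Δ[1] ⟶ K)
    (h₀ : SSet.ι₀ ≫ H = 𝟙 K) (h₁ : SSet.ι₁ ≫ H = SSet.const pt) (X : SSet.{u}) :
    weakEquivalences (fst X K) := by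
  let H' : (X ⊗ K) ⊗ Δ[1] ⟶ X ⊗ K := (α_ X K Δ[1]).hom ≫ X ◁ H
  have h₀' : SSet.ι₀ ≫ H' = 𝟙 _ := by
    change X ◁ SSet.ι₀ ≫ X ◁ H = _
    rw [← MonoidalCategory.whiskerLeft_comp, h₀, MonoidalCategory.whiskerLeft_id]
  have h₁' : SSet.ι₁ ≫ H' = fst X K ≫ lift (𝟙 X) (SSet.const pt) := by
    change X ◁ SSet.ι₁ ≫ X ◁ H = _
    rw [← MonoidalCategory.whiskerLeft_comp, h₁]
    rfl
  refine weakEquivalences_of_inverse _ (lift (𝟙 X) (SSet.const pt)) ?_ ?_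
  · rw [← h₁', ← realHo_map_ι₀_comp, h₀', CategoryTheory.Functor.map_id]
  · rw [lift_fst, CategoryTheory.Functor.map_id]

/-- The contraction of a simplex to its last vertex. -/
noncomputable def simplexContraction (n : ℕ) : (Δ[n] : SSet.{u}) ⊗ Δ[1] ⟶ Δ[n] where
  app m := ↾fun x => SSet.stdSimplex.objMk
    { toFun := fun j => if SSet.stdSimplex.asOrderHom x.2 j = 0 then
        SSet.stdSimplex.asOrderHom x.1 j else Fin.last n
      monotone' := fun j k hjk => by
        have h₁ := (SSet.stdSimplex.asOrderHom x.1).monotone hjk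
        have h₂ := (SSet.stdSimplex.asOrderHom x.2).monotone hjk
        dsimp only
        split_ifs with hj hk hk
        · exact h₁
        · exact Fin.le_last _
        · exact absurd (le_antisymm (hk ▸ h₂) (Fin.zero_le _)) hj
        · exact le_rfl }
  naturality _ _ _ := rfl

theorem weakEquivalences_fst_stdSimplex (X : SSet.{u}) (n : ℕ) :
    weakEquivalences (fst X Δ[n]) :=
  weakEquivalences_fst_of_contraction (SSet.stdSimplex.obj₀Equiv.symm (Fin.last n))
    (simplexContraction n) (NatTrans.ext (funext fun _ => ConcreteCategory.hom_ext _ _ fun _ =>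
      SSet.stdSimplex.objEquiv.injective (by ext; rfl))) rfl X

end Contractions

section Products

instance mono_whiskerRight {X Y : SSet.{u}} (f : X ⟶ Y) [Mono f] (Z : SSet.{u}) : Mono (f ▷ Z) where
  right_cancellation g h w := by
    ext : 1
    · rw [← cancel_mono f]
      simpa using congrArg (fun k => k ≫ fst Y Z) w
    · simpa using congrArg (fun k => k ≫ snd Y Z) w

theorem weakEquivalences_whiskerRight_stdSimplex {X Y : SSet.{u}} {f : X ⟶ Y}
    (hf : weakEquivalences f) (n : ℕ) : weakEquivalences (f ▷ (Δ[n] : SSet.{u})) := by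
  refine weakEquivalences.of_postcomp _ _ (weakEquivalences_fst_stdSimplex Y n) ?_
  rw [whiskerRight_fst]
  exact weakEquivalences.comp_mem _ _ (weakEquivalences_fst_stdSimplex X n) hf

open HomotopicalAlgebra MonoidalClosed SSet.Subcomplex

variable {X : SSet.{u}} {S : X.Subcomplex}

/-- By adjunction, the hypothesis says that the pullback-hom of `S.ι` and a test fibration lifts
against the cells of `K`. -/
theorem trivialCofibrations_ι_whiskerRight_of_cells {K : SSet.{u}}
    (h : ∀ d, (K.nonDegenerate d).Nonempty →
      trivialCofibrations (S.unionProd (∂Δ[d] : Δ[d].Subcomplex)).ι) :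
    trivialCofibrations (S.ι ▷ K) := by
  simp only [trivialCofibrations_eq_llp] at h ⊢
  refine ⟨inferInstanceAs (Mono _), fun E B p hp => ?_⟩
  let J : MorphismProperty SSet.{u} :=
    .ofHoms fun d : {d // (K.nonDegenerate d).Nonempty} => (∂Δ[d.1] : Δ[d.1].Subcomplex).ι
  let pushoutProduct := Functor.PushoutObjObj.ofIsInitialRight (curriedTensor SSet.{u}) S.ι
    (⊥ : K.Subcomplex).ι isInitialBot
  let pullbackHom := Functor.PullbackObjObj.ofHasPullback MonoidalClosed.internalHom S.ι p
  have rlp_pullbackHom : J.rlp pullbackHom.π := by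
    rintro _ _ _ ⟨d⟩
    rw [← internalHomAdjunction₂.hasLiftingProperty_iff (unionProd.pushoutObjObj.{u} S ∂Δ[d.1])]
    exact (h d.1 d.2).2 p hp
  change HasLiftingProperty pushoutProduct.ι p
  rw [internalHomAdjunction₂.hasLiftingProperty_iff pushoutProduct pullbackHom]
  refine MorphismProperty.transfiniteCompositionsOfShape_pushouts_coproducts_le_llp_rlp.{u} J ℕ _
    ⟨(SSet.relativeCellComplex K).transfiniteCompositionOfShape' fun s => ?_⟩ _ rlp_pullbackHom
  exact ⟨(⟨s.j, _, s.k.nonDegenerate⟩ : {d // (K.nonDegenerate d).Nonempty})⟩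

theorem trivialCofibrations_unionProd_boundary (hS : trivialCofibrations S.ι) (n : ℕ) :
    trivialCofibrations (S.unionProd (∂Δ[n] : Δ[n].Subcomplex)).ι := by
  induction n using Nat.strong_induction_on with
  | _ n ih =>
    have whiskered : trivialCofibrations (S.ι ▷ (∂Δ[n] : SSet.{u})) := by
      refine trivialCofibrations_ι_whiskerRight_of_cells ?_
      rintro d ⟨x, hx⟩
      exact ih d (SSet.dim_lt_of_nonDegenerate _ ⟨x, hx⟩ n)
    have side : trivialCofibrations (unionProd.ι₂ S (∂Δ[n] : Δ[n].Subcomplex)) :=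
      MorphismProperty.of_isPushout (unionProd.isPushout S ∂Δ[n]).flip whiskered
    refine ⟨inferInstanceAs (Mono _), weakEquivalences.of_precomp _ _ side.2 ?_⟩
    rw [unionProd.ι₂_ι]
    exact weakEquivalences_whiskerRight_stdSimplex hS.2 n

theorem weakEquivalences_whiskerRight_of_mono {X Y : SSet.{u}} {i : X ⟶ Y} [Mono i]
    (hi : weakEquivalences i) (K : SSet.{u}) : weakEquivalences (i ▷ K) := by
  rw [← SSet.Subcomplex.toRange_ι i, MonoidalCategory.comp_whiskerRight]
  refine weakEquivalences.comp_mem _ _ (MorphismProperty.of_isIso weakEquivalences _) ?_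
  exact (trivialCofibrations_ι_whiskerRight_of_cells fun d _ =>
    trivialCofibrations_unionProd_boundary (trivialCofibrations_range_ι hi) d).2

end Products

section Attachment

theorem trivialCofibrations_homOfLE_of_ge {Z : SSet.{u}} {B B' : Z.Subcomplex} (h : B ≤ B')
    (h' : B' ≤ B) : trivialCofibrations (SSet.Subcomplex.homOfLE h) := by
  have : IsIso (SSet.Subcomplex.homOfLE h) := ⟨SSet.Subcomplex.homOfLE h', rfl, rfl⟩
  exact ⟨inferInstanceAs (Mono _), MorphismProperty.of_isIso weakEquivalences _⟩

open SSet.Subcomplex in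
/-- `B'` is obtained from `B` by attaching `X` along `A`. -/
theorem trivialCofibrations_homOfLE_of_attach {X Z : SSet.{u}} (f : X ⟶ Z) {A : X.Subcomplex}
    {B B' : Z.Subcomplex} (hle : B ≤ B')
    (hA : ∀ m (x : X.obj m), f.app m x ∈ B.obj m ↔ x ∈ A.obj m)
    (hB' : ∀ m (z : Z.obj m), z ∈ B'.obj m ↔ z ∈ B.obj m ∨ ∃ x, f.app m x = z)
    (hf : ∀ m (x x' : X.obj m), x ∉ A.obj m → x' ∉ A.obj m → f.app m x = f.app m x' → x = x')
    (hι : trivialCofibrations A.ι) : trivialCofibrations (homOfLE hle) := by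
  let t : (A : SSet.{u}) ⟶ (B : SSet.{u}) := SSet.Subcomplex.lift (A.ι ≫ f) (by
    rintro m _ ⟨x, rfl⟩
    exact (hA m x.1).2 x.2)
  let b : X ⟶ (B' : SSet.{u}) := SSet.Subcomplex.lift f (by
    rintro m _ ⟨x, rfl⟩
    exact (hB' m _).2 (Or.inr ⟨x, rfl⟩))
  have isPushout_app (m : SimplexCategoryᵒᵖ) :
      IsPushout (t.app m) (A.ι.app m) ((SSet.Subcomplex.homOfLE hle).app m) (b.app m) := by
    refine Types.isPushout_of_isPullback_of_mono' ?_ ?_ ?_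
    · rw [Types.isPullback_iff]
      refine ⟨rfl, fun x y h => Subtype.ext h.2, ?_⟩
      rintro ⟨z, hz⟩ x h
      obtain rfl : z = f.app m x := congrArg Subtype.val h
      exact ⟨⟨x, (hA m x).1 hz⟩, rfl, rfl⟩
    · refine Set.eq_univ_of_forall ?_
      rintro ⟨z, hz⟩
      rcases (hB' m z).1 hz with hz' | ⟨x, rfl⟩
      · exact Or.inl ⟨⟨z, hz'⟩, rfl⟩
      · exact Or.inr ⟨x, rfl⟩
    · exact fun x x' hx hx' h => hf m x x' (fun h' => hx ⟨⟨x, h'⟩, rfl⟩)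
        (fun h' => hx' ⟨⟨x', h'⟩, rfl⟩) (congrArg Subtype.val h)
  have isPushout : IsPushout t A.ι (homOfLE hle) b :=
    { w := rfl
      isColimit' := ⟨evaluationJointlyReflectsColimits _ fun m =>
        (isColimitMapCoconePushoutCoconeEquiv _ _).2 (isPushout_app m).isColimit⟩ }
  exact MorphismProperty.of_isPushout isPushout hι

end Attachment

/-- A bisimplicial subset of a bisimplicial set. -/
structure Subbisimplicial (Y : SimplicialObject SSet.{u}) where
  obj (p : SimplexCategoryᵒᵖ) : (Y.obj p).Subcomplex
  map {p q : SimplexCategoryᵒᵖ} (φ : p ⟶ q) {m : SimplexCategoryᵒᵖ} {y : (Y.obj p).obj m} :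
    y ∈ (obj p).obj m → (Y.map φ).app m y ∈ (obj q).obj m

/-- A column of a bisimplicial set. -/
abbrev column (Y : SimplicialObject SSet.{u}) (m : SimplexCategoryᵒᵖ) : SSet.{u} :=
  Y ⋙ (evaluation _ _).obj m

section Column

variable (Y : SimplicialObject SSet.{u}) {m : SimplexCategoryᵒᵖ}

theorem column_δ_castSucc_σ {p : ℕ} (i : Fin (p + 1)) (w : (column Y m) _⦋p⦌) :
    (column Y m).δ i.castSucc ((column Y m).σ i w) = w :=
  ConcreteCategory.congr_hom ((column Y m).δ_comp_σ_self (i := i)) w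

theorem column_δ_succ_σ {p : ℕ} (i : Fin (p + 1)) (w : (column Y m) _⦋p⦌) :
    (column Y m).δ i.succ ((column Y m).σ i w) = w :=
  ConcreteCategory.congr_hom ((column Y m).δ_comp_σ_succ (i := i)) w

/-- The map from the product of a row with a simplex to the diagonal, given by the action of the
simplicial operators on the rows. -/
def rowAction (n : ℕ) : Y.obj (op ⦋n⦌) ⊗ Δ[n] ⟶ diag.obj Y where
  app m := ↾fun x => (column Y m).map (SSet.stdSimplex.objEquiv x.2).op x.1
  naturality m m' ψ := by
    refine ConcreteCategory.hom_ext _ _ fun x => ?_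
    change (Y.map ((SSet.stdSimplex.objEquiv x.2).op ≫ ψ)).app m' ((Y.obj (op ⦋n⦌)).map ψ x.1) =
      (Y.obj m').map ψ ((Y.map ψ).app m ((Y.map (SSet.stdSimplex.objEquiv x.2).op).app m x.1))
    rw [NatTrans.naturality_apply, Y.map_comp]
    rfl

variable {Y}

theorem rowAction_apply {n : ℕ} (y : (Y.obj (op ⦋n⦌)).obj m) (θ : (Δ[n] : SSet.{u}).obj m) :
    (rowAction Y n).app m (y, θ) = (column Y m).map (SSet.stdSimplex.objEquiv θ).op y := rfl

theorem epi_of_notMem_boundary {n : ℕ} {θ : (Δ[n] : SSet.{u}).obj m}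
    (h : θ ∉ (∂Δ[n] : Δ[n].Subcomplex).obj m) : Epi (SSet.stdSimplex.objEquiv θ) := by
  rw [SimplexCategory.epi_iff_surjective]
  exact not_not.1 h

theorem column_map_section {n k : SimplexCategory} (ψ : k ⟶ n) [IsSplitEpi ψ]
    (w : (column Y m).obj (op n)) :
    (column Y m).map (section_ ψ).op ((column Y m).map ψ.op w) = w := by
  rw [← Functor.map_comp_apply, ← op_comp, IsSplitEpi.id]
  simp

theorem rowAction_injective_of_nonDegenerate {n : ℕ} {y y' : (Y.obj (op ⦋n⦌)).obj m}
    {θ θ' : (Δ[n] : SSet.{u}).obj m} (hy : y ∈ (column Y m).nonDegenerate n)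
    (hy' : y' ∈ (column Y m).nonDegenerate n) (hθ : θ ∉ (∂Δ[n] : Δ[n].Subcomplex).obj m)
    (hθ' : θ' ∉ (∂Δ[n] : Δ[n].Subcomplex).obj m)
    (h : (rowAction Y n).app m (y, θ) = (rowAction Y n).app m (y', θ')) : (y, θ) = (y', θ') := by
  have := epi_of_notMem_boundary hθ
  have := epi_of_notMem_boundary hθ'
  have simplex_eq : y = y' :=
    congrArg Subtype.val ((column Y m).unique_nonDegenerate_simplex (n := m.unop.len) _
      (SSet.stdSimplex.objEquiv θ) ⟨y, hy⟩ rfl (SSet.stdSimplex.objEquiv θ') ⟨y', hy'⟩ h)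
  have operator_eq : SSet.stdSimplex.objEquiv θ = SSet.stdSimplex.objEquiv θ' :=
    (column Y m).unique_nonDegenerate_map (n := m.unop.len) _
      (SSet.stdSimplex.objEquiv θ) ⟨y, hy⟩ rfl (SSet.stdSimplex.objEquiv θ') ⟨y', hy'⟩ h
  rw [simplex_eq, SSet.stdSimplex.objEquiv.injective operator_eq]

end Column

namespace Subbisimplicial

variable {Y : SimplicialObject SSet.{u}} (A : Subbisimplicial Y)

/-- The union of a row of `A` with the images of the degeneracies of index less than `k`; for
`k = p` it is the union with the latching object of the row. -/
def latch (k p : ℕ) : (Y.obj (op ⦋p⦌)).Subcomplex :=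
  match p with
  | 0 => A.obj _
  | p + 1 => A.obj _ ⊔ ⨆ i : {i : Fin (p + 1) // i.1 < k}, SSet.Subcomplex.range (Y.σ i.1)

theorem mem_latch_succ {k p : ℕ} {m : SimplexCategoryᵒᵖ} (y : (Y.obj (op ⦋p + 1⦌)).obj m) :
    y ∈ (A.latch k (p + 1)).obj m ↔ y ∈ (A.obj _).obj m ∨
      ∃ i : Fin (p + 1), i.1 < k ∧ ∃ w, (column Y m).σ i w = y := by
  simp only [latch, Subfunctor.max_obj, Subfunctor.iSup_obj, Set.mem_union, Set.mem_iUnion,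
    Subtype.exists, exists_prop]
  rfl

theorem le_latch (k p : ℕ) : A.obj (op ⦋p⦌) ≤ A.latch k p := by
  cases p
  · exact le_rfl
  · exact le_sup_left

theorem latch_mono {k l : ℕ} (h : k ≤ l) (p : ℕ) : A.latch k p ≤ A.latch l p := by
  cases p
  · exact le_rfl
  · intro m y hy
    rw [mem_latch_succ] at hy ⊢
    exact hy.imp_right fun ⟨i, hi, hw⟩ => ⟨i, hi.trans_le h, hw⟩

theorem latch_zero (p : ℕ) : A.latch 0 p = A.obj (op ⦋p⦌) := by
  refine le_antisymm ?_ (A.le_latch 0 p)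
  cases p
  · exact le_rfl
  · intro m y hy
    rw [mem_latch_succ] at hy
    exact hy.resolve_right fun ⟨_, hi, _⟩ => Nat.not_lt_zero _ hi

theorem latch_le_of_le {k p : ℕ} (h : p ≤ k) (l : ℕ) : A.latch l p ≤ A.latch k p := by
  cases p
  · exact le_rfl
  · intro m y hy
    rw [mem_latch_succ] at hy ⊢
    exact hy.imp_right fun ⟨i, _, hw⟩ => ⟨i, i.2.trans_le h, hw⟩

section

variable {k p : ℕ} {m : SimplexCategoryᵒᵖ}

theorem mem_latch_of_σ_mem (hk : k < p + 1) {w : (Y.obj (op ⦋p⦌)).obj m}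
    (h : (column Y m).σ ⟨k, hk⟩ w ∈ (A.latch k (p + 1)).obj m) : w ∈ (A.latch k p).obj m := by
  rw [mem_latch_succ] at h
  rcases h with h | ⟨i, hi, v, hv⟩
  · apply A.le_latch
    rw [← column_δ_castSucc_σ Y ⟨k, hk⟩ w]
    exact A.map _ h
  · obtain _ | p := p
    · omega
    · rw [mem_latch_succ]
      refine Or.inr ⟨⟨i.1, by omega⟩, hi, (column Y m).δ ⟨k, hk⟩ v, ?_⟩
      rw [← column_δ_succ_σ Y ⟨k, hk⟩ w, ← hv]
      exact (ConcreteCategory.congr_hom ((column Y m).δ_comp_σ_of_gt (i := ⟨k, hk⟩)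
        (j := ⟨i.1, by omega⟩) hi) v).symm

theorem σ_mem_latch (hk : k < p + 1) {w : (Y.obj (op ⦋p⦌)).obj m}
    (h : w ∈ (A.latch k p).obj m) :
    (column Y m).σ ⟨k, hk⟩ w ∈ (A.latch k (p + 1)).obj m := by
  rw [mem_latch_succ]
  obtain _ | p := p
  · exact Or.inl (A.map _ h)
  rw [mem_latch_succ] at h
  rcases h with h | ⟨i, hi, v, rfl⟩
  · exact Or.inl (A.map _ h)
  obtain _ | k := k
  · omega
  refine Or.inr ⟨i.castSucc, hi, (column Y m).σ ⟨k, by omega⟩ v, ?_⟩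
  exact ConcreteCategory.congr_hom ((column Y m).σ_comp_σ (i := i) (j := ⟨k, by omega⟩)
    (Nat.lt_succ_iff.1 hi)) v

theorem mem_latch_succ_succ (hk : k < p + 1) (y : (Y.obj (op ⦋p + 1⦌)).obj m) :
    y ∈ (A.latch (k + 1) (p + 1)).obj m ↔
      y ∈ (A.latch k (p + 1)).obj m ∨ ∃ w, (Y.σ ⟨k, hk⟩).app m w = y := by
  constructor
  · rw [mem_latch_succ, mem_latch_succ]
    rintro (h | ⟨i, hi, w, hw⟩)
    · exact Or.inl (Or.inl h)
    · rcases Nat.lt_succ_iff_lt_or_eq.1 hi with hi | hi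
      · exact Or.inl (Or.inr ⟨i, hi, w, hw⟩)
      · obtain rfl : i = ⟨k, hk⟩ := Fin.ext hi
        exact Or.inr ⟨w, hw⟩
  · rintro (h | ⟨w, hw⟩)
    · exact A.latch_mono (Nat.le_succ k) _ _ h
    · exact (A.mem_latch_succ y).2 (Or.inr ⟨⟨k, hk⟩, Nat.lt_succ_self k, w, hw⟩)

theorem mem_latch_of_mem_degenerate {y : (column Y m) _⦋p⦌}
    (hy : y ∈ (column Y m).degenerate p) : y ∈ (A.latch p p).obj m := by
  obtain _ | p := p
  · simp at hy
  · rw [SSet.degenerate_eq_iUnion_range_σ, Set.mem_iUnion] at hy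
    obtain ⟨i, w, hw⟩ := hy
    rw [mem_latch_succ]
    exact Or.inr ⟨i, i.2, w, hw⟩

end

theorem trivialCofibrations_latch_succ {k p : ℕ} (hA : trivialCofibrations (A.latch k p).ι)
    (hk : k < p + 1) :
    trivialCofibrations (SSet.Subcomplex.homOfLE (A.latch_mono (Nat.le_succ k) (p + 1))) :=
  trivialCofibrations_homOfLE_of_attach (Y.σ ⟨k, hk⟩) _
    (fun _ _ => ⟨A.mem_latch_of_σ_mem hk, A.σ_mem_latch hk⟩)
    (fun _ => A.mem_latch_succ_succ hk)
    (fun m x x' _ _ h => by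
      rw [← column_δ_castSucc_σ Y (m := m) ⟨k, hk⟩ x, ← column_δ_castSucc_σ Y (m := m) ⟨k, hk⟩ x']
      exact congrArg _ h)
    hA

theorem trivialCofibrations_latch_ι (hA : ∀ p, trivialCofibrations (A.obj p).ι) (k p : ℕ) :
    trivialCofibrations (A.latch k p).ι := by
  suffices trivialCofibrations (SSet.Subcomplex.homOfLE (A.le_latch k p)) from
    ⟨inferInstanceAs (Mono _), weakEquivalences.of_precomp _ _ this.2 (hA _).2⟩
  induction k generalizing p with
  | zero => exact trivialCofibrations_homOfLE_of_ge _ (A.latch_zero p).le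
  | succ k ih =>
    rw [← SSet.Subcomplex.homOfLE_comp (A.le_latch k p) (A.latch_mono (Nat.le_succ k) p)]
    refine MorphismProperty.comp_mem _ _ _ (ih p) ?_
    rcases le_or_gt p k with hpk | hkp
    · exact trivialCofibrations_homOfLE_of_ge _ (A.latch_le_of_le hpk (k + 1))
    · obtain _ | p := p
      · omega
      · exact A.trivialCofibrations_latch_succ
          ⟨inferInstanceAs (Mono _), weakEquivalences.of_precomp _ _ (ih p).2 (hA _).2⟩ hkp

/-- The subcomplex of the diagonal which consists of the simplices of `A` and those coming from
the rows of index less than `n`. -/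
def stage (n : ℕ) : (diag.obj Y).Subcomplex where
  obj m := {y | y ∈ (A.obj m).obj m ∨ ∃ (k : ℕ) (_ : k < n) (z : (Y.obj (op ⦋k⦌)).obj m)
    (φ : m.unop ⟶ ⦋k⦌), (column Y m).map φ.op z = y}
  map {m m'} ψ := by
    rintro y (hy | ⟨k, hk, z, φ, rfl⟩)
    · exact Or.inl ((A.obj m').map ψ (A.map ψ hy))
    · refine Or.inr ⟨k, hk, (Y.obj _).map ψ z, ψ.unop ≫ φ, ?_⟩
      change (Y.map (φ.op ≫ ψ)).app m' ((Y.obj _).map ψ z) =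
        (Y.obj m').map ψ ((Y.map ψ).app m ((Y.map φ.op).app m z))
      rw [NatTrans.naturality_apply, Y.map_comp]
      rfl

theorem stage_mono : Monotone A.stage := fun _ _ h _ _ hy =>
  hy.imp_right fun ⟨k, hk, hz⟩ => ⟨k, hk.trans_le h, hz⟩

theorem stage_zero_obj (m : SimplexCategoryᵒᵖ) : (A.stage 0).obj m = (A.obj m).obj m :=
  Set.ext fun _ => or_iff_left fun ⟨_, hk, _⟩ => absurd hk (Nat.not_lt_zero _)

theorem iSup_stage : ⨆ n, A.stage n = ⊤ := by
  rw [eq_top_iff]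
  intro m y _
  rw [Subfunctor.iSup_obj, Set.mem_iUnion]
  refine ⟨m.unop.len + 1, Or.inr ⟨m.unop.len, Nat.lt_succ_self _, y, 𝟙 _, ?_⟩⟩
  exact ConcreteCategory.congr_hom ((column Y m).map_id m) y

variable {n : ℕ} {m : SimplexCategoryᵒᵖ}

theorem mem_stage_succ (z : (diag.obj Y).obj m) :
    z ∈ (A.stage (n + 1)).obj m ↔ z ∈ (A.stage n).obj m ∨ ∃ x, (rowAction Y n).app m x = z := by
  constructor
  · rintro (h | ⟨k, hk, z, φ, h⟩)
    · exact Or.inl (Or.inl h)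
    · rcases Nat.lt_succ_iff_lt_or_eq.1 hk with hk | rfl
      · exact Or.inl (Or.inr ⟨k, hk, z, φ, h⟩)
      · exact Or.inr ⟨(z, SSet.stdSimplex.objEquiv.symm φ), by
          rw [rowAction_apply, Equiv.apply_symm_apply]; exact h⟩
  · rintro (h | ⟨⟨y, θ⟩, h⟩)
    · exact A.stage_mono (Nat.le_succ n) _ h
    · exact Or.inr ⟨n, Nat.lt_succ_self n, y, _, h⟩

theorem mem_latch_of_rowAction_mem_stage {y : (Y.obj (op ⦋n⦌)).obj m}
    {θ : (Δ[n] : SSet.{u}).obj m} (hθ : θ ∉ (∂Δ[n] : Δ[n].Subcomplex).obj m)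
    (h : (rowAction Y n).app m (y, θ) ∈ (A.stage n).obj m) : y ∈ (A.latch n n).obj m := by
  have := epi_of_notMem_boundary hθ
  have := isSplitEpi_of_epi (SSet.stdSimplex.objEquiv θ)
  rcases h with h | ⟨k, hk, z, φ, h⟩
  · apply A.le_latch
    rw [← column_map_section (SSet.stdSimplex.objEquiv θ) y]
    exact A.map _ h
  · apply A.mem_latch_of_mem_degenerate
    refine ⟨k, hk, section_ (SSet.stdSimplex.objEquiv θ) ≫ φ, z, ?_⟩
    rw [op_comp, Functor.map_comp_apply, h]
    exact column_map_section _ _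

theorem rowAction_mem_stage_of_mem_boundary (y : (Y.obj (op ⦋n⦌)).obj m)
    {θ : (Δ[n] : SSet.{u}).obj m} (hθ : θ ∈ (∂Δ[n] : Δ[n].Subcomplex).obj m) :
    (rowAction Y n).app m (y, θ) ∈ (A.stage n).obj m := by
  obtain _ | n := n
  · exact absurd hθ (by simp)
  obtain ⟨i, θ', hθ'⟩ := SimplexCategory.eq_comp_δ_of_not_surjective (SSet.stdSimplex.objEquiv θ) hθ
  refine Or.inr ⟨n, Nat.lt_succ_self n, (column Y m).δ i y, θ', ?_⟩
  rw [rowAction_apply, hθ', op_comp, Functor.map_comp_apply]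
  rfl

theorem rowAction_mem_stage_of_mem_latch {y : (Y.obj (op ⦋n⦌)).obj m}
    (θ : (Δ[n] : SSet.{u}).obj m) (hy : y ∈ (A.latch n n).obj m) :
    (rowAction Y n).app m (y, θ) ∈ (A.stage n).obj m := by
  obtain _ | n := n
  · exact Or.inl (A.map _ hy)
  rw [mem_latch_succ] at hy
  rcases hy with hy | ⟨i, -, w, rfl⟩
  · exact Or.inl (A.map _ hy)
  · refine Or.inr ⟨n, Nat.lt_succ_self n, w, SSet.stdSimplex.objEquiv θ ≫ SimplexCategory.σ i, ?_⟩
    rw [op_comp, Functor.map_comp_apply]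
    rfl

theorem rowAction_mem_stage_iff (x : (Y.obj (op ⦋n⦌) ⊗ Δ[n]).obj m) :
    (rowAction Y n).app m x ∈ (A.stage n).obj m ↔
      x ∈ ((A.latch n n).unionProd (∂Δ[n] : Δ[n].Subcomplex)).obj m := by
  obtain ⟨y, θ⟩ := x
  refine Iff.trans ?_ (SSet.Subcomplex.mem_unionProd_iff (A.latch n n) ∂Δ[n] (y, θ)).symm
  exact ⟨fun h => or_iff_not_imp_left.2 fun hθ => A.mem_latch_of_rowAction_mem_stage hθ h,
    fun h => h.elim (A.rowAction_mem_stage_of_mem_boundary y)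
      (A.rowAction_mem_stage_of_mem_latch θ)⟩

theorem rowAction_injective_of_notMem (x x' : (Y.obj (op ⦋n⦌) ⊗ Δ[n]).obj m)
    (hx : x ∉ ((A.latch n n).unionProd (∂Δ[n] : Δ[n].Subcomplex)).obj m)
    (hx' : x' ∉ ((A.latch n n).unionProd (∂Δ[n] : Δ[n].Subcomplex)).obj m)
    (h : (rowAction Y n).app m x = (rowAction Y n).app m x') : x = x' := by
  obtain ⟨hθ, hy⟩ := not_or.1 (mt (SSet.Subcomplex.mem_unionProd_iff _ _ x).2 hx)
  obtain ⟨hθ', hy'⟩ := not_or.1 (mt (SSet.Subcomplex.mem_unionProd_iff _ _ x').2 hx')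
  exact rowAction_injective_of_nonDegenerate (mt A.mem_latch_of_mem_degenerate hy)
    (mt A.mem_latch_of_mem_degenerate hy') hθ hθ' h

theorem trivialCofibrations_stage_zero_ι (hA : ∀ p, trivialCofibrations (A.obj p).ι) :
    trivialCofibrations (A.stage 0).ι :=
  trivialCofibrations_ι_of_chain A.stage A.stage_mono
    (fun n => trivialCofibrations_homOfLE_of_attach (rowAction Y n) _
      (fun _ => A.rowAction_mem_stage_iff) (fun _ => A.mem_stage_succ)
      (fun _ => A.rowAction_injective_of_notMem)
      (trivialCofibrations_unionProd_boundary (A.trivialCofibrations_latch_ι hA n n) n))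
    A.iSup_stage

end Subbisimplicial

section RealizationLemma

theorem weakEquivalences_diag_of_mono {X Y : SimplicialObject SSet.{u}} (f : X ⟶ Y)
    [∀ p, Mono (f.app p)] (hf : ∀ p, weakEquivalences (f.app p)) :
    weakEquivalences (diag.map f) := by
  let A : Subbisimplicial Y :=
    { obj := fun p => SSet.Subcomplex.range (f.app p)
      map := by
        rintro p q φ m _ ⟨x, rfl⟩
        exact ⟨(X.map φ).app m x, congrArg (fun k => k.app m x) (f.naturality φ)⟩ }
  have stage_zero : A.stage 0 = SSet.Subcomplex.range (diag.map f) :=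
    Subfunctor.ext (funext A.stage_zero_obj)
  have : Mono (diag.map f) :=
    (NatTrans.mono_iff_mono_app _).2 fun m =>
      (NatTrans.mono_iff_mono_app (f.app m)).1 inferInstance m
  apply weakEquivalences_of_range_ι
  rw [← stage_zero]
  exact (A.trivialCofibrations_stage_zero_ι fun p => trivialCofibrations_range_ι (hf p)).2

/-- A functorial contractible simplicial set containing a given one: its `q`-simplices are the
tuples of `q + 1` elements of the pointed set obtained from the set of `q`-simplices by adding a
base point. -/
def hull : SSet.{u} ⥤ SSet.{u} where
  obj K :=
    { obj := fun m => Fin (m.unop.len + 1) → Option (K.obj m)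
      map := fun ψ => ↾fun g j => (g (ψ.unop.toOrderHom j)).map (K.map ψ)
      map_id := fun m => ConcreteCategory.hom_ext _ _ fun g => funext fun j => by
        change (g j).map (K.map (𝟙 m)) = g j
        cases h : g j <;> simp
      map_comp := fun φ ψ => ConcreteCategory.hom_ext _ _ fun g => funext fun j => by
        change (g _).map (K.map (φ ≫ ψ)) = ((g _).map (K.map φ)).map (K.map ψ)
        rw [Option.map_map, K.map_comp]
        rfl }
  map f :=
    { app := fun m => ↾fun g j => (g j).map (f.app m)
      naturality := fun m m' ψ => ConcreteCategory.hom_ext _ _ fun g => funext fun j => by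
        change ((g _).map _).map (f.app m') = ((g _).map (f.app m)).map _
        rw [Option.map_map, Option.map_map]
        congr 1
        funext x
        exact NatTrans.naturality_apply f ψ x }
  map_id K := NatTrans.ext (funext fun m => ConcreteCategory.hom_ext _ _ fun g =>
    funext fun j => congrFun Option.map_id (g j))
  map_comp f f' := NatTrans.ext (funext fun m => ConcreteCategory.hom_ext _ _ fun g =>
    funext fun j => (Option.map_map (f'.app m) (f.app m) (g j)).symm)

/-- The inclusion of a simplicial set in its hull, as constant tuples. -/
def toHull : 𝟭 SSet.{u} ⟶ hull where
  app K :=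
    { app := fun _ => ↾fun x _ => some x }

instance mono_toHull_app (K : SSet.{u}) : Mono (toHull.app K) := by
  rw [NatTrans.mono_iff_mono_app]
  intro m
  rw [mono_iff_injective]
  exact fun x y h => Option.some_injective _ (congrFun h 0)

instance mono_lift_toHull_app {X Y : SSet.{u}} (f : X ⟶ Y) : Mono (lift f (toHull.app X)) :=
  mono_of_mono_fac (lift_snd f (toHull.app X))

/-- The contraction of the hull to its base point. -/
noncomputable def hullContraction (K : SSet.{u}) : hull.obj K ⊗ Δ[1] ⟶ hull.obj K where
  app m := ↾fun x j => if SSet.stdSimplex.asOrderHom x.2 j = 0 then x.1 j else none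
  naturality m m' ψ := ConcreteCategory.hom_ext _ _ fun x => funext fun j => by
    change (if SSet.stdSimplex.asOrderHom x.2 (ψ.unop.toOrderHom j) = 0 then
      (x.1 (ψ.unop.toOrderHom j)).map (K.map ψ) else none) =
      (if SSet.stdSimplex.asOrderHom x.2 (ψ.unop.toOrderHom j) = 0 then
      x.1 (ψ.unop.toOrderHom j) else none).map (K.map ψ)
    split_ifs <;> rfl

theorem weakEquivalences_fst_hull (X K : SSet.{u}) : weakEquivalences (fst X (hull.obj K)) :=
  weakEquivalences_fst_of_contraction (fun _ => none) (hullContraction K) rfl rfl X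

theorem weakEquivalences_lift_toHull_app {X Y : SSet.{u}} {f : X ⟶ Y} (hf : weakEquivalences f) :
    weakEquivalences (lift f (toHull.app X)) :=
  weakEquivalences.of_postcomp _ _ (weakEquivalences_fst_hull Y X)
    (by rwa [lift_fst f (toHull.app X)])

/-- The levelwise product of `Y` with the hull of `X`. -/
def cylinder (X Y : SimplicialObject SSet.{u}) : SimplicialObject SSet.{u} where
  obj p := Y.obj p ⊗ hull.obj (X.obj p)
  map φ := Y.map φ ⊗ₘ hull.map (X.map φ)

/-- The inclusion of `X` in the levelwise product of `Y` with the hull of `X`. -/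
def toCylinder {X Y : SimplicialObject SSet.{u}} (f : X ⟶ Y) : X ⟶ cylinder X Y where
  app p := lift (f.app p) (toHull.app (X.obj p))
  naturality p q φ := by
    refine CartesianMonoidalCategory.hom_ext _ _ ?_ ?_
    · simp [cylinder]
    · simpa [cylinder] using toHull.naturality (X.map φ)

/-- The projection of the levelwise product of `Y` with the hull of `X`. -/
def cylinderFst (X Y : SimplicialObject SSet.{u}) : cylinder X Y ⟶ Y where
  app p := fst _ _
  naturality p q φ := by simp [cylinder]

theorem toCylinder_fst {X Y : SimplicialObject SSet.{u}} (f : X ⟶ Y) :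
    toCylinder f ≫ cylinderFst X Y = f := by
  ext p : 2
  exact lift_fst _ _

/-- The diagonal commutes with the formation of the cylinder. -/
def diagCylinderIso (X Y : SimplicialObject SSet.{u}) :
    diag.obj (cylinder X Y) ≅ diag.obj Y ⊗ hull.obj (diag.obj X) :=
  NatIso.ofComponents (fun m => Iso.refl ((Y.obj m).obj m × (hull.obj (X.obj m)).obj m))
    (fun {m m'} φ => by
      refine ConcreteCategory.hom_ext _ _ ?_
      rintro ⟨y, g⟩
      exact Prod.ext rfl (funext fun j =>
        Option.map_map ((X.obj m').map φ) ((X.map φ).app m) (g (φ.unop.toOrderHom j))))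

theorem diag_map_cylinderFst (X Y : SimplicialObject SSet.{u}) :
    diag.map (cylinderFst X Y) =
      (diagCylinderIso X Y).hom ≫ fst (diag.obj Y) (hull.obj (diag.obj X)) := rfl

/-- The realization lemma. A map factors as a levelwise monomorphism to its cylinder followed by a
projection, whose diagonal is again a projection with contractible fibre. -/
theorem weakEquivalences_diag {X Y : SimplicialObject SSet.{u}} (f : X ⟶ Y)
    (hf : ∀ p, weakEquivalences (f.app p)) : weakEquivalences (diag.map f) := by
  have (p : SimplexCategoryᵒᵖ) : Mono ((toCylinder f).app p) := mono_lift_toHull_app (f.app p)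
  rw [← toCylinder_fst f, Functor.map_comp, diag_map_cylinderFst]
  exact weakEquivalences.comp_mem _ _
    (weakEquivalences_diag_of_mono _ fun p => weakEquivalences_lift_toHull_app (hf p))
    (weakEquivalences.comp_mem _ _ (MorphismProperty.of_isIso weakEquivalences _)
      (weakEquivalences_fst_hull _ _))

theorem weakEquivalences_whiskerRight_fst_hull (X Y Z : SSet.{u}) :
    weakEquivalences (fst Y (hull.obj X) ▷ Z) := by
  have braided : (β_ _ _).hom ≫ fst Y (hull.obj X) ▷ Z ≫ (β_ _ _).hom =
    (α_ Z Y (hull.obj X)).inv ≫ fst (Z ⊗ Y) (hull.obj X) := rfl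
  have h := weakEquivalences.comp_mem _ _
    (MorphismProperty.of_isIso weakEquivalences (α_ Z Y (hull.obj X)).inv)
    (weakEquivalences_fst_hull (Z ⊗ Y) X)
  rw [← braided] at h
  exact (weakEquivalences.cancel_right_of_respectsIso _ _).1
    ((weakEquivalences.cancel_left_of_respectsIso _ _).1 h)

theorem weakEquivalences_whiskerRight {X Y : SSet.{u}} {f : X ⟶ Y} (hf : weakEquivalences f)
    (K : SSet.{u}) : weakEquivalences (f ▷ K) := by
  rw [← lift_fst f (toHull.app X), MonoidalCategory.comp_whiskerRight]
  exact weakEquivalences.comp_mem _ _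
    (weakEquivalences_whiskerRight_of_mono (weakEquivalences_lift_toHull_app hf) K)
    (weakEquivalences_whiskerRight_fst_hull X Y K)

end RealizationLemma

end RealizationEquivalence

/-! ### Nerves of products and coproducts of 2-categories -/

namespace TwoCategory

open MonoidalCategory CartesianMonoidalCategory Limits RealizationEquivalence

section Chains

variable {ι : Type} [Preorder ι] {B : Type u₁} [Bicategory.{w₁, v₁} B] {L : Type u₂}
  [Bicategory.{w₂, v₂} L]

theorem chainHom_heq {c : ι → B} {f g f' g' : Chain c} {α : f ⟶ g} {β : f' ⟶ g'} (hf : f = f')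
    (hg : g = g') (h : ∀ {i j : ι} (h : i ≤ j), ChainHom.cell α h ≍ ChainHom.cell β h) :
    α ≍ β := by
  subst hf hg
  exact heq_of_eq (ChainHom.ext (by funext i j k; exact eq_of_heq (h k)))

/-- A pair of chains, viewed as a chain in the product. -/
def chainPair {b : ι → B} {l : ι → L} (f : Chain b) (g : Chain l) :
    Chain (B := B × L) (fun i => (b i, l i)) where
  hom h := (f.hom h, g.hom h)
  hom_refl i := Prod.ext (f.hom_refl i) (g.hom_refl i)
  hom_trans h h₂ := Prod.ext (f.hom_trans h h₂) (g.hom_trans h h₂)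

/-- A pair of morphisms of chains, viewed as a morphism of chains in the product. -/
def chainHomPair {b : ι → B} {l : ι → L} {f f' : Chain b} {g g' : Chain l} (α : f ⟶ f')
    (β : g ⟶ g') : chainPair f g ⟶ chainPair f' g' :=
  show ChainHom _ _ from
  { cell h := (ChainHom.cell α h, ChainHom.cell β h)
    cell_refl i := prod_cell_heq (A := B) (L := L) (X := (b i, l i)) (Y := (b i, l i))
      (f := (f.hom le_rfl, g.hom le_rfl)) (g := (f'.hom le_rfl, g'.hom le_rfl))
      (f' := (𝟙 _, 𝟙 _)) (g' := (𝟙 _, 𝟙 _)) _ (𝟙 _, 𝟙 _)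
      (Prod.ext (f.hom_refl i) (g.hom_refl i)) (Prod.ext (f'.hom_refl i) (g'.hom_refl i))
      (ChainHom.cell_refl α i) (ChainHom.cell_refl β i)
    cell_trans {i _ k} h h₂ := prod_cell_heq (A := B) (L := L) (X := (b i, l i)) (Y := (b k, l k))
      (f := (f.hom (h.trans h₂), g.hom (h.trans h₂)))
      (g := (f'.hom (h.trans h₂), g'.hom (h.trans h₂)))
      (f' := (f.hom h ≫ f.hom h₂, g.hom h ≫ g.hom h₂))
      (g' := (f'.hom h ≫ f'.hom h₂, g'.hom h ≫ g'.hom h₂))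
      _ (hcomp _ _, hcomp _ _)
      (Prod.ext (f.hom_trans h h₂) (g.hom_trans h h₂))
      (Prod.ext (f'.hom_trans h h₂) (g'.hom_trans h h₂))
      (ChainHom.cell_trans α h h₂) (ChainHom.cell_trans β h h₂) }

/-- The action of `chainProd` on morphisms. -/
def chainProdMap : ∀ {X Y : Σ b : ι → B, Chain b} {X' Y' : Σ l : ι → L, Chain l} (_ : X ⟶ Y)
    (_ : X' ⟶ Y'), ((⟨fun i => (X.1 i, X'.1 i), chainPair X.2 X'.2⟩ : Σ c : ι → B × L, Chain c) ⟶
      ⟨fun i => (Y.1 i, Y'.1 i), chainPair Y.2 Y'.2⟩)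
  | _, _, _, _, Sigma.SigmaHom.mk α, Sigma.SigmaHom.mk β => Sigma.SigmaHom.mk (chainHomPair α β)

/-- The pairing of chains as a functor; it is inverse to the pair of projections. -/
def chainProd : ((Σ b : ι → B, Chain b) × (Σ l : ι → L, Chain l)) ⥤
    (Σ c : ι → B × L, Chain c) where
  obj X := ⟨fun i => (X.1.1 i, X.2.1 i), chainPair X.1.2 X.2.2⟩
  map f := chainProdMap f.1 f.2
  map_id _ := rfl
  map_comp := by
    rintro ⟨_, _⟩ ⟨_, _⟩ ⟨_, _⟩ ⟨⟨α⟩, ⟨β⟩⟩ ⟨⟨α'⟩, ⟨β'⟩⟩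
    rfl

end Chains

section Products

variable {A A' : TwoCat.{u}} (K : Type u) [Category.{u} K]

/-- The projection `A × K → A`. -/
def prodFst (A : TwoCat.{u}) : prodCat A K ⟶ A :=
  Bicategory.Prod.fst A (LocallyDiscrete K)

/-- The projection `A × K → K`. -/
def prodSnd (A : TwoCat.{u}) : prodCat A K ⟶ TwoCat.mk (LocallyDiscrete K) :=
  Bicategory.Prod.snd A (LocallyDiscrete K)

/-- The comparison of the double nerve of a product with the product of the double nerves. -/
def nerveProd (A : TwoCat.{u}) : diagDoubleNerve.obj (prodCat A K) ⟶
    diagDoubleNerve.obj A ⊗ diagDoubleNerve.obj (TwoCat.mk (LocallyDiscrete K)) :=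
  lift (diagDoubleNerve.map (prodFst K A)) (diagDoubleNerve.map (prodSnd K A))

theorem nerveProd_app_bijective (A : TwoCat.{u}) (m : SimplexCategoryᵒᵖ) :
    Function.Bijective ((nerveProd K A).app m) := by
  let pr₁ := ((nerFunctor.map (prodFst K A)).app m).toFunctor
  let pr₂ := ((nerFunctor.map (prodSnd K A)).app m).toFunctor
  let pair : _ ⥤ ((nerFunctor.obj (prodCat A K)).obj m) :=
    chainProd (ι := Fin (m.unop.len + 1)) (B := A) (L := LocallyDiscrete K)
  have prod'_pair : Functor.prod' pr₁ pr₂ ⋙ pair = 𝟭 _ := sigma_functor_ext fun _ => rfl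
  have pair_pr₁ : pair ⋙ pr₁ = CategoryTheory.Prod.fst _ _ := by
    refine Functor.hext (fun _ => rfl) ?_
    rintro ⟨_, _⟩ ⟨_, _⟩ ⟨⟨α⟩, ⟨β⟩⟩
    rfl
  have pair_pr₂ : pair ⋙ pr₂ = CategoryTheory.Prod.snd _ _ := by
    refine Functor.hext (fun _ => rfl) ?_
    rintro ⟨_, _⟩ ⟨_, _⟩ ⟨⟨α⟩, ⟨β⟩⟩
    rfl
  refine Function.bijective_iff_has_inverse.2
    ⟨fun x => Functor.prod' (show Fin (m.unop.len + 1) ⥤ _ from x.1) x.2 ⋙ pair, fun x => ?_,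
      fun x => Prod.ext ?_ ?_⟩
  · exact congrArg (fun k => (show Fin (m.unop.len + 1) ⥤ _ from x) ⋙ k) prod'_pair
  · exact congrArg (fun k => Functor.prod' (show Fin (m.unop.len + 1) ⥤ _ from x.1) x.2 ⋙ k)
      pair_pr₁
  · exact congrArg (fun k => Functor.prod' (show Fin (m.unop.len + 1) ⥤ _ from x.1) x.2 ⋙ k)
      pair_pr₂

instance (A : TwoCat.{u}) : IsIso (nerveProd K A) :=
  (NatTrans.isIso_iff_isIso_app _).2 fun m =>
    (isIso_iff_bijective _).2 (nerveProd_app_bijective K A m)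

theorem diagDoubleNerve_map_prodMap_comp_nerveProd (F : A ⟶ A') :
    diagDoubleNerve.map (show prodCat A K ⟶ prodCat A' K from prodMap (TwoCat.fn F) K) ≫
      nerveProd K A' = nerveProd K A ≫ diagDoubleNerve.map F ▷ _ := by
  refine CartesianMonoidalCategory.hom_ext _ _ ?_ ?_
  · simp only [nerveProd, Category.assoc, lift_fst, whiskerRight_fst, lift_fst_assoc]
    rw [← Functor.map_comp, ← Functor.map_comp]
    rfl
  · simp only [nerveProd, Category.assoc, lift_snd, whiskerRight_snd]
    rw [← Functor.map_comp]
    rfl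

theorem weakEquivalences_diagDoubleNerve_map_prodMap (F : A ⟶ A')
    (hF : weakEquivalences (diagDoubleNerve.map F)) :
    weakEquivalences (diagDoubleNerve.map
      (show prodCat A K ⟶ prodCat A' K from prodMap (TwoCat.fn F) K)) := by
  rw [← weakEquivalences.cancel_right_of_respectsIso _ (nerveProd K A'),
    diagDoubleNerve_map_prodMap_comp_nerveProd, weakEquivalences.cancel_left_of_respectsIso]
  exact weakEquivalences_whiskerRight hF _

end Products

section FunctorsIntoCoproducts

variable {J : Type v₁} [Category.{w₁} J] {X : Type v₂} [Category.{w₂} X] {Y : Type v₃}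
  [Category.{w₃} Y]

theorem exists_comp_eq_of_full_of_faithful (Φ : X ⥤ Y) [Φ.Full] [Φ.Faithful] (F : J ⥤ Y)
    (h : ∀ j, ∃ x, Φ.obj x = F.obj j) : ∃ G : J ⥤ X, G ⋙ Φ = F := by
  choose x hx using h
  refine ⟨{ obj := x
            map := fun {i j} f => Φ.preimage (eqToHom (hx i) ≫ F.map f ≫ eqToHom (hx j).symm)
            map_id := fun j => Φ.map_injective (by simp)
            map_comp := fun f g => Φ.map_injective (by simp) }, ?_⟩
  exact CategoryTheory.Functor.ext hx fun i j f => Φ.map_preimage _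

theorem comp_injective_of_faithful (Φ : X ⥤ Y) [Φ.Faithful] (hΦ : Function.Injective Φ.obj) :
    Function.Injective fun G : J ⥤ X => G ⋙ Φ := by
  intro G G' h
  refine CategoryTheory.Functor.ext (fun j => hΦ (Functor.congr_obj h j)) fun i j f =>
    Φ.map_injective ?_
  simp only [Functor.map_comp, eqToHom_map]
  exact Functor.congr_hom h f

theorem exists_comp_sigma_incl_eq {P : Type w₁} [Preorder P] [OrderBot P] {Q : Type u₁}
    {B : Q → Type u₂} [∀ i, Category.{v₂} (B i)] (F : P ⥤ Σ i, B i) :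
    ∃ (i : Q) (G : P ⥤ B i), G ⋙ Sigma.incl i = F := by
  have exists_incl_obj_eq : ∀ {X Y : Σ i, B i} (_ : X ⟶ Y),
      ∃ x : B X.1, (Sigma.incl X.1).obj x = Y := by
    rintro _ _ ⟨f⟩
    exact ⟨_, rfl⟩
  exact ⟨(F.obj ⊥).1, exists_comp_eq_of_full_of_faithful _ F fun j =>
    exists_incl_obj_eq (F.map (homOfLE bot_le))⟩

theorem sigma_incl_obj_injective {Q : Type u₁} {B : Q → Type u₂} [∀ i, Category.{v₂} (B i)]
    (i : Q) : Function.Injective (Sigma.incl i : B i ⥤ Σ j, B j).obj :=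
  sigma_mk_injective

end FunctorsIntoCoproducts

namespace Coprod

variable {Q : Type u} {A : Q → TwoCat.{u}}

/-- The inclusion of a summand into a disjoint union. -/
def inclFunctor (A : Q → TwoCat.{u}) (i : Q) : StrictPseudofunctor (A i) (Coprod A) :=
  StrictPseudofunctor.mk''
    { obj x := ⟨i, x⟩
      map f := Hom.mk f
      map₂ η := Hom₂.mk η
      map₂_id _ := rfl
      map₂_comp _ _ := rfl
      map_id _ := rfl
      map_comp _ _ := rfl
      map₂_whisker_left f _ _ η :=
        have h_mk : Hom₂.mk (f ◁ η) = whiskerL (Hom.mk f) (Hom₂.mk η) := rfl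
        eq_conj_of_heq (A := (⟨i, _⟩ : Coprod A) ⟶ ⟨i, _⟩) rfl rfl (heq_of_eq h_mk)
      map₂_whisker_right η h :=
        have h_mk : Hom₂.mk (η ▷ h) = whiskerR (Hom₂.mk η) (Hom.mk h) := rfl
        eq_conj_of_heq (A := (⟨i, _⟩ : Coprod A) ⟶ ⟨i, _⟩) rfl rfl (heq_of_eq h_mk) }

/-- The inclusion of a summand into a disjoint union, as a 1-cell of the 2-category of
2-categories. -/
def incl (A : Q → TwoCat.{u}) (i : Q) : A i ⟶ TwoCat.mk (Coprod A) :=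
  inclFunctor A i

theorem incl_comp_map {A' : Q → TwoCat.{u}} (F : ∀ i, A i ⟶ A' i) (i : Q) :
    incl A i ≫ (show TwoCat.mk (Coprod A) ⟶ TwoCat.mk (Coprod A') from
      map (fun i => i) (fun i => TwoCat.fn (F i))) = F i ≫ incl A' i :=
  twoFunctor_ext (fun _ => rfl) (fun _ => HEq.rfl) (fun _ => HEq.rfl)

theorem mk_injective (i : Q) : Function.Injective (fun x : A i => (⟨i, x⟩ : Coprod A)) := by
  rintro x _ ⟨⟩
  rfl

/-- The inverse of `inclHom`: the 1-cells and 2-cells of a summand underlying those of the disjoint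
union. -/
def underlying {i : Q} (x y : A i) : ((⟨i, x⟩ : Coprod A) ⟶ ⟨i, y⟩) ⥤ (x ⟶ y) where
  obj | Hom.mk f => f
  map | Hom₂.mk η => η
  map_id := by rintro ⟨f⟩; rfl
  map_comp := by rintro _ _ _ ⟨η⟩ ⟨θ⟩; rfl

theorem underlying_comp_inclHom {i : Q} (x y : A i) : underlying x y ⋙ inclHom x y = 𝟭 _ := by
  refine Functor.hext ?_ ?_
  · rintro ⟨f⟩
    rfl
  · rintro _ _ ⟨η⟩
    rfl

theorem underlying_obj_comp {i : Q} {x y z : A i} (f : (⟨i, x⟩ : Coprod A) ⟶ ⟨i, y⟩)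
    (g : (⟨i, y⟩ : Coprod A) ⟶ ⟨i, z⟩) :
    (underlying x z).obj (f ≫ g) = (underlying x y).obj f ≫ (underlying y z).obj g := by
  obtain ⟨f⟩ := f
  obtain ⟨g⟩ := g
  rfl

theorem underlying_map_heq {i : Q} {x y : A i} {f g f' g' : (⟨i, x⟩ : Coprod A) ⟶ ⟨i, y⟩}
    {η : f ⟶ g} {η' : f' ⟶ g'} (hf : f = f') (hg : g = g') (h : η ≍ η') :
    (underlying x y).map η ≍ (underlying x y).map η' := by
  subst hf hg h
  rfl

theorem underlying_map_hcomp_heq {i : Q} {x y z : A i} {f f' : (⟨i, x⟩ : Coprod A) ⟶ ⟨i, y⟩}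
    {g g' : (⟨i, y⟩ : Coprod A) ⟶ ⟨i, z⟩} (η : f ⟶ f') (θ : g ⟶ g') :
    (underlying x z).map (hcomp η θ) ≍
      hcomp ((underlying x y).map η) ((underlying y z).map θ) := by
  obtain ⟨η⟩ := η
  obtain ⟨θ⟩ := θ
  rfl

section Chains

variable {ι : Type} [Preorder ι]

/-- Chains in a disjoint union through objects of a summand, viewed as chains in the summand. -/
def chainPreimage {i : Q} (a : ι → A i) : Chain (fun j => (⟨i, a j⟩ : Coprod A)) ⥤ Chain a where
  obj f :=
    { hom h := (underlying _ _).obj (f.hom h)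
      hom_refl j := congrArg (underlying _ _).obj (f.hom_refl j)
      hom_trans h h' :=
        (congrArg (underlying _ _).obj (f.hom_trans h h')).trans (underlying_obj_comp _ _) }
  map {f g} α := show ChainHom _ _ from
    { cell h := (underlying _ _).map (ChainHom.cell α h)
      cell_refl j := underlying_map_heq (f.hom_refl j) (g.hom_refl j) (ChainHom.cell_refl α j)
      cell_trans h h' := (underlying_map_heq (f.hom_trans h h') (g.hom_trans h h')
        (ChainHom.cell_trans α h h')).trans (underlying_map_hcomp_heq _ _) }
  map_id f := ChainHom.ext (by funext i j h; exact (underlying _ _).map_id _)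
  map_comp α β := ChainHom.ext (by funext i j h; exact (underlying _ _).map_comp _ _)

theorem chainPreimage_comp_image {i : Q} (a : ι → A i) :
    chainPreimage a ⋙ Chain.image (inclFunctor A i) a = 𝟭 (Chain fun j => (⟨i, a j⟩ : Coprod A)) :=
  have obj_eq (f : Chain (fun j => (⟨i, a j⟩ : Coprod A))) :
      (chainPreimage a ⋙ Chain.image (inclFunctor A i) a).obj f = f :=
    Chain.ext (by funext j k h; exact Functor.congr_obj (underlying_comp_inclHom _ _) _)
  Functor.hext obj_eq fun f g _ => chainHom_heq (obj_eq f) (obj_eq g) fun _ =>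
    Functor.hcongr_hom (underlying_comp_inclHom _ _) _

theorem exists_eq_mk_of_chain [OrderBot ι] {c : ι → Coprod A} (f : Chain c) :
    ∃ (i : Q) (a : ι → A i), c = fun j => ⟨i, a j⟩ := by
  have exists_eq_mk : ∀ {X Y : Coprod A} (_ : X ⟶ Y), ∃ x : A X.idx, Y = ⟨X.idx, x⟩ := by
    rintro _ _ ⟨f⟩
    exact ⟨_, rfl⟩
  choose a ha using fun j => exists_eq_mk (f.hom (bot_le (a := j)))
  exact ⟨(c ⊥).idx, a, funext ha⟩

variable (ι) in
/-- The inclusion of a summand on chains. -/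
def inclChain (A : Q → TwoCat.{u}) (i : Q) : (Σ a : ι → A i, Chain a) ⥤
    (Σ c : ι → Coprod A, Chain c) :=
  sigmaFunctor.{u} (A' := fun c : ι → Coprod A => Chain c)
    (fun (a : ι → A i) j => (⟨i, a j⟩ : Coprod A))
    (fun a => Chain.image (inclFunctor A i) a)

variable {P : Type} [Preorder P] [OrderBot P] [OrderBot ι]

theorem exists_comp_inclChain_eq (F : P ⥤ Σ c : ι → Coprod A, Chain c) :
    ∃ (i : Q) (G : P ⥤ Σ a : ι → A i, Chain a), G ⋙ inclChain ι A i = F := by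
  obtain ⟨c, G, rfl⟩ := exists_comp_sigma_incl_eq F
  obtain ⟨i, a, rfl⟩ := exists_eq_mk_of_chain (G.obj ⊥)
  refine ⟨i, G ⋙ chainPreimage a ⋙ Sigma.incl a, ?_⟩
  exact congrArg (fun k => G ⋙ k ⋙ Sigma.incl (C := fun c : ι → Coprod A => Chain c) _)
    (chainPreimage_comp_image a)

theorem eq_and_heq_of_comp_inclChain_eq {i i' : Q} (H : P ⥤ Σ a : ι → A i, Chain a)
    (H' : P ⥤ Σ a : ι → A i', Chain a) (h : H ⋙ inclChain ι A i = H' ⋙ inclChain ι A i') :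
    i = i' ∧ H ≍ H' := by
  obtain ⟨a, G, rfl⟩ := exists_comp_sigma_incl_eq H
  obtain ⟨a', G', rfl⟩ := exists_comp_sigma_incl_eq H'
  have objects_eq := congrArg Sigma.fst (Functor.congr_obj h ⊥)
  obtain rfl : i = i' := congrArg (fun c : ι → Coprod A => (c ⊥).idx) objects_eq
  obtain rfl : a = a' := funext fun j => mk_injective i (congrFun objects_eq j)
  have image_eq : G ⋙ Chain.image (inclFunctor A i) a = G' ⋙ Chain.image (inclFunctor A i) a :=
    comp_injective_of_faithful (Sigma.incl (C := fun c : ι → Coprod A => Chain c)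
      (fun j => ⟨i, a j⟩)) (sigma_incl_obj_injective _) h
  have preimage_eq : G = G' := congrArg (fun k => k ⋙ chainPreimage a) image_eq
  exact ⟨rfl, heq_of_eq (congrArg (fun k => k ⋙ Sigma.incl a) preimage_eq)⟩

end Chains

/-- The double nerve preserves coproducts. -/
noncomputable def isColimitDiagDoubleNerve (A : Q → TwoCat.{u}) :
    IsColimit (Cofan.mk (diagDoubleNerve.obj (TwoCat.mk (Coprod A)))
      fun i => diagDoubleNerve.map (incl A i)) := by
  refine evaluationJointlyReflectsColimits _ fun m => ?_
  refine (isColimitMapCoconeCofanMkEquiv ((evaluation _ _).obj m) _ _).2 ?_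
  refine Classical.choice ((Cofan.nonempty_isColimit_iff_bijective_fromSigma _).2 ⟨?_, ?_⟩)
  · rintro ⟨i, H⟩ ⟨i', H'⟩ h
    obtain ⟨rfl, h'⟩ := eq_and_heq_of_comp_inclChain_eq (P := Fin (m.unop.len + 1))
      (ι := Fin (m.unop.len + 1)) H H' h
    cases h'
    rfl
  · intro F
    obtain ⟨i, G, h⟩ := exists_comp_inclChain_eq (P := Fin (m.unop.len + 1))
      (ι := Fin (m.unop.len + 1)) F
    exact ⟨⟨i, G⟩, h⟩

theorem weakEquivalences_diagDoubleNerve_map {A' : Q → TwoCat.{u}} (F : ∀ i, A i ⟶ A' i)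
    (hF : ∀ i, weakEquivalences (diagDoubleNerve.map (F i))) :
    weakEquivalences (diagDoubleNerve.map
      (show TwoCat.mk (Coprod A) ⟶ TwoCat.mk (Coprod A') from
        map (fun i => i) (fun i => TwoCat.fn (F i)))) :=
  weakEquivalences_of_cofan (isColimitDiagDoubleNerve A) (isColimitDiagDoubleNerve A') _
    (fun i => diagDoubleNerve.map (F i))
    (fun i => by rw [← Functor.map_comp, incl_comp_map, Functor.map_comp]) hF

theorem weakEquivalences_diagDoubleNerve_map_prodMap {A' : Q → TwoCat.{u}} (F : ∀ i, A i ⟶ A' i)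
    (hF : ∀ i, IsWeakEquivalence (F i)) (K : Q → Type u) [∀ i, Category.{u} (K i)] :
    weakEquivalences (diagDoubleNerve.map
      (show TwoCat.mk (Coprod fun i => prodCat (A i) (K i)) ⟶
          TwoCat.mk (Coprod fun i => prodCat (A' i) (K i)) from
        map (fun i => i) (fun i => prodMap (TwoCat.fn (F i)) (K i)))) :=
  weakEquivalences_diagDoubleNerve_map
    (fun i => (show prodCat (A i) (K i) ⟶ prodCat (A' i) (K i) from
      prodMap (TwoCat.fn (F i)) (K i)))
    fun i => TwoCategory.weakEquivalences_diagDoubleNerve_map_prodMap (K i) (F i)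
      ((weakEquivalences_iff _).2 (hF i))

end Coprod

theorem isHomotopyEquivalence_classifyingSpaceSimplicial_map {S T : SimplicialObject TwoCat.{u}}
    (F : S ⟶ T) (hF : ∀ p, weakEquivalences (diagDoubleNerve.map (F.app p))) :
    IsHomotopyEquivalence (classifyingSpaceSimplicial.map F) :=
  (weakEquivalences_iff _).1
    (weakEquivalences_diag (((SimplicialObject.whiskering _ _).obj diagDoubleNerve).map F) hF)

end TwoCategory

theorem mainTheorem2 {C : Type u} [Bicategory.{u, u} C] [Bicategory.Strict C] :
    (∀ (D E : StrictPseudofunctor C TwoCat.{u}) (Γ : TwoNatTrans D E),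
      (∀ c : C, IsWeakEquivalence (Γ.app c)) →
        IsHomotopyEquivalence (classifyingSpaceSimplicial.map (hocolimMap Γ))) ∧
    (∀ (D E : StrictPseudofunctor Cᵒᵖ TwoCat.{u}) (Γ : TwoNatTrans D E),
      (∀ c : C, IsWeakEquivalence (Γ.app (op c))) →
        IsHomotopyEquivalence (classifyingSpaceSimplicial.map (hocolimOpMap Γ))) := by
  refine ⟨fun D E Γ hΓ => ?_, fun D E Γ hΓ => ?_⟩
  · exact isHomotopyEquivalence_classifyingSpaceSimplicial_map _ fun p =>
      Coprod.weakEquivalences_diagDoubleNerve_map_prodMap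
        (fun c : Fin (p.unop.len + 1) → C => Γ.app (c 0))
        (fun c => hΓ (c 0)) (fun c => Chain c)
  · exact isHomotopyEquivalence_classifyingSpaceSimplicial_map _ fun p =>
      Coprod.weakEquivalences_diagDoubleNerve_map_prodMap
        (fun c : Fin (p.unop.len + 1) → C => Γ.app (op (c (Fin.last _))))
        (fun c => hΓ (c (Fin.last _))) (fun c => Chain c)
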